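/- Let $q$ be a prime power, let $V$ be a vector space of dimension $n$ over the finite field $\mathbb{F}_q$, and let $k$ be an integer with $2 \le k \le n/2$. Three distinct $k$-dimensional subspaces $A, B, C$ of $V$ form a *covering triple* if $A = (A \cap B) \oplus (A \cap C)$, and a *3-cluster* if $A \cap B \cap C = \{0\}$ and $\dim(A+B+C) \le 2k$. A family (set) $\mathcal{F}$ of $k$-dimensional subspaces of $V$ is *covering-triple-free* (respectively *3-cluster-free*) if no three of its members, in any order, form a covering triple (respectively a 3-cluster), and it is a *star* if all its members contain a common one-dimensional subspace. The *full star* with centre a one-dimensional subspace $L \subseteq V$ is the family of all $k$-dimensional subspaces of $V$ containing $L$. Write $[m]_q = q^{m-1} + \cdots + q + 1$, $[m]_q! = [m]_q [m-1]_q \cdots [1]_q$ and $\binom{m}{j}_q = \dfrac{[m]_q!}{[j]_q!\,[m-j]_q!}$ for $0 \le j \le m$. Then: 1. Every covering-triple-free family $\mathcal{F}$ of $k$-dimensional subspaces of $V$ satisfies $|\mathcal{F}| \le \binom{n-1}{k-1}_q$. If moreover $k < n/2$ and $|\mathcal{F}| = \binom{n-1}{k-1}_q$, then $\mathcal{F}$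 is a full star. 2. Every covering triple is a 3-cluster, and the same bound, and for $k < n/2$ the same uniqueness, hold for every 3-cluster-free family $\mathcal{F}$ of $k$-dimensional subspaces of $V$. 3. Every star of $k$-dimensional subspaces of $V$ is both covering-triple-free and 3-cluster-free, and every full star has exactly $\binom{n-1}{k-1}_q$ members; so the bound is attained in both cases. -/

import Mathlib

namespace SubspaceCluster

/-- The `q`-integer `[m]_q = q^(m-1) + ⋯ + q + 1`, as a rational number. -/
def qInt (q m : ℕ) : ℚ := ∑ i ∈ Finset.range m, (q : ℚ) ^ i

/-- The `q`-factorial `[m]_q! = [m]_q [m-1]_q ⋯ [1]_q`. -/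
def qFactorial (q m : ℕ) : ℚ := ∏ j ∈ Finset.range m, qInt q (j + 1)

/-- The Gaussian binomial coefficient `[m]_q! / ([j]_q! [m-j]_q!)`, for `j ≤ m`. -/
def gaussBinom (q m j : ℕ) : ℚ :=
  qFactorial q m / (qFactorial q j * qFactorial q (m - j))

variable {K V : Type*} [Field K] [AddCommGroup V] [Module K V]

/-- `F` is a family of `k`-dimensional subspaces of `V`. -/
def IsFamily (k : ℕ) (F : Set (Submodule K V)) : Prop :=
  ∀ A ∈ F, Module.finrank K A = k

/-- Three (distinct) `k`-dimensional subspaces `A`, `B`, `C` form a covering triple if `A` is the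
internal direct sum of `A ∩ B` and `A ∩ C`. -/
structure IsCoveringTriple (k : ℕ) (A B C : Submodule K V) : Prop where
  finrank_left : Module.finrank K A = k
  finrank_mid : Module.finrank K B = k
  finrank_right : Module.finrank K C = k
  ne_left_mid : A ≠ B
  ne_left_right : A ≠ C
  ne_mid_right : B ≠ C
  sum_eq : (A ⊓ B) ⊔ (A ⊓ C) = A
  disjoint : (A ⊓ B) ⊓ (A ⊓ C) = ⊥

/-- Three (distinct) `k`-dimensional subspaces `A`, `B`, `C` form a 3-cluster if
`A ∩ B ∩ C = 0` and `dim (A + B + C) ≤ 2k`. -/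
structure IsThreeCluster (k : ℕ) (A B C : Submodule K V) : Prop where
  finrank_left : Module.finrank K A = k
  finrank_mid : Module.finrank K B = k
  finrank_right : Module.finrank K C = k
  ne_left_mid : A ≠ B
  ne_left_right : A ≠ C
  ne_mid_right : B ≠ C
  inf_eq : A ⊓ B ⊓ C = ⊥
  finrank_sup_le : Module.finrank K (A ⊔ B ⊔ C : Submodule K V) ≤ 2 * k

/-- No three members of `F`, in any order, form a covering triple. -/
def CoveringTripleFree (k : ℕ) (F : Set (Submodule K V)) : Prop :=
  ∀ A ∈ F, ∀ B ∈ F, ∀ C ∈ F, ¬ IsCoveringTriple k A B C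

/-- No three members of `F` form a 3-cluster. -/
def ThreeClusterFree (k : ℕ) (F : Set (Submodule K V)) : Prop :=
  ∀ A ∈ F, ∀ B ∈ F, ∀ C ∈ F, ¬ IsThreeCluster k A B C

/-- The full star with centre `L`: all `k`-dimensional subspaces containing `L`. -/
def fullStar (k : ℕ) (L : Submodule K V) : Set (Submodule K V) :=
  {A | Module.finrank K A = k ∧ L ≤ A}

/-- `F` is a star: all its members contain a common one-dimensional subspace. -/
def IsStar (F : Set (Submodule K V)) : Prop :=
  ∃ L : Submodule K V, Module.finrank K L = 1 ∧ ∀ A ∈ F, L ≤ A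

end SubspaceCluster

open SubspaceCluster

/-! Call one- and two-dimensional spaces points and lines, write [m] for the q-integer, and let D =
[n-k+1] be the number of k-spaces above a (k-1)-space. The bound comes from a weight-shifting
argument: every member distributes weights over its hyperplanes so that no (k-1)-space receives more
than 1 in total (`om_le_one`). If every member gave away at least [n]/D, then |F|·[n]/D would be at
most the number of (k-1)-spaces, which is the desired bound. In a full star this works exactly: a
member gives 1 to each hyperplane missing the centre, which lies in no other member, and 1/D to each
hyperplane through it, which lies in D members.

In general, call two members adjacent if they meet in dimension k-1. A member is good if some point
of it lies in all adjacent members; it then behaves as in a star. A bad member B never meets a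
member in a single point P, since an adjacent C missing P would give B = (B ∩ C) ⊕ P. On each
hyperplane that lies in no other bad member, B takes what the good members leave. Good members
inside a common (k+1)-space above B share a point, so they cost B no more than it can afford
(`good_inside`, `dg_mul_cstar_identity`). The loss on hyperplanes shared by several bad members is
charged to the points L of B missed by some adjacent bad E (`loss_le`). Averaging over points
(`cstar_mul_card_le`) leaves a local inequality at each L: the weight on (k-1)-spaces through L,
plus the charge, is at most the number of these spaces.

At a charged point the inequality is strict (`local_lt`). Every member through L meets E in
dimension at least two, so in V/L the weighted spaces all meet a fixed k-space T, and the charged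
members become an intersecting family of (k-1)-spaces meeting T in at least a line. This family is
small by a spectral bound for cross-intersecting weights (`cross_weights`, `cross_families`),
applied to points and to lines of T, followed by numerical estimates. The tight case q = 2, n = 2k
needs a second such space T'.

Equality excludes charged points and makes every estimate sharp. A bad member would then lie in two
local stars with different centres, from which a covering triple is built (`bad_eq_empty`). With all
members good, the centre is transported from member to member (`ctr_eq`, `mem_of_ctr_le`), so the
family is a full star. The statements on 3-clusters follow because a covering triple is a 3-cluster.
-/

namespace SubspaceCluster

noncomputable section

open Module Finset
open scoped Classical

/-! ### q-integers, Gaussian binomials and extension numbers. -/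

section Numbers

/-- The `q`-integer `[m]_q`, as a real number. -/
def qn (q : ℝ) (m : ℕ) : ℝ := ∑ i ∈ range m, q ^ i

/-- The Gaussian binomial coefficient, as a real number. -/
def gb (q : ℝ) : ℕ → ℕ → ℝ
  | _, 0 => 1
  | 0, _ + 1 => 0
  | n + 1, k + 1 => qn q (n + 1) / qn q (k + 1) * gb q n k

variable {q : ℝ}

@[simp] lemma qn_zero : qn q 0 = 0 := by simp [qn]
@[simp] lemma qn_one : qn q 1 = 1 := by simp [qn]
lemma qn_succ (m : ℕ) : qn q (m + 1) = qn q m + q ^ m := by simp [qn, sum_range_succ]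
lemma qn_add (a b : ℕ) : qn q (a + b) = qn q a + q ^ a * qn q b := by
  simp [qn, sum_range_add, pow_add, mul_sum]
lemma qn_succ' (m : ℕ) : qn q (m + 1) = 1 + q * qn q m := by
  rw [add_comm, qn_add]; simp
lemma qn_mul (m : ℕ) : qn q m * (q - 1) = q ^ m - 1 := by
  simp [qn, geom_sum_mul]

lemma qn_sub {a b : ℕ} (h : a ≤ b) : qn q b - qn q a = q ^ a * qn q (b - a) := by
  obtain ⟨c, rfl⟩ := Nat.exists_eq_add_of_le h
  rw [qn_add]; simp

lemma qn_nonneg (hq : 0 < q) (m : ℕ) : 0 ≤ qn q m := by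
  unfold qn; positivity

lemma qn_pos (hq : 0 < q) {m : ℕ} (hm : 0 < m) : 0 < qn q m := by
  obtain ⟨m, rfl⟩ := Nat.exists_eq_add_of_lt hm
  rw [Nat.zero_add, qn_succ]
  have := qn_nonneg hq m
  positivity

lemma qn_mono (hq : 0 < q) {a b : ℕ} (h : a ≤ b) : qn q a ≤ qn q b := by
  have := qn_sub (q := q) h
  have := mul_nonneg (pow_pos hq a).le (qn_nonneg hq (b - a))
  linarith

lemma qn_lt (hq : 0 < q) {a b : ℕ} (h : a < b) : qn q a < qn q b := by
  have h1 := qn_sub (q := q) h.le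
  have := mul_pos (pow_pos hq a) (qn_pos hq (Nat.sub_pos_of_lt h))
  linarith

@[simp] lemma gb_zero_right (n : ℕ) : gb q n 0 = 1 := by cases n <;> rfl
@[simp] lemma gb_zero_succ (k : ℕ) : gb q 0 (k + 1) = 0 := rfl
lemma gb_succ_succ (n k : ℕ) :
    gb q (n + 1) (k + 1) = qn q (n + 1) / qn q (k + 1) * gb q n k := rfl

lemma gb_mul (hq : 0 < q) (n k : ℕ) :
    qn q (k + 1) * gb q (n + 1) (k + 1) = qn q (n + 1) * gb q n k := by
  have := (qn_pos hq (Nat.succ_pos k)).ne'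
  rw [gb_succ_succ]; field_simp

lemma gb_nonneg (hq : 0 < q) (n k : ℕ) : 0 ≤ gb q n k := by
  induction n generalizing k with
  | zero => cases k <;> simp
  | succ n ih =>
    cases k with
    | zero => simp
    | succ k =>
      rw [gb_succ_succ]
      exact mul_nonneg (div_nonneg (qn_nonneg hq _) (qn_nonneg hq _)) (ih k)

lemma gb_pos (hq : 0 < q) {n k : ℕ} (h : k ≤ n) : 0 < gb q n k := by
  induction n generalizing k with
  | zero => obtain rfl : k = 0 := by omega
            simp
  | succ n ih =>
    cases k with
    | zero => simp
    | succ k =>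
      rw [gb_succ_succ]
      exact mul_pos (div_pos (qn_pos hq (by omega)) (qn_pos hq (by omega))) (ih (by omega))

lemma gb_eq_zero {n k : ℕ} (h : n < k) : gb q n k = 0 := by
  induction n generalizing k with
  | zero => obtain ⟨k, rfl⟩ := Nat.exists_eq_succ_of_ne_zero h.ne'
            rfl
  | succ n ih =>
    obtain ⟨k, rfl⟩ := Nat.exists_eq_succ_of_ne_zero (show k ≠ 0 by omega)
    rw [Nat.succ_eq_add_one, gb_succ_succ, ih (by omega), mul_zero]

lemma gb_self (hq : 0 < q) (n : ℕ) : gb q n n = 1 := by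
  induction n with
  | zero => simp
  | succ n ih =>
    rw [gb_succ_succ, ih, div_self (qn_pos hq (Nat.succ_pos n)).ne', one_mul]

lemma gb_one (n : ℕ) : gb q n 1 = qn q n := by
  cases n with
  | zero => simp
  | succ n => rw [show (1 : ℕ) = 0 + 1 from rfl, gb_succ_succ]; simp

lemma gb_absorb (hq : 0 < q) (n k : ℕ) :
    q ^ k * qn q (k + 1) * gb q n (k + 1) = (qn q n - qn q k) * gb q n k := by
  induction n generalizing k with
  | zero => cases k <;> simp
  | succ n ih =>
    cases k with
    | zero => simp [gb_one]
    | succ k =>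
      have h1 := gb_mul hq n (k + 1)
      have h2 := gb_mul hq n k
      have h3 := ih k
      have h4 := (qn_pos hq (Nat.succ_pos k)).ne'
      have e : qn q (n + 1) - qn q (k + 1) = q * (qn q n - qn q k) := by
        rw [qn_succ', qn_succ']; ring
      apply mul_left_cancel₀ h4
      calc qn q (k + 1) * (q ^ (k + 1) * qn q (k + 1 + 1) * gb q (n + 1) (k + 1 + 1))
          = q * qn q (n + 1) * (q ^ k * qn q (k + 1) * gb q n (k + 1)) := by
            rw [show qn q (k + 1) * (q ^ (k + 1) * qn q (k + 1 + 1) * gb q (n + 1) (k + 1 + 1))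
              = q ^ (k + 1) * qn q (k + 1) * (qn q (k + 1 + 1) * gb q (n + 1) (k + 1 + 1)) by ring,
              h1]; ring
        _ = _ := by
            rw [h3, e, show qn q (k + 1) * (q * (qn q n - qn q k) * gb q (n + 1) (k + 1))
              = q * (qn q n - qn q k) * (qn q (k + 1) * gb q (n + 1) (k + 1)) by ring, h2]; ring

lemma gb_pascal (hq : 0 < q) (n k : ℕ) :
    gb q (n + 1) (k + 1) = gb q n k + q ^ (k + 1) * gb q n (k + 1) := by
  have h1 := gb_mul hq n k
  have h2 := gb_absorb hq n k
  apply mul_left_cancel₀ (qn_pos hq (Nat.succ_pos k)).ne'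
  rw [Nat.succ_eq_add_one, h1, qn_succ' n]
  have e := qn_succ' (q := q) k
  linear_combination (-gb q n k) * e - q * h2

lemma gb_succ_self (hq : 0 < q) (n : ℕ) : gb q (n + 1) n = qn q (n + 1) := by
  induction n with
  | zero => simp
  | succ n ih =>
    rw [gb_succ_succ, ih]
    have := (qn_pos hq (Nat.succ_pos n)).ne'
    field_simp

/-- The alternating `q`-binomial sum vanishes. -/
lemma sum_gb_alternating (hq : 0 < q) (n : ℕ) :
    ∑ i ∈ range (n + 2), (-1) ^ i * q ^ (i.choose 2) * gb q (n + 1) i = 0 := by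
  rw [sum_range_succ']
  -- The q-Pascal rule writes each term as a difference, so the sum telescopes to a multiple of a
  -- binomial that vanishes.
  have h : ∀ i, (-1 : ℝ) ^ (i + 1) * q ^ ((i + 1).choose 2) * gb q (n + 1) (i + 1)
      = (-1) ^ (i + 1) * q ^ ((i + 1 + 1).choose 2) * gb q n (i + 1)
        - (-1) ^ i * q ^ ((i + 1).choose 2) * gb q n i := by
    intro i
    rw [gb_pascal hq, Nat.choose_succ_succ' (i + 1) 1, Nat.choose_one_right, pow_add, pow_succ]
    ring
  simp_rw [h]
  rw [sum_range_sub (fun i => (-1 : ℝ) ^ i * q ^ ((i + 1).choose 2) * gb q n i)]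
  simp [gb_eq_zero]

/-- The number of ways to extend a subspace by `e` dimensions in codimension `N`,
keeping the intersection with a space of relative dimension `b`. -/
def dc (q : ℝ) : ℕ → ℕ → ℕ → ℝ
  | _, _, 0 => 1
  | N, b, e + 1 => (qn q N - qn q b) / qn q (e + 1) * dc q (N - 1) b e

lemma dc_zero (N b : ℕ) : dc q N b 0 = 1 := by cases N <;> rfl
lemma dc_succ (N b e : ℕ) :
    dc q N b (e + 1) = (qn q N - qn q b) / qn q (e + 1) * dc q (N - 1) b e := by cases N <;> rfl

lemma dc_mul (hq : 0 < q) (N b e : ℕ) :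
    dc q N b (e + 1) * qn q (e + 1) = (qn q N - qn q b) * dc q (N - 1) b e := by
  have := (qn_pos hq (Nat.succ_pos e)).ne'
  rw [dc_succ]; field_simp

/-- Each factor of the recursion equals q^b here. This case counts the lifts of a space from a
quotient. -/
lemma dc_compl (hq : 0 < q) (b e : ℕ) : dc q (b + e) b e = q ^ (b * e) := by
  induction e with
  | zero => simp [dc_zero]
  | succ e ih =>
    have := (qn_pos hq (Nat.succ_pos e)).ne'
    rw [dc_succ, qn_add, show b + (e + 1) - 1 = b + e by omega, ih]
    field_simp
    ring

lemma dc_pos (hq : 0 < q) {N b e : ℕ} (h : b + e ≤ N) : 0 < dc q N b e := by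
  induction e generalizing N with
  | zero => simp [dc_zero]
  | succ e ih =>
    rw [dc_succ]
    exact mul_pos (div_pos (sub_pos.2 (qn_lt hq (by omega))) (qn_pos hq (by omega)))
      (ih (by omega))

end Numbers

/-! ### Counting subspaces over a finite field. -/

section Counting

set_option linter.unusedSectionVars false

variable (K V : Type*) [Field K] [Fintype K] [AddCommGroup V] [Module K V] [FiniteDimensional K V]

instance submoduleFintype : Fintype (Submodule K V) :=
  haveI : Finite V := Module.finite_of_finite K
  Fintype.ofFinite _

/-- The `k`-dimensional subspaces of `V`. -/
def Gr (k : ℕ) : Finset (Submodule K V) := univ.filter (fun W => finrank K W = k)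

/-- The order of the field, as a real number. -/
def qr : ℝ := Fintype.card K

lemma two_le_qr : 2 ≤ qr K := by
  unfold qr
  exact_mod_cast Fintype.one_lt_card (α := K)

lemma qr_pos : 0 < qr K := by linarith [two_le_qr K]

variable {K V}

@[simp] lemma mem_Gr {k : ℕ} {W : Submodule K V} : W ∈ Gr K V k ↔ finrank K W = k := by simp [Gr]

lemma card_Gr_one : ((Gr K V 1).card : ℝ) = qn (qr K) (finrank K V) := by
  have h := Projectivization.card_of_finrank K V (n := finrank K V) rfl
  have e : Nat.card (Projectivization K V) = (Gr K V 1).card := by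
    rw [Nat.card_congr (Projectivization.equivSubmodule K V), Nat.card_eq_fintype_card,
      Fintype.card_subtype]
    simp [Gr]
  rw [← e, h]
  simp [qn, qr]

lemma finrank_map_subtype (A : Submodule K V) (W : Submodule K A) :
    finrank K (W.map A.subtype) = finrank K W :=
  (LinearEquiv.finrank_eq (Submodule.equivMapOfInjective A.subtype A.subtype_injective W)).symm

lemma card_filter_le (A : Submodule K V) (k : ℕ) :
    ((Gr K V k).filter (· ≤ A)).card = (Gr K A k).card := by
  symm
  refine card_bij (fun W _ => W.map A.subtype) ?_ ?_ ?_
  · intro W hW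
    simp only [mem_filter, mem_Gr] at hW ⊢
    refine ⟨?_, Submodule.map_subtype_le A W⟩
    rw [← hW]
    exact finrank_map_subtype A W
  · intro W _ W' _ h
    exact Submodule.map_injective_of_injective A.subtype_injective h
  · intro W hW
    simp only [mem_filter, mem_Gr] at hW
    refine ⟨W.comap A.subtype, ?_, ?_⟩
    · rw [mem_Gr, ← hW.1]
      have := finrank_map_subtype A (W.comap A.subtype)
      rw [← this, Submodule.map_comap_subtype, inf_eq_right.2 hW.2]
    · simp [Submodule.map_comap_subtype, hW.2]

lemma finrank_comap_mkQ (S : Submodule K V) (Y : Submodule K (V ⧸ S)) :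
    finrank K (Y.comap S.mkQ) = finrank K Y + finrank K S := by
  have h := LinearMap.finrank_range_add_finrank_ker (S.mkQ.domRestrict (Y.comap S.mkQ))
  rw [← h]
  congr 1
  · rw [LinearMap.range_domRestrict, Submodule.map_comap_eq_of_surjective S.mkQ_surjective]
  · have hS : S ≤ Y.comap S.mkQ := by
      intro x hx
      have : S.mkQ x = 0 := by simpa using hx
      simp [Submodule.mem_comap, this]
    have : LinearMap.ker (S.mkQ.domRestrict (Y.comap S.mkQ)) = S.comap (Y.comap S.mkQ).subtype := by
      ext x; simp
    rw [this]
    exact LinearEquiv.finrank_eq (Submodule.comapSubtypeEquivOfLe hS)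

lemma finrank_map_mkQ {S W : Submodule K V} (h : S ≤ W) :
    finrank K (W.map S.mkQ) + finrank K S = finrank K W := by
  rw [← finrank_comap_mkQ, Submodule.comap_map_eq, Submodule.ker_mkQ, sup_eq_left.2 h]

lemma card_filter_ge (S : Submodule K V) (k : ℕ) :
    ((Gr K V (k + finrank K S)).filter (S ≤ ·)).card = (Gr K (V ⧸ S) k).card := by
  symm
  refine card_bij (fun Y _ => Y.comap S.mkQ) ?_ ?_ ?_
  · intro Y hY
    simp only [mem_filter, mem_Gr] at hY ⊢
    refine ⟨by rw [finrank_comap_mkQ, hY], ?_⟩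
    rw [← Submodule.map_le_iff_le_comap]
    simp
  · intro Y _ Y' _ h
    exact Submodule.comap_injective_of_surjective S.mkQ_surjective h
  · intro W hW
    simp only [mem_filter, mem_Gr] at hW
    refine ⟨W.map S.mkQ, ?_, ?_⟩
    · have := finrank_map_mkQ hW.2
      rw [mem_Gr]; omega
    · rw [Submodule.comap_map_eq, Submodule.ker_mkQ, sup_eq_left.2 hW.2]

lemma card_points_le (A : Submodule K V) :
    (((Gr K V 1).filter (· ≤ A)).card : ℝ) = qn (qr K) (finrank K A) := by
  rw [card_filter_le, card_Gr_one]

lemma sum_card_filter_comm {α β : Type*} (s : Finset α) (t : Finset β) (r : α → β → Prop) :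
    ∑ a ∈ s, (((t.filter (r a)).card : ℕ) : ℝ) = ∑ b ∈ t, ((s.filter (fun a => r a b)).card : ℝ) := by
  have := sum_card_bipartiteAbove_eq_sum_card_bipartiteBelow (s := s) (t := t) r
  exact_mod_cast this

/-- Double counting of points L inside (k+1)-spaces W. The W through L correspond to k-spaces of V ⧸
L, so the induction must range over all ambient spaces. -/
theorem card_Gr (k : ℕ) : ((Gr K V k).card : ℝ) = gb (qr K) (finrank K V) k := by
  induction k generalizing V with
  | zero =>
    have : Gr K V 0 = {⊥} := by ext W; simp [Submodule.finrank_eq_zero]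
    simp [this]
  | succ k ih =>
    have hq := qr_pos K
    have h := sum_card_filter_comm (Gr K V 1) (Gr K V (k + 1)) (fun L W => L ≤ W)
    have h1 : ∀ L ∈ Gr K V 1, (((Gr K V (k + 1)).filter (fun W => L ≤ W)).card : ℝ)
        = gb (qr K) (finrank K V - 1) k := by
      intro L hL
      rw [mem_Gr] at hL
      have e := card_filter_ge L k
      rw [hL] at e
      rw [e, ih]
      have := Submodule.finrank_quotient_add_finrank L
      rw [show finrank K V - 1 = finrank K (V ⧸ L) by omega]
    have h2 : ∀ W ∈ Gr K V (k + 1), (((Gr K V 1).filter (fun L => L ≤ W)).card : ℝ)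
        = qn (qr K) (k + 1) := by
      intro W hW
      rw [card_points_le, mem_Gr.1 hW]
    rw [sum_congr rfl h1, sum_congr rfl h2, sum_const, sum_const, nsmul_eq_mul, nsmul_eq_mul,
      card_Gr_one] at h
    rcases Nat.eq_zero_or_pos (finrank K V) with h0 | h0
    · have : Gr K V (k + 1) = ∅ := by
        ext W
        have := Submodule.finrank_le W
        simp; omega
      simp [this, h0]
    · obtain ⟨m, hm⟩ := Nat.exists_eq_add_of_lt h0
      rw [hm] at h ⊢
      simp only [zero_add, Nat.add_sub_cancel] at h ⊢
      rw [← gb_mul hq m k] at h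
      have := (qn_pos hq (Nat.succ_pos k)).ne'
      apply mul_left_cancel₀ this
      rw [Nat.succ_eq_add_one]
      linarith

theorem card_between {S A : Submodule K V} (hSA : S ≤ A) (j : ℕ) :
    (((Gr K V (finrank K S + j)).filter (fun W => S ≤ W ∧ W ≤ A)).card : ℝ)
      = gb (qr K) (finrank K A - finrank K S) j := by
  have hS : finrank K (S.comap A.subtype) = finrank K S :=
    LinearEquiv.finrank_eq (Submodule.comapSubtypeEquivOfLe hSA)
  have e := card_filter_ge (S.comap A.subtype) j
  have q1 := Submodule.finrank_quotient_add_finrank (S.comap A.subtype)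
  have c := card_Gr (K := K) (V := A ⧸ S.comap A.subtype) j
  rw [show finrank K (A ⧸ S.comap A.subtype) = finrank K A - finrank K S by omega] at c
  rw [← c, ← e, hS]
  norm_cast
  symm
  refine card_bij (fun W _ => W.map A.subtype) ?_ ?_ ?_
  · intro W hW
    simp only [mem_filter, mem_Gr] at hW ⊢
    refine ⟨?_, ?_, Submodule.map_subtype_le A W⟩
    · rw [finrank_map_subtype]; omega
    · calc S = (S.comap A.subtype).map A.subtype := by
            rw [Submodule.map_comap_subtype, inf_eq_right.2 hSA]
        _ ≤ _ := Submodule.map_mono hW.2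
  · intro W _ W' _ h
    exact Submodule.map_injective_of_injective A.subtype_injective h
  · intro W hW
    simp only [mem_filter, mem_Gr] at hW
    refine ⟨W.comap A.subtype, ?_, ?_⟩
    · simp only [mem_filter, mem_Gr]
      refine ⟨?_, Submodule.comap_mono hW.2.1⟩
      have := LinearEquiv.finrank_eq (Submodule.comapSubtypeEquivOfLe hW.2.2)
      omega
    · simp [Submodule.map_comap_subtype, hW.2.2]

theorem card_superspaces (S : Submodule K V) (j : ℕ) :
    (((Gr K V (finrank K S + j)).filter (fun W => S ≤ W)).card : ℝ)
      = gb (qr K) (finrank K V - finrank K S) j := by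
  have := card_between (le_top : S ≤ ⊤) j
  simpa using this

/-- Extensions `D` of `S` inside `U` which do not enlarge the intersection with `A`. -/
theorem card_extensions {A U : Submodule K V} (hA : A ≤ U) (e : ℕ) :
    ∀ {S : Submodule K V}, S ≤ U →
    (((Gr K V (finrank K S + e)).filter (fun D => S ≤ D ∧ D ≤ U ∧ D ⊓ A = S ⊓ A)).card : ℝ)
      = dc (qr K) (finrank K U - finrank K S) (finrank K A - finrank K (S ⊓ A : Submodule K V)) e := by
  have hq := qr_pos K
  induction e with
  | zero =>
    intro S hS
    have : (Gr K V (finrank K S + 0)).filter (fun D => S ≤ D ∧ D ≤ U ∧ D ⊓ A = S ⊓ A) = {S} := by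
      ext D
      simp only [mem_filter, mem_Gr, mem_singleton, add_zero]
      constructor
      · rintro ⟨h1, h2, -⟩
        exact (Submodule.eq_of_le_of_finrank_eq h2 h1.symm).symm
      · rintro rfl; exact ⟨rfl, le_rfl, hS, rfl⟩
    rw [this, dc_zero]; simp
  | succ e ih =>
    intro S hS
    set P := S ⊓ A with hP
    set 𝒟 := (Gr K V (finrank K S + (e + 1))).filter (fun D => S ≤ D ∧ D ≤ U ∧ D ⊓ A = P)
    set 𝒮 := (Gr K V (finrank K S + 1)).filter (fun T => S ≤ T ∧ T ≤ U ∧ T ⊓ A = P)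
    -- A one-dimensional enlargement of S enlarges the intersection with A exactly when it lies in S
    -- ⊔ A. The admissible enlargements are therefore counted by a difference of two q-integers.
    have hsup : ∀ T : Submodule K V, finrank K T = finrank K S + 1 → S ≤ T →
        (T ≤ S ⊔ A ↔ T ⊓ A ≠ P) := by
      intro T hT hST
      constructor
      · intro h he
        have : T = S ⊔ (A ⊓ T) := by
          rw [← sup_inf_assoc_of_le A hST, inf_eq_right.2 h]
        rw [inf_comm, he, hP, sup_eq_left.2 inf_le_left] at this
        rw [this] at hT; omega
      · intro h
        have hle : P ≤ T ⊓ A := by rw [hP]; exact inf_le_inf_right A hST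
        have h1 : ¬ T ⊓ A ≤ S := fun h' => h (le_antisymm (le_inf h' inf_le_right) hle)
        have h2 : S < S ⊔ (T ⊓ A) := left_lt_sup.2 h1
        have h3 := Submodule.finrank_lt_finrank_of_lt h2
        have h4 : S ⊔ (T ⊓ A) ≤ T := sup_le hST inf_le_left
        have h5 : S ⊔ (T ⊓ A) = T := Submodule.eq_of_le_of_finrank_le h4 (by omega)
        rw [← h5]; exact sup_le_sup_left inf_le_right S
    have c𝒮 : (𝒮.card : ℝ) = qn (qr K) (finrank K U - finrank K S)
        - qn (qr K) (finrank K A - finrank K P) := by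
      have c1 := card_between hS 1
      have c2 := card_between (le_sup_left : S ≤ S ⊔ A) 1
      rw [gb_one] at c1 c2
      have hd : finrank K (S ⊔ A : Submodule K V) - finrank K S = finrank K A - finrank K P := by
        have := Submodule.finrank_sup_add_finrank_inf_eq S A
        rw [← hP] at this
        omega
      rw [hd] at c2
      rw [← c1, ← c2, eq_sub_iff_add_eq]
      norm_cast
      rw [← card_union_of_disjoint]
      · congr 1
        ext T
        simp only [mem_union, mem_filter, mem_Gr, 𝒮]
        constructor
        · rintro (⟨h1, h2, h3, -⟩ | ⟨h1, h2, h3⟩)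
          · exact ⟨h1, h2, h3⟩
          · exact ⟨h1, h2, h3.trans (sup_le hS hA)⟩
        · rintro ⟨h1, h2, h3⟩
          by_cases h : T ⊓ A = P
          · exact Or.inl ⟨h1, h2, h3, h⟩
          · exact Or.inr ⟨h1, h2, (hsup T h1 h2).2 h⟩
      · rw [Finset.disjoint_left]
        intro T hT hT'
        simp only [mem_filter, mem_Gr, 𝒮] at hT hT'
        exact (hsup T hT.1 hT.2.1).1 hT'.2.2 hT.2.2.2
    -- Double count pairs T ≤ D: any T between S and D is automatically admissible, and the
    -- induction hypothesis counts the D above a given T.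
    have h := sum_card_filter_comm 𝒟 𝒮 (fun D T => T ≤ D)
    have h1 : ∀ D ∈ 𝒟, ((𝒮.filter (fun T => T ≤ D)).card : ℝ) = qn (qr K) (e + 1) := by
      intro D hD
      simp only [mem_filter, mem_Gr, 𝒟] at hD
      have c := card_between hD.2.1 1
      rw [gb_one, hD.1, Nat.add_sub_cancel_left] at c
      rw [← c]
      congr 2
      ext T
      simp only [mem_filter, mem_Gr, 𝒮]
      constructor
      · rintro ⟨⟨h1, h2, -⟩, h3⟩; exact ⟨h1, h2, h3⟩
      · rintro ⟨h1, h2, h3⟩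
        refine ⟨⟨h1, h2, h3.trans hD.2.2.1, ?_⟩, h3⟩
        apply le_antisymm
        · rw [← hD.2.2.2]; exact inf_le_inf_right A h3
        · rw [hP]; exact inf_le_inf_right A h2
    have h2 : ∀ T ∈ 𝒮, ((𝒟.filter (fun D => T ≤ D)).card : ℝ)
        = dc (qr K) (finrank K U - finrank K S - 1) (finrank K A - finrank K P) e := by
      intro T hT
      simp only [mem_filter, mem_Gr, 𝒮] at hT
      have c := ih hT.2.2.1
      rw [hT.2.2.2, hT.1] at c
      rw [Nat.sub_sub, ← c]
      congr 2
      ext D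
      simp only [mem_filter, mem_Gr, 𝒟]
      constructor
      · rintro ⟨⟨h1, h2, h3, h4⟩, h5⟩; exact ⟨by omega, h5, h3, h4⟩
      · rintro ⟨h1, h2, h3, h4⟩; exact ⟨⟨by omega, hT.2.1.trans h2, h3, h4⟩, h2⟩
    rw [sum_congr rfl h1, sum_congr rfl h2, sum_const, sum_const, nsmul_eq_mul, nsmul_eq_mul,
      c𝒮, ← dc_mul hq] at h
    exact mul_right_cancel₀ (qn_pos hq (Nat.succ_pos e)).ne' h

end Counting


/-! ### Symmetric relations, eigenvectors and orthogonality. -/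

section LinearAlgebra

/-- Every vector splits into a combination of given vectors and a vector orthogonal to them. -/
lemma exists_orthogonal_split {α β : Type*} [Fintype α] [Fintype β] (v : β → α → ℝ) (g : α → ℝ) :
    ∃ (c : β → ℝ) (g₀ : α → ℝ), (∀ a, g a = g₀ a + ∑ b, c b * v b a) ∧
      ∀ b, ∑ a, v b a * g₀ a = 0 := by
  let w : β → EuclideanSpace ℝ α := fun b => WithLp.toLp 2 (v b)
  obtain ⟨y, hy, z, hz, h⟩ := (Submodule.span ℝ (Set.range w)).exists_add_mem_mem_orthogonal
    (WithLp.toLp 2 g)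
  obtain ⟨c, hc⟩ := (Submodule.mem_span_range_iff_exists_fun ℝ).1 hy
  refine ⟨c, fun a => z a, fun a => ?_, fun b => ?_⟩
  · have h1 : g a = (y + z) a := by rw [← h]
    have h2 : y a = ∑ b, c b * v b a := by
      rw [← hc]; simp [w]
    rw [h1, ← h2]; simp [add_comm]
  · have := (Submodule.mem_orthogonal _ _).1 hz (w b) (Submodule.subset_span ⟨b, rfl⟩)
    rw [PiLp.inner_apply] at this
    rw [← this]
    exact sum_congr rfl fun a _ => by simp [w, mul_comm]

variable {α : Type*} (s : Finset α)

/-- The standard bilinear form on functions, restricted to a finite set. -/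
def ip (f g : α → ℝ) : ℝ := ∑ a ∈ s, f a * g a

/-- The adjacency operator of a relation on a finite set. -/
def adjOp (r : α → α → Prop) (f : α → ℝ) (a : α) : ℝ := ∑ b ∈ s with r b a, f b

lemma ip_adjOp {r : α → α → Prop} (hr : ∀ a b, r a b → r b a) (f g : α → ℝ) :
    ip s (adjOp s r f) g = ip s f (adjOp s r g) := by
  simp only [ip, adjOp, sum_filter, sum_mul, mul_sum]
  rw [sum_comm]
  refine sum_congr rfl fun a _ => sum_congr rfl fun b _ => ?_
  have : r a b ↔ r b a := ⟨hr a b, hr b a⟩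
  simp [this]

lemma ip_comm (f g : α → ℝ) : ip s f g = ip s g f := sum_congr rfl fun _ _ => mul_comm _ _

lemma ip_self_nonneg (f : α → ℝ) : 0 ≤ ip s f f := sum_nonneg fun a _ => mul_self_nonneg (f a)

lemma ip_sum_left {k : ℕ} {x : α → ℝ} {xs : ℕ → α → ℝ}
    (hx : ∀ a ∈ s, x a = ∑ i ∈ range k, xs i a) (g : α → ℝ) :
    ip s x g = ∑ i ∈ range k, ip s (xs i) g := by
  simp only [ip]
  rw [sum_comm]
  exact sum_congr rfl fun a ha => by rw [hx a ha, sum_mul]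

variable {s}

lemma ip_sq_le (f g : α → ℝ) : ip s f g ^ 2 ≤ ip s f f * ip s g g := by
  have := sum_mul_sq_le_sq_mul_sq s f g
  simpa [ip, sq] using this

lemma ip_eigen_orthogonal {r : α → α → Prop} (hr : ∀ a b, r a b → r b a) {f g : α → ℝ} {l m : ℝ}
    (hf : ∀ a ∈ s, adjOp s r f a = l * f a) (hg : ∀ a ∈ s, adjOp s r g a = m * g a) (h : l ≠ m) :
    ip s f g = 0 := by
  have h1 := ip_adjOp s hr f g
  have h2 : ip s (adjOp s r f) g = l * ip s f g := by
    simp only [ip, mul_sum]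
    exact sum_congr rfl fun a ha => by rw [hf a ha]; ring
  have h3 : ip s f (adjOp s r g) = m * ip s f g := by
    simp only [ip, mul_sum]
    exact sum_congr rfl fun a ha => by rw [hg a ha]; ring
  rw [h2, h3] at h1
  have : (l - m) * ip s f g = 0 := by linarith
  exact (mul_eq_zero.1 this).resolve_left (sub_ne_zero.2 h)

/-- If `x` and `y` have no adjacent pairs in their supports, the component along the first
eigenspace is controlled by the remaining components. -/
lemma eigen_cross {r : α → α → Prop} (hr : ∀ a b, r a b → r b a) {k : ℕ} {lam : ℕ → ℝ} {b : ℝ}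
    (hlam : ∀ i ≤ k, ∀ j ≤ k, i ≠ j → lam i ≠ lam j)
    (hb : ∀ i < k, |lam (i + 1)| ≤ b) {x y : α → ℝ} {xs ys : ℕ → α → ℝ}
    (hx : ∀ a ∈ s, x a = ∑ i ∈ range (k + 1), xs i a)
    (hy : ∀ a ∈ s, y a = ∑ i ∈ range (k + 1), ys i a)
    (ex : ∀ i ≤ k, ∀ a ∈ s, adjOp s r (xs i) a = lam i * xs i a)
    (ey : ∀ i ≤ k, ∀ a ∈ s, adjOp s r (ys i) a = lam i * ys i a)
    (h0 : ∀ a ∈ s, ∀ c ∈ s, r c a → x a * y c = 0) :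
    (lam 0 * ip s (xs 0) (ys 0)) ^ 2 ≤
      b ^ 2 * ((ip s x x - ip s (xs 0) (xs 0)) * (ip s y y - ip s (ys 0) (ys 0))) := by
  -- Components for different eigenvalues are orthogonal, so inner products are diagonal in the
  -- decomposition.
  have expand : ∀ {x y : α → ℝ} {xs ys : ℕ → α → ℝ}
      (_ : ∀ a ∈ s, x a = ∑ i ∈ range (k + 1), xs i a)
      (_ : ∀ a ∈ s, y a = ∑ i ∈ range (k + 1), ys i a)
      (_ : ∀ i ≤ k, ∀ a ∈ s, adjOp s r (xs i) a = lam i * xs i a)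
      (_ : ∀ i ≤ k, ∀ a ∈ s, adjOp s r (ys i) a = lam i * ys i a),
      ip s x y = ∑ i ∈ range (k + 1), ip s (xs i) (ys i) := by
    intro x y xs ys hx hy ex ey
    rw [ip_sum_left s hx]
    refine sum_congr rfl fun i hi => ?_
    rw [ip_comm, ip_sum_left s hy, sum_eq_single i]
    · exact ip_comm _ _ _
    · intro j hj hji
      rw [mem_range] at hi hj
      exact ip_eigen_orthogonal hr (ey j (by omega)) (ex i (by omega))
        (hlam j (by omega) i (by omega) hji)
    · intro h; exact absurd hi h
  have hzero : ip s x (adjOp s r y) = 0 := by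
    simp only [ip, adjOp, mul_sum]
    refine sum_eq_zero fun a ha => sum_eq_zero fun c hc => ?_
    rw [mem_filter] at hc
    exact h0 a ha c hc.1 hc.2
  have hTy : ∀ a ∈ s, adjOp s r y a = ∑ i ∈ range (k + 1), lam i * ys i a := by
    intro a ha
    have : adjOp s r y a = ∑ i ∈ range (k + 1), adjOp s r (ys i) a := by
      simp only [adjOp]
      rw [sum_comm]
      exact sum_congr rfl fun c hc => hy c (mem_filter.1 hc).1
    rw [this]
    exact sum_congr rfl fun i hi => ey i (by rw [mem_range] at hi; omega) a ha
  have h1 : ip s x (adjOp s r y) = ∑ i ∈ range (k + 1), lam i * ip s (xs i) (ys i) := by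
    have ey' : ∀ i ≤ k, ∀ a ∈ s, adjOp s r (fun a => lam i * ys i a) a
        = lam i * (lam i * ys i a) := by
      intro i hi a ha
      have := ey i hi a ha
      simp only [adjOp] at this ⊢
      rw [← mul_sum, this]
    rw [expand (ys := fun i a => lam i * ys i a) hx hTy ex ey']
    refine sum_congr rfl fun i _ => ?_
    simp only [ip, mul_sum]
    exact sum_congr rfl fun a _ => by ring
  have h2 := expand hx hx ex ex
  have h3 := expand hy hy ey ey
  rw [sum_range_succ'] at h1 h2 h3
  -- Writing T for the adjacency operator, 0 = ⟨x, T y⟩ = ∑ λᵢ ⟨xᵢ, yᵢ⟩ expresses the zeroth term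
  -- through the others. These are bounded by Cauchy–Schwarz, first inside each eigenspace and then
  -- across the eigenspaces.
  have e1 : lam 0 * ip s (xs 0) (ys 0) =
      - ∑ i ∈ range k, lam (i + 1) * ip s (xs (i + 1)) (ys (i + 1)) := by
    rw [hzero] at h1; linarith
  have e2 : ip s x x - ip s (xs 0) (xs 0) = ∑ i ∈ range k, ip s (xs (i + 1)) (xs (i + 1)) := by
    linarith
  have e3 : ip s y y - ip s (ys 0) (ys 0) = ∑ i ∈ range k, ip s (ys (i + 1)) (ys (i + 1)) := by
    linarith
  rw [e1, e2, e3, neg_sq]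
  rcases Nat.eq_zero_or_pos k with rfl | hk
  · simp
  have hb0 : 0 ≤ b := (abs_nonneg _).trans (hb 0 hk)
  have h4 : |∑ i ∈ range k, lam (i + 1) * ip s (xs (i + 1)) (ys (i + 1))| ≤
      b * ∑ i ∈ range k, √(ip s (xs (i + 1)) (xs (i + 1))) * √(ip s (ys (i + 1)) (ys (i + 1))) := by
    refine (abs_sum_le_sum_abs _ _).trans ?_
    rw [mul_sum]
    refine sum_le_sum fun i hi => ?_
    rw [abs_mul]
    refine mul_le_mul (hb i (mem_range.1 hi)) ?_ (abs_nonneg _) hb0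
    rw [← Real.sqrt_mul (ip_self_nonneg _ _)]
    exact Real.abs_le_sqrt (ip_sq_le _ _)
  have h5 := sum_mul_sq_le_sq_mul_sq (range k) (fun i => √(ip s (xs (i + 1)) (xs (i + 1))))
    (fun i => √(ip s (ys (i + 1)) (ys (i + 1))))
  simp only [Real.sq_sqrt (ip_self_nonneg _ _)] at h5
  rw [← sq_abs]
  calc _ ≤ (b * ∑ i ∈ range k, √(ip s (xs (i + 1)) (xs (i + 1)))
          * √(ip s (ys (i + 1)) (ys (i + 1)))) ^ 2 := pow_le_pow_left₀ (abs_nonneg _) h4 2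
    _ ≤ _ := by rw [mul_pow]; exact mul_le_mul_of_nonneg_left h5 (sq_nonneg b)

end LinearAlgebra

/-! ### Spectrum of the disjointness relation on k-spaces, and weighted cross-intersection. -/

section Spectral

set_option linter.unusedSectionVars false

variable {K V : Type*} [Field K] [Fintype K] [AddCommGroup V] [Module K V] [FiniteDimensional K V]

/-- The Möbius function of the subspace lattice, as a function of the dimension. -/
def mob (q : ℝ) (i : ℕ) : ℝ := (-1) ^ i * q ^ (i.choose 2)

lemma sum_mob (U : Submodule K V) :
    ∑ T : Submodule K V with T ≤ U, mob (qr K) (finrank K T) = if U = ⊥ then 1 else 0 := by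
  have h : ∑ T : Submodule K V with T ≤ U, mob (qr K) (finrank K T)
      = ∑ i ∈ range (finrank K U + 1), mob (qr K) i * gb (qr K) (finrank K U) i := by
    rw [← sum_fiberwise_of_maps_to (s := univ.filter (· ≤ U)) (t := range (finrank K U + 1))
      (g := fun T => finrank K T)]
    · refine sum_congr rfl fun i _ => ?_
      rw [← card_Gr, ← card_filter_le, sum_congr rfl (g := fun _ => mob (qr K) i)]
      · rw [sum_const, nsmul_eq_mul, mul_comm]
        congr 3
        ext T; simp [and_comm]
      · intro T hT
        simp only [mem_filter] at hT
        rw [hT.2]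
    · intro T hT
      simp only [mem_filter] at hT
      have := Submodule.finrank_mono hT.2
      simp only [mem_range]; omega
  rw [h]
  split_ifs with hU
  · subst hU; simp [mob]
  · have hpos : finrank K U ≠ 0 := fun h0 => hU (Submodule.finrank_eq_zero.1 h0)
    obtain ⟨m, hm⟩ := Nat.exists_eq_succ_of_ne_zero hpos
    rw [hm]
    exact sum_gb_alternating (qr_pos K) m

/-- The function on subspaces obtained by summing over the `j`-dimensional subspaces below. -/
def up (j : ℕ) (g : Submodule K V → ℝ) (A : Submodule K V) : ℝ :=
  ∑ S ∈ (Gr K V j).filter (· ≤ A), g S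

/-- `g` has zero sum over the `j`-spaces above any smaller subspace. -/
def ZeroSums (j : ℕ) (g : Submodule K V → ℝ) : Prop :=
  ∀ T : Submodule K V, finrank K T < j → ∑ S ∈ (Gr K V j).filter (T ≤ ·), g S = 0

/-- Möbius inversion over the T below S ⊓ A, followed by exchanging the sums. Those T of dimension
below j are killed by the zero sums, those above j lie in no j-space, and those of dimension j force
S = T. -/
lemma ZeroSums.sum_disjoint {j : ℕ} {g : Submodule K V → ℝ} (hg : ZeroSums j g)
    (A : Submodule K V) :
    ∑ S ∈ (Gr K V j).filter (fun S => S ⊓ A = ⊥), g S = mob (qr K) j * up j g A := by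
  have h1 : ∑ S ∈ (Gr K V j).filter (fun S => S ⊓ A = ⊥), g S
      = ∑ S ∈ Gr K V j, ∑ T : Submodule K V,
        if T ≤ A then (if T ≤ S then mob (qr K) (finrank K T) * g S else 0) else 0 := by
    rw [sum_filter]
    refine sum_congr rfl fun S _ => ?_
    have := sum_mob (S ⊓ A)
    rw [show (if S ⊓ A = ⊥ then g S else 0) = (if S ⊓ A = ⊥ then 1 else 0) * g S by
      split_ifs <;> simp, ← this, sum_filter, sum_mul]
    refine sum_congr rfl fun T _ => ?_
    by_cases hA : T ≤ A <;> by_cases hS : T ≤ S <;> simp [hA, hS]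
  rw [h1, sum_comm]
  have h2 : ∀ T : Submodule K V, (∑ S ∈ Gr K V j,
      if T ≤ A then (if T ≤ S then mob (qr K) (finrank K T) * g S else 0) else 0)
      = if T ∈ (Gr K V j).filter (· ≤ A) then mob (qr K) j * g T else 0 := by
    intro T
    by_cases hA : T ≤ A
    · simp only [hA, if_true, mem_filter, mem_Gr, and_true]
      rw [← sum_filter, ← mul_sum]
      rcases lt_trichotomy (finrank K T) j with h | h | h
      · rw [hg T h, if_neg h.ne]; simp
      · rw [if_pos h, h]
        congr 1
        have : (Gr K V j).filter (T ≤ ·) = {T} := by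
          ext S
          simp only [mem_filter, mem_Gr, mem_singleton]
          constructor
          · rintro ⟨h1, h2⟩
            exact (Submodule.eq_of_le_of_finrank_eq h2 (by omega)).symm
          · rintro rfl; exact ⟨h, le_rfl⟩
        rw [this, sum_singleton]
      · have : (Gr K V j).filter (T ≤ ·) = ∅ := by
          ext S
          simp only [mem_filter, mem_Gr, notMem_empty, iff_false]
          rintro ⟨h1, h2⟩
          have := Submodule.finrank_mono h2
          omega
        rw [if_neg h.ne', this]; simp
    · simp [hA]
  simp_rw [h2]
  rw [sum_ite_mem, univ_inter, up, mul_sum]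

/-- The eigenvalues of the disjointness relation on `k`-spaces. -/
def lam (q : ℝ) (n k j : ℕ) : ℝ := mob q j * dc q (n - j) k (k - j)

/-- The disjointness relation. -/
def Disj (A B : Submodule K V) : Prop := A ⊓ B = ⊥

lemma Disj.symm {A B : Submodule K V} (h : Disj A B) : Disj B A := by
  unfold Disj at *; rwa [inf_comm]

/-- A j-space S disjoint from A lies in the same number of k-spaces disjoint from A, whichever S it
is, and any other S lies in none. What remains is `ZeroSums.sum_disjoint`, so lifts of zero-sum
functions are eigenvectors. -/
lemma ZeroSums.adjOp_up {j k : ℕ} (hj : j ≤ k) {g : Submodule K V → ℝ} (hg : ZeroSums j g)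
    {A : Submodule K V} (hA : A ∈ Gr K V k) :
    adjOp (Gr K V k) Disj (up j g) A = lam (qr K) (finrank K V) k j * up j g A := by
  rw [lam, mul_right_comm, ← hg.sum_disjoint]
  have e : adjOp (Gr K V k) Disj (up j g) A
      = ∑ D ∈ (Gr K V k).filter (fun D => D ⊓ A = ⊥), up j g D :=
    sum_congr (by ext; rw [mem_filter, mem_filter]; rfl) fun _ _ => rfl
  rw [e]
  simp only [up]
  simp_rw [sum_filter (s := Gr K V j)]
  rw [sum_comm, sum_mul]
  refine sum_congr rfl fun S hS => ?_
  rw [mem_Gr] at hS hA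
  rw [← sum_filter, filter_filter, sum_const, nsmul_eq_mul]
  by_cases h : S ⊓ A = ⊥
  · have c := card_extensions (le_top : A ≤ ⊤) (k - j) (le_top : S ≤ ⊤)
    rw [h, hS, hA, show j + (k - j) = k by omega] at c
    simp only [finrank_top, finrank_bot, Nat.sub_zero] at c
    rw [if_pos h, mul_comm, ← c]
    congr 3
    ext D
    simp only [le_top, true_and, and_comm]
  · rw [if_neg h, zero_mul]
    have : (Gr K V k).filter (fun D => D ⊓ A = ⊥ ∧ S ≤ D) = ∅ := by
      ext D
      simp only [mem_filter, notMem_empty, iff_false]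
      rintro ⟨-, h1, h2⟩
      exact h (eq_bot_iff.2 (h1 ▸ inf_le_inf_right A h2))
    rw [this]; simp

lemma up_up {j k : ℕ} (h : Submodule K V → ℝ) {A : Submodule K V} (hA : A ∈ Gr K V k) :
    up (j + 1) (up j h) A = qn (qr K) (k - j) * up j h A := by
  simp only [up]
  simp_rw [sum_filter (s := Gr K V j)]
  rw [sum_comm, mul_sum]
  refine sum_congr rfl fun T hT => ?_
  rw [mem_Gr] at hT hA
  rw [← sum_filter, filter_filter, sum_const, nsmul_eq_mul]
  by_cases hTA : T ≤ A
  · have c := card_between hTA 1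
    rw [hT, hA, gb_one] at c
    rw [if_pos hTA, ← c]
    congr 4
    ext W; tauto
  · have : (Gr K V (j + 1)).filter (fun S => S ≤ A ∧ T ≤ S) = ∅ := by
      ext D
      simp only [mem_filter, notMem_empty, iff_false]
      rintro ⟨-, h1, h2⟩
      exact hTA (h2.trans h1)
    rw [if_neg hTA, this]; simp

/-- Sum the hypothesis over the j-spaces above a smaller T: each S above T is hit the same positive
number of times. -/
lemma zeroSums_of_pred {j : ℕ} {g : Submodule K V → ℝ}
    (h : ∀ T ∈ Gr K V j, ∑ S ∈ (Gr K V (j + 1)).filter (T ≤ ·), g S = 0) : ZeroSums (j + 1) g := by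
  intro T hT
  have h1 : ∑ T' ∈ (Gr K V j).filter (T ≤ ·), ∑ S ∈ (Gr K V (j + 1)).filter (T' ≤ ·), g S = 0 :=
    sum_eq_zero fun T' hT' => h T' (mem_filter.1 hT').1
  simp_rw [sum_filter (s := Gr K V (j + 1))] at h1
  rw [sum_comm] at h1
  have h2 : ∀ S ∈ Gr K V (j + 1), (∑ T' ∈ (Gr K V j).filter (T ≤ ·), if T' ≤ S then g S else 0)
      = gb (qr K) (j + 1 - finrank K T) (j - finrank K T) * (if T ≤ S then g S else 0) := by
    intro S hS
    rw [mem_Gr] at hS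
    rw [← sum_filter, filter_filter, sum_const, nsmul_eq_mul]
    split_ifs with hTS
    · have c := card_between hTS (j - finrank K T)
      rw [hS, show finrank K T + (j - finrank K T) = j by omega] at c
      rw [← c]
    · have : (Gr K V j).filter (fun D => T ≤ D ∧ D ≤ S) = ∅ := by
        ext D
        simp only [mem_filter, notMem_empty, iff_false]
        rintro ⟨-, h1, h2⟩
        exact hTS (h1.trans h2)
      rw [this]; simp
  rw [sum_congr rfl h2, ← mul_sum, ← sum_filter] at h1
  exact (mul_eq_zero.1 h1).resolve_left (gb_pos (qr_pos K) (by omega)).ne'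

/-- Split g into a part orthogonal to the incidence vectors of the j-spaces, which has zero sums,
and a combination of these vectors, which has the form `up j c`. On k-spaces, lifting the latter
from level j + 1 is by `up_up` a multiple of lifting c directly from level j, so the induction
descends. -/
lemma exists_eigen_decomposition {k : ℕ} (j : ℕ) (g : Submodule K V → ℝ) :
    ∃ h : ℕ → Submodule K V → ℝ, (∀ i, ZeroSums i (h i)) ∧
      ∀ A ∈ Gr K V k, up j g A = ∑ i ∈ range (j + 1), up i (h i) A := by
  induction j generalizing g with
  | zero =>
    refine ⟨fun i => if i = 0 then g else 0, ?_, ?_⟩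
    · intro i T hT
      have : i ≠ 0 := by omega
      simp [this]
    · intro A _; simp
  | succ j ih =>
    obtain ⟨c, g₀, h1, h2⟩ := exists_orthogonal_split
      (fun (T S : Submodule K V) => if T ∈ Gr K V j ∧ S ∈ Gr K V (j + 1) ∧ T ≤ S then (1 : ℝ) else 0) g
    have hz : ZeroSums (j + 1) g₀ := by
      refine zeroSums_of_pred fun T hT => ?_
      rw [← h2 T, ← sum_filter_add_sum_filter_not univ (fun S => S ∈ Gr K V (j + 1) ∧ T ≤ S),
        eq_comm, add_eq_left.2]
      · symm
        refine sum_congr ?_ ?_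
        · ext S; simp
        · intro S hS
          simp only [mem_filter] at hS
          rw [if_pos ⟨hT, hS.2⟩, one_mul]
      · refine sum_eq_zero fun S hS => ?_
        simp only [mem_filter] at hS
        rw [if_neg (fun h => hS.2 h.2), zero_mul]
    obtain ⟨h, hh1, hh2⟩ := ih (fun T => qn (qr K) (k - j) * c T)
    refine ⟨fun i => if i = j + 1 then g₀ else h i, ?_, ?_⟩
    · intro i
      dsimp only
      split_ifs with hi
      · subst hi; exact hz
      · exact hh1 i
    · intro A hA
      rw [sum_range_succ]
      simp only [if_true]
      have e : ∑ i ∈ range (j + 1), up i (if i = j + 1 then g₀ else h i) A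
          = ∑ i ∈ range (j + 1), up i (h i) A :=
        sum_congr rfl fun i hi => by rw [if_neg (by rw [mem_range] at hi; omega)]
      rw [e, ← hh2 A hA]
      have e2 : up j (fun T => qn (qr K) (k - j) * c T) A = up (j + 1) (up j c) A := by
        rw [up_up c hA]; simp only [up, mul_sum]
      rw [e2]
      simp only [up]
      rw [← sum_add_distrib]
      refine sum_congr rfl fun S hS => ?_
      rw [h1 S, add_comm]
      congr 1
      have hS' := (mem_filter.1 hS).1
      have e3 : (Gr K V j).filter (· ≤ S)
          = univ.filter (fun T => T ∈ Gr K V j ∧ S ∈ Gr K V (j + 1) ∧ T ≤ S) := by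
        ext T
        simp only [mem_filter, mem_univ, true_and, hS']
      rw [e3, sum_filter]
      exact sum_congr rfl fun T _ => by rw [mul_ite, mul_one, mul_zero]

lemma up_self {k : ℕ} (f : Submodule K V → ℝ) {A : Submodule K V} (hA : A ∈ Gr K V k) :
    up k f A = f A := by
  rw [mem_Gr] at hA
  have : (Gr K V k).filter (· ≤ A) = {A} := by
    ext S
    simp only [mem_filter, mem_Gr, mem_singleton]
    constructor
    · rintro ⟨h1, h2⟩
      exact Submodule.eq_of_le_of_finrank_eq h2 (by omega)
    · rintro rfl; exact ⟨hA, le_rfl⟩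
  rw [up, this, sum_singleton]

lemma up_zero (f : Submodule K V → ℝ) (A : Submodule K V) : up 0 f A = f ⊥ := by
  have : (Gr K V 0).filter (· ≤ A) = {⊥} := by
    ext S
    simp only [mem_filter, mem_Gr, mem_singleton, Submodule.finrank_eq_zero]
    constructor
    · rintro ⟨h1, -⟩; exact h1
    · rintro rfl; exact ⟨rfl, bot_le⟩
  rw [up, this, sum_singleton]

section Eigenvalues

variable {q : ℝ}

lemma abs_mob (hq : 0 < q) (j : ℕ) : |mob q j| = q ^ (j.choose 2) := by
  rw [mob, abs_mul, abs_pow, abs_neg, abs_one, one_pow, one_mul, abs_of_pos (pow_pos hq _)]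

lemma abs_lam (hq : 0 < q) {n k j : ℕ} (hn : 2 * k ≤ n) (hj : j ≤ k) :
    |lam q n k j| = q ^ (j.choose 2) * dc q (n - j) k (k - j) := by
  rw [lam, abs_mul, abs_mob hq, abs_of_pos (dc_pos hq (by omega))]

lemma abs_lam_succ (hq : 0 < q) {n k j : ℕ} (hn : 2 * k ≤ n) (hj : j < k) :
    |lam q n k (j + 1)| * (q ^ k * qn q (n - j - k)) = |lam q n k j| * (q ^ j * qn q (k - j)) := by
  rw [abs_lam hq hn hj, abs_lam hq hn hj.le]
  have := dc_mul hq (n - j) k (k - (j + 1))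
  rw [show k - (j + 1) + 1 = k - j by omega, qn_sub (by omega), Nat.sub_sub n j 1] at this
  have e : (j + 1).choose 2 = j + j.choose 2 := by
    rw [Nat.choose_succ_succ' j 1, Nat.choose_one_right]
  rw [e, pow_add]
  linear_combination (-(q ^ j * q ^ j.choose 2)) * this

/-- Consecutive absolute values have ratio q^j [k-j] / (q^k [n-j-k]), which is below 1 because 2k ≤
n. Strict decrease makes the eigenvalues distinct and leaves |λ₁| as the largest after λ₀. -/
lemma abs_lam_succ_lt (hq : 1 < q) {n k j : ℕ} (hn : 2 * k ≤ n) (hj : j < k) :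
    |lam q n k (j + 1)| < |lam q n k j| := by
  have hq0 : 0 < q := by linarith
  have h := abs_lam_succ hq0 hn hj
  have h1 : q ^ j * qn q (k - j) < q ^ k * qn q (n - j - k) := by
    have a := pow_lt_pow_right₀ hq hj
    have b := qn_mono hq0 (show k - j ≤ n - j - k by omega)
    have c := qn_pos hq0 (show 0 < k - j by omega)
    exact mul_lt_mul a b c (pow_pos hq0 k).le
  have h2 : 0 < |lam q n k j| := by
    rw [abs_lam hq0 hn hj.le]
    exact mul_pos (pow_pos hq0 _) (dc_pos hq0 (by omega))
  by_contra hcon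
  rw [not_lt] at hcon
  have h3 : 0 < q ^ j * qn q (k - j) := mul_pos (pow_pos hq0 _) (qn_pos hq0 (by omega))
  nlinarith [mul_lt_mul_of_pos_left h1 h2, mul_le_mul_of_nonneg_right hcon (h3.trans h1).le]

lemma abs_lam_lt (hq : 1 < q) {n k i j : ℕ} (hn : 2 * k ≤ n) (hj : j ≤ k) (hij : i < j) :
    |lam q n k j| < |lam q n k i| := by
  induction j, hij using Nat.le_induction with
  | base => exact abs_lam_succ_lt hq hn hj
  | succ j _ ih => exact (abs_lam_succ_lt hq hn hj).trans (ih (by omega))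

end Eigenvalues

/-- Put t = √(ξη). By the arithmetic–geometric mean inequality (f-ξ)(f-η) ≤ (f-t)², so the
hypothesis, after inserting l₀ / l₁ = a / b, becomes a t ≤ b (f - t). -/
lemma cross_quadratic {ξ η f a b l₀ l₁ N : ℝ} (hξ : 0 ≤ ξ) (hη : 0 ≤ η) (hξf : ξ ≤ f)
    (hηf : η ≤ f) (ha : 0 < a) (hb : 0 < b) (hl : 0 < l₀) (hN : 0 < N) (hr : l₁ * a = l₀ * b)
    (h : l₀ ^ 2 * (N * (ξ * η)) ^ 2 ≤
      l₁ ^ 2 * ((N * (ξ * (f - ξ))) * (N * (η * (f - η))))) :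
    ξ * η ≤ (f * (b / (a + b))) ^ 2 := by
  rcases (mul_nonneg hξ hη).eq_or_lt with h0 | hpos
  · rw [← h0]; positivity
  have hf : 0 ≤ f := hξ.trans hξf
  have b3 : a ^ 2 * (ξ * η) ≤ b ^ 2 * ((f - ξ) * (f - η)) := by
    have hp : 0 < l₀ ^ 2 * (N ^ 2 * (ξ * η)) := by positivity
    refine le_of_mul_le_mul_left ?_ hp
    have e1 := mul_le_mul_of_nonneg_left h (sq_nonneg a)
    calc _ = a ^ 2 * (l₀ ^ 2 * (N * (ξ * η)) ^ 2) := by ring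
      _ ≤ _ := e1
      _ = (l₁ * a) ^ 2 * (N ^ 2 * (ξ * η)) * ((f - ξ) * (f - η)) := by ring
      _ = _ := by rw [hr]; ring
  obtain ⟨t, ht0, ht2⟩ : ∃ t, 0 ≤ t ∧ t ^ 2 = ξ * η :=
    ⟨√(ξ * η), Real.sqrt_nonneg _, Real.sq_sqrt hpos.le⟩
  have htf : t ≤ f := by
    refine abs_le_of_sq_le_sq' ?_ hf |>.2
    rw [ht2, sq]
    exact mul_le_mul hξf hηf hη hf
  have hamgm : 2 * t ≤ ξ + η := by
    refine abs_le_of_sq_le_sq' ?_ (add_nonneg hξ hη) |>.2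
    rw [mul_pow, ht2]
    linarith [sq_nonneg (ξ - η)]
  have b4 : (f - ξ) * (f - η) ≤ (f - t) ^ 2 := by
    linarith [mul_le_mul_of_nonneg_left hamgm hf]
  have b5 : (a * t) ^ 2 ≤ (b * (f - t)) ^ 2 := by
    rw [mul_pow, mul_pow, ht2]
    exact b3.trans (mul_le_mul_of_nonneg_left b4 (sq_nonneg _))
  have b6 := (abs_le_of_sq_le_sq' b5 (mul_nonneg hb.le (by linarith))).2
  have b7 : t ≤ f * (b / (a + b)) := by
    rw [← mul_div_assoc, le_div_iff₀ (by linarith)]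
    linarith
  rw [← ht2]
  exact pow_le_pow_left₀ ht0 b7 2

/-- The weighted cross-intersection theorem: two weight functions on `k`-spaces bounded by `f₀`
without disjoint pairs in their supports. -/
theorem cross_weights {k : ℕ} (hk : 1 ≤ k) (hn : 2 * k ≤ finrank K V) {f₀ : ℝ}
    {x y : Submodule K V → ℝ} (hx : ∀ A ∈ Gr K V k, 0 ≤ x A ∧ x A ≤ f₀)
    (hy : ∀ A ∈ Gr K V k, 0 ≤ y A ∧ y A ≤ f₀)
    (h : ∀ A ∈ Gr K V k, ∀ B ∈ Gr K V k, A ⊓ B = ⊥ → x A * y B = 0) :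
    (∑ A ∈ Gr K V k, x A) * (∑ A ∈ Gr K V k, y A) ≤
      (f₀ * gb (qr K) (finrank K V) k * qn (qr K) k / qn (qr K) (finrank K V)) ^ 2 := by
  set n := finrank K V with hn'
  set q := qr K with hq'
  set s := Gr K V k with hs
  have hq1 : 1 < q := by have := two_le_qr K; linarith
  have hq : 0 < q := by linarith
  obtain ⟨hX, zX, eX⟩ := exists_eigen_decomposition (k := k) k x
  obtain ⟨hY, zY, eY⟩ := exists_eigen_decomposition (k := k) k y
  have key := eigen_cross (s := s) (r := Disj) (fun _ _ h => h.symm) (k := k) (lam := lam q n k)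
    (b := |lam q n k 1|)
    (by
      intro i hi j hj hij he
      rcases lt_or_gt_of_ne hij with hlt | hlt
      · exact (abs_lam_lt hq1 hn hj hlt).ne (by rw [he])
      · exact (abs_lam_lt hq1 hn hi hlt).ne (by rw [he]))
    (by
      intro i hi
      rcases Nat.eq_zero_or_pos i with rfl | h0
      · simp
      · exact (abs_lam_lt hq1 hn hi (by omega)).le)
    (x := x) (y := y) (xs := fun i => up i (hX i)) (ys := fun i => up i (hY i))
    (fun a ha => by rw [← eX a ha, up_self x ha])
    (fun a ha => by rw [← eY a ha, up_self y ha])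
    (fun i hi a ha => (zX i).adjOp_up hi ha)
    (fun i hi a ha => (zY i).adjOp_up hi ha)
    (fun a ha c hc hr => h a ha c hc hr.symm)
  have hN : (s.card : ℝ) = gb q n k := card_Gr k
  set N := gb q n k
  have hNpos : 0 < N := gb_pos hq (by omega)
  have hlam : ∀ i ≤ k, ∀ j ≤ k, i ≠ j → lam q n k i ≠ lam q n k j := by
    intro i hi j hj hij he
    rcases lt_or_gt_of_ne hij with hlt | hlt
    · exact (abs_lam_lt hq1 hn hj hlt).ne (by rw [he])
    · exact (abs_lam_lt hq1 hn hi hlt).ne (by rw [he])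
  -- The zeroth component is the constant `hZ 0 ⊥`. It is the mean of z, since the other components
  -- are orthogonal to constants.
  have total : ∀ (z : Submodule K V → ℝ) (hZ : ℕ → Submodule K V → ℝ), (∀ i, ZeroSums i (hZ i)) →
      (∀ A ∈ s, up k z A = ∑ i ∈ range (k + 1), up i (hZ i) A) →
      ∑ A ∈ s, z A = N * hZ 0 ⊥ := by
    intro z hZ zZ eZ
    have h1 : ∑ A ∈ s, z A = ip s z (up 0 (fun _ => 1)) := by
      simp [ip, up_zero]
    rw [h1, ip_sum_left s (xs := fun i => up i (hZ i)) (k := k + 1)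
      (fun a ha => by rw [← eZ a ha, up_self z ha]), sum_eq_single 0]
    · simp [ip, up_zero, ← hN]
    · intro i hi hi0
      have hone : ZeroSums 0 (fun _ : Submodule K V => (1 : ℝ)) := by intro T hT; omega
      exact ip_eigen_orthogonal (r := Disj) (fun _ _ h => h.symm)
        (fun a ha => (zZ i).adjOp_up (by rw [mem_range] at hi; omega) ha)
        (fun a ha => hone.adjOp_up (Nat.zero_le k) ha)
        (hlam i (by rw [mem_range] at hi; omega) 0 (Nat.zero_le k) hi0)
    · intro h0; simp at h0
  have tX := total x hX zX eX
  have tY := total y hY zY eY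
  set ξ := hX 0 ⊥
  set η := hY 0 ⊥
  have i1 : ip s (up 0 (hX 0)) (up 0 (hY 0)) = N * (ξ * η) := by
    simp [ip, up_zero, ← hN, ξ, η]
  have i2 : ip s (up 0 (hX 0)) (up 0 (hX 0)) = N * (ξ * ξ) := by
    simp [ip, up_zero, ← hN, ξ]
  have i3 : ip s (up 0 (hY 0)) (up 0 (hY 0)) = N * (η * η) := by
    simp [ip, up_zero, ← hN, η]
  have sqX : ip s x x ≤ f₀ * (N * ξ) := by
    rw [← tX, ip, mul_sum]
    exact sum_le_sum fun a ha => mul_le_mul_of_nonneg_right (hx a ha).2 (hx a ha).1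
  have sqY : ip s y y ≤ f₀ * (N * η) := by
    rw [← tY, ip, mul_sum]
    exact sum_le_sum fun a ha => mul_le_mul_of_nonneg_right (hy a ha).2 (hy a ha).1
  have hξ : 0 ≤ ξ := by
    have : 0 ≤ N * ξ := tX ▸ sum_nonneg fun a ha => (hx a ha).1
    exact nonneg_of_mul_nonneg_right this hNpos
  have hη : 0 ≤ η := by
    have : 0 ≤ N * η := tY ▸ sum_nonneg fun a ha => (hy a ha).1
    exact nonneg_of_mul_nonneg_right this hNpos
  have hξ' : ξ ≤ f₀ := by
    have : N * ξ ≤ N * f₀ := by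
      rw [← tX, ← hN, ← nsmul_eq_mul]
      exact sum_le_card_nsmul _ _ _ fun a ha => (hx a ha).2
    exact le_of_mul_le_mul_left this hNpos
  have hη' : η ≤ f₀ := by
    have : N * η ≤ N * f₀ := by
      rw [← tY, ← hN, ← nsmul_eq_mul]
      exact sum_le_card_nsmul _ _ _ fun a ha => (hy a ha).2
    exact le_of_mul_le_mul_left this hNpos
  simp only [i1, i2, i3] at key
  rw [tX, tY]
  have hf : 0 ≤ f₀ := hξ.trans hξ'
  have hqk : 0 < qn q k := qn_pos hq hk
  have hqn : 0 < qn q n := qn_pos hq (by omega)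
  have hdiff : 0 < qn q n - qn q k := sub_pos.2 (qn_lt hq (by omega))
  have hratio : |lam q n k 1| * (qn q n - qn q k) = |lam q n k 0| * qn q k := by
    have := abs_lam_succ hq hn (show 0 < k by omega)
    rw [qn_sub (by omega)]
    simpa using this
  have hl0 : 0 < |lam q n k 0| := by
    rw [abs_lam hq hn (Nat.zero_le k)]
    exact mul_pos (pow_pos hq _) (dc_pos hq (by omega))
  have main : ξ * η ≤ (f₀ * (qn q k / qn q n)) ^ 2 := by
    -- As 0 ≤ z ≤ f₀, the square norm of z is at most f₀ times its sum, which bounds the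
    -- non-constant part by N ζ (f₀ - ζ). Cauchy–Schwarz against the constant 1 shows that this part
    -- is nonnegative.
    have hN2 : ∀ {z : Submodule K V → ℝ} {ζ : ℝ}, ∑ A ∈ s, z A = N * ζ → ip s z z ≤ f₀ * (N * ζ) →
        0 ≤ ip s z z - N * (ζ * ζ) ∧ ip s z z - N * (ζ * ζ) ≤ N * (ζ * (f₀ - ζ)) := by
      intro z ζ tz sz
      have h2 := ip_sq_le (s := s) z (fun _ => 1)
      have e : ip s z (fun _ => 1) = N * ζ := by rw [← tz]; simp [ip]
      have e' : ip s (fun _ : Submodule K V => (1 : ℝ)) (fun _ => 1) = N := by simp [ip, hN]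
      rw [e, e'] at h2
      have h3 : N * (N * (ζ * ζ)) ≤ N * ip s z z := by linarith [h2]
      have h4 := le_of_mul_le_mul_left h3 hNpos
      exact ⟨by linarith, by linarith⟩
    obtain ⟨u1, u2⟩ := hN2 tX sqX
    obtain ⟨v1, v2⟩ := hN2 tY sqY
    have b1 : (lam q n k 0 * (N * (ξ * η))) ^ 2 ≤ |lam q n k 1| ^ 2 *
        ((N * (ξ * (f₀ - ξ))) * (N * (η * (f₀ - η)))) :=
      key.trans (mul_le_mul_of_nonneg_left (mul_le_mul u2 v2 v1 (u1.trans u2)) (sq_nonneg _))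
    rw [mul_pow, ← sq_abs (lam q n k 0)] at b1
    have := cross_quadratic hξ hη hξ' hη' hdiff hqk hl0 hNpos hratio b1
    rwa [sub_add_cancel] at this
  calc N * ξ * (N * η) = N ^ 2 * (ξ * η) := by ring
    _ ≤ N ^ 2 * (f₀ * (qn q k / qn q n)) ^ 2 := mul_le_mul_of_nonneg_left main (sq_nonneg N)
    _ = _ := by ring

end Spectral


/-- By q-Pascal, raising the dimension by one gains a factor of at least q^e. In `cross_families`
this absorbs the maximal weight on the quotient. -/
lemma gb_pow_le {q : ℝ} (hq : 0 < q) (n p e : ℕ) :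
    q ^ (p * e) * gb q n e ≤ gb q (n + p) e := by
  induction p with
  | zero => simp
  | succ p ih =>
    have h : q ^ e * gb q (n + p) e ≤ gb q (n + p + 1) e := by
      cases e with
      | zero => simp
      | succ e =>
        rw [gb_pascal hq]
        have := gb_nonneg hq (n + p) e
        linarith
    calc q ^ ((p + 1) * e) * gb q n e = q ^ e * (q ^ (p * e) * gb q n e) := by ring
      _ ≤ q ^ e * gb q (n + p) e := mul_le_mul_of_nonneg_left ih (pow_pos hq e).le
      _ ≤ _ := h

/-! ### Cross-intersecting families and intersecting families tied to a fixed space. -/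

section CrossFamilies

set_option linter.unusedSectionVars false

variable {K V : Type*} [Field K] [Fintype K] [AddCommGroup V] [Module K V] [FiniteDimensional K V]

/-- The weight on `V ⧸ Q` counting members of a family by their images. -/
def traceWeight (Q : Submodule K V) (𝒳 : Finset (Submodule K V)) (Y : Submodule K (V ⧸ Q)) : ℝ :=
  ((𝒳.filter (fun X => X.map Q.mkQ = Y)).card : ℝ)

lemma le_comap_map_mkQ (Q X : Submodule K V) : X ≤ (X.map Q.mkQ).comap Q.mkQ :=
  Submodule.le_comap_map _ _

lemma finrank_map_mkQ_add (Q X : Submodule K V) :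
    finrank K (X.map Q.mkQ) + finrank K (X ⊓ Q : Submodule K V) = finrank K X := by
  have h1 := finrank_comap_mkQ Q (X.map Q.mkQ)
  rw [Submodule.comap_map_eq, Submodule.ker_mkQ] at h1
  have h2 := Submodule.finrank_sup_add_finrank_inf_eq X Q
  omega

/-- Two families of `m`-spaces meeting `P ⊔ P'` in `P` and `P'` respectively, all of whose
members cross-intersect. -/
theorem cross_families {m p : ℕ} (hpm : p < m) (hN : 2 * m ≤ finrank K V) {P P' : Submodule K V}
    (hP : finrank K P = p) (hP' : finrank K P' = p) (hPP : P ⊓ P' = ⊥)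
    {𝒳 𝒳' : Finset (Submodule K V)} (h𝒳 : ∀ X ∈ 𝒳, finrank K X = m ∧ X ⊓ (P ⊔ P') = P)
    (h𝒳' : ∀ X ∈ 𝒳', finrank K X = m ∧ X ⊓ (P ⊔ P') = P')
    (hcross : ∀ X ∈ 𝒳, ∀ X' ∈ 𝒳', X ⊓ X' ≠ ⊥) :
    (𝒳.card : ℝ) * 𝒳'.card ≤
      (gb (qr K) (finrank K V - p) (m - p) * qn (qr K) (m - p) / qn (qr K) (finrank K V - 2 * p)) ^ 2
    := by
  set Q := P ⊔ P' with hQ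
  have hq := qr_pos K
  have hQd : finrank K Q = 2 * p := by
    have := Submodule.finrank_sup_add_finrank_inf_eq P P'
    rw [hPP, finrank_bot, hP, hP', ← hQ] at this
    omega
  have hd : finrank K (V ⧸ Q) = finrank K V - 2 * p := by
    have := Submodule.finrank_quotient_add_finrank Q
    omega
  -- The X with image Y and trace R on Q are extensions of R inside the preimage of Y that do not
  -- enlarge the intersection with Q. There are q^(p(m-p)) such extensions.
  have bound : ∀ {R : Submodule K V} {𝒵 : Finset (Submodule K V)}, finrank K R = p → R ≤ Q →
      (∀ X ∈ 𝒵, finrank K X = m ∧ X ⊓ Q = R) → ∀ Y ∈ Gr K (V ⧸ Q) (m - p),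
      0 ≤ traceWeight Q 𝒵 Y ∧ traceWeight Q 𝒵 Y ≤ qr K ^ (p * (m - p)) := by
    intro R 𝒵 hR hRQ h𝒵 Y hY
    rw [mem_Gr] at hY
    refine ⟨Nat.cast_nonneg _, ?_⟩
    have hQU : Q ≤ Y.comap Q.mkQ := by
      intro x hx
      have : Q.mkQ x = 0 := by simpa using hx
      simp [Submodule.mem_comap, this]
    have c := card_extensions hQU (m - p) (hRQ.trans hQU)
    rw [finrank_comap_mkQ, inf_eq_left.2 hRQ, hR, hY, hQd,
      show m - p + 2 * p - p = p + (m - p) by omega, show 2 * p - p = p by omega,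
      dc_compl hq] at c
    rw [← c, traceWeight]
    norm_cast
    refine card_le_card fun X hX => ?_
    rw [mem_filter] at hX
    obtain ⟨hX1, hX2⟩ := h𝒵 X hX.1
    rw [mem_filter, mem_Gr]
    refine ⟨by omega, hX2 ▸ inf_le_left, ?_, hX2⟩
    rw [← hX.2]; exact le_comap_map_mkQ Q X
  have total : ∀ {R : Submodule K V} {𝒵 : Finset (Submodule K V)}, finrank K R = p →
      (∀ X ∈ 𝒵, finrank K X = m ∧ X ⊓ Q = R) →
      ∑ Y ∈ Gr K (V ⧸ Q) (m - p), traceWeight Q 𝒵 Y = 𝒵.card := by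
    intro R 𝒵 hR h𝒵
    unfold traceWeight
    norm_cast
    rw [← card_eq_sum_card_fiberwise]
    intro X hX
    obtain ⟨hX1, hX2⟩ := h𝒵 X hX
    have := finrank_map_mkQ_add Q X
    rw [hX2] at this
    rw [mem_coe, mem_Gr]; omega
  -- Disjoint images would put X ⊓ X' inside Q, hence inside P ⊓ P' = ⊥. So cross-intersection
  -- survives in the quotient by Q.
  have key := cross_weights (K := K) (V := V ⧸ Q) (k := m - p) (by omega) (by omega)
    (bound hP le_sup_left h𝒳) (bound hP' le_sup_right h𝒳') (by
      intro Y hY Y' hY' hYY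
      by_contra hne
      rw [mul_eq_zero, not_or, traceWeight, traceWeight] at hne
      obtain ⟨X, hX⟩ : (𝒳.filter (fun X => X.map Q.mkQ = Y)).Nonempty := by
        rw [← card_ne_zero]; exact_mod_cast hne.1
      obtain ⟨X', hX'⟩ : (𝒳'.filter (fun X => X.map Q.mkQ = Y')).Nonempty := by
        rw [← card_ne_zero]; exact_mod_cast hne.2
      rw [mem_filter] at hX hX'
      apply hcross X hX.1 X' hX'.1
      have h1 : X ⊓ X' ≤ Q := by
        have : (X ⊓ X').map Q.mkQ ≤ ⊥ := by
          rw [← hYY, ← hX.2, ← hX'.2]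
          exact le_inf (Submodule.map_mono inf_le_left) (Submodule.map_mono inf_le_right)
        have h2 := (le_comap_map_mkQ Q (X ⊓ X')).trans (Submodule.comap_mono this)
        rwa [Submodule.comap_bot, Submodule.ker_mkQ] at h2
      rw [eq_bot_iff, ← hPP, ← (h𝒳 X hX.1).2, ← (h𝒳' X' hX'.1).2]
      exact le_inf (le_inf inf_le_left h1) (le_inf inf_le_right h1))
  rw [total hP h𝒳, total hP' h𝒳', hd] at key
  refine key.trans (pow_le_pow_left₀ ?_ ?_ 2)
  · have := gb_nonneg hq (finrank K V - 2 * p) (m - p)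
    have := qn_nonneg hq (m - p)
    have := qn_nonneg hq (finrank K V - 2 * p)
    positivity
  · refine div_le_div_of_nonneg_right ?_ (qn_nonneg hq _)
    refine mul_le_mul_of_nonneg_right ?_ (qn_nonneg hq _)
    have := gb_pow_le hq (finrank K V - 2 * p) p (m - p)
    rwa [show finrank K V - 2 * p + p = finrank K V - p by omega] at this

lemma exists_point {A : Submodule K V} (h : A ≠ ⊥) :
    ∃ R : Submodule K V, finrank K R = 1 ∧ R ≤ A := by
  obtain ⟨x, hx, hx0⟩ := Submodule.exists_mem_ne_zero_of_ne_bot h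
  exact ⟨K ∙ x, finrank_span_singleton hx0, by simpa using hx⟩

/-- Subspaces of prescribed intermediate dimension. -/
lemma exists_between {S A : Submodule K V} (h : S ≤ A) {d : ℕ} (h1 : finrank K S ≤ d)
    (h2 : d ≤ finrank K A) : ∃ U : Submodule K V, S ≤ U ∧ U ≤ A ∧ finrank K U = d := by
  have c := card_between h (d - finrank K S)
  have hpos := gb_pos (qr_pos K) (show d - finrank K S ≤ finrank K A - finrank K S by omega)
  rw [← c, show finrank K S + (d - finrank K S) = d by omega] at hpos
  obtain ⟨U, hU⟩ := card_pos.1 (by exact_mod_cast hpos)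
  simp only [mem_filter, mem_Gr] at hU
  exact ⟨U, hU.2.1, hU.2.2, hU.1⟩

lemma inf_eq_bot_of_point {R X : Submodule K V} (hR : finrank K R = 1) (h : ¬ R ≤ X) :
    R ⊓ X = ⊥ := by
  by_contra hne
  have h1 : finrank K (R ⊓ X : Submodule K V) ≠ 0 := fun h0 => hne (Submodule.finrank_eq_zero.1 h0)
  have : R ⊓ X = R := Submodule.eq_of_le_of_finrank_le inf_le_left (by omega)
  exact h (inf_eq_left.1 this)

lemma finrank_sup_point {R X : Submodule K V} (hR : finrank K R = 1) (h : ¬ R ≤ X) :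
    finrank K (X ⊔ R : Submodule K V) = finrank K X + 1 := by
  have := Submodule.finrank_sup_add_finrank_inf_eq X R
  rw [inf_comm, inf_eq_bot_of_point hR h, finrank_bot] at this
  omega

/-- Members of a family through a given subspace. -/
lemma card_filter_superspace_le {m : ℕ} {𝒴 : Finset (Submodule K V)}
    (h𝒴 : ∀ X ∈ 𝒴, finrank K X = m) {S : Submodule K V} (hS : finrank K S ≤ m) :
    ((𝒴.filter (S ≤ ·)).card : ℝ) ≤
      gb (qr K) (finrank K V - finrank K S) (m - finrank K S) := by
  rw [← card_superspaces]
  norm_cast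
  refine card_le_card fun X hX => ?_
  rw [mem_filter] at hX
  rw [mem_filter, mem_Gr]
  exact ⟨by rw [h𝒴 X hX.1]; omega, hX.2⟩

variable {m : ℕ} {𝒴 : Finset (Submodule K V)} {T : Submodule K V}

/-- Each member through R contains one of the [m] lines of T through R. -/
lemma card_through_point_le (hm : 2 ≤ m) (h𝒴 : ∀ X ∈ 𝒴, finrank K X = m)
    (hT : finrank K T = m + 1) (hXT : ∀ X ∈ 𝒴, 2 ≤ finrank K (X ⊓ T : Submodule K V))
    {R : Submodule K V} (hR : finrank K R = 1) (hRT : R ≤ T) :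
    ((𝒴.filter (R ≤ ·)).card : ℝ) ≤ qn (qr K) m * gb (qr K) (finrank K V - 2) (m - 2) := by
  have c := card_between hRT 1
  rw [hR, hT, gb_one, Nat.add_sub_cancel] at c
  have hsub : 𝒴.filter (R ≤ ·) ⊆
      ((Gr K V (1 + 1)).filter (fun W => R ≤ W ∧ W ≤ T)).biUnion (fun W => 𝒴.filter (W ≤ ·)) := by
    intro X hX
    rw [mem_filter] at hX
    obtain ⟨U, h1, h2, h3⟩ := exists_between (le_inf hX.2 hRT) (by omega) (hXT X hX.1)
    simp only [mem_biUnion, mem_filter, mem_Gr]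
    exact ⟨U, ⟨h3, h1, h2.trans inf_le_right⟩, hX.1, h2.trans inf_le_left⟩
  calc ((𝒴.filter (R ≤ ·)).card : ℝ)
      ≤ ∑ W ∈ (Gr K V (1 + 1)).filter (fun W => R ≤ W ∧ W ≤ T), ((𝒴.filter (W ≤ ·)).card : ℝ) := by
        exact_mod_cast (card_le_card hsub).trans card_biUnion_le
    _ ≤ ∑ W ∈ (Gr K V (1 + 1)).filter (fun W => R ≤ W ∧ W ≤ T),
          gb (qr K) (finrank K V - 2) (m - 2) := by
        refine sum_le_sum fun W hW => ?_
        simp only [mem_filter, mem_Gr] at hW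
        have := card_filter_superspace_le h𝒴 (S := W) (by omega)
        rwa [hW.1] at this
    _ = _ := by rw [sum_const, nsmul_eq_mul, c]

lemma card_points_of_two_le {A : Submodule K V} (h : 2 ≤ finrank K A) :
    qr K + 1 ≤ ((Gr K V 1).filter (· ≤ A)).card := by
  rw [card_points_le]
  have := qn_mono (qr_pos K) h
  rw [qn_succ, qn_one, pow_one] at this
  linarith

/-- Comparing the members avoiding a point with the members through it. -/
lemma card_off_point_mul_le (hm : 2 ≤ m) (hN : 2 * m ≤ finrank K V)
    (h𝒴 : ∀ X ∈ 𝒴, finrank K X = m) (hint : ∀ X ∈ 𝒴, ∀ X' ∈ 𝒴, X ⊓ X' ≠ ⊥)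
    (hT : finrank K T = m + 1) (hXT : ∀ X ∈ 𝒴, 2 ≤ finrank K (X ⊓ T : Submodule K V))
    {R : Submodule K V} (hR : finrank K R = 1)  :
    (qr K + 1) * ((𝒴.card : ℝ) - (𝒴.filter (R ≤ ·)).card) *
      ((𝒴.filter (R ≤ ·)).card - gb (qr K) (finrank K V - 2) (m - 2)) ≤
    qn (qr K) (m + 1) *
      (gb (qr K) (finrank K V - 1) (m - 1) * qn (qr K) (m - 1) / qn (qr K) (finrank K V - 2)) ^ 2
    := by
  have hq := qr_pos K
  set z : ℝ := ((𝒴.filter (R ≤ ·)).card : ℝ) with hz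
  set g := gb (qr K) (finrank K V - 2) (m - 2)
  set B := gb (qr K) (finrank K V - 1) (m - 1) * qn (qr K) (m - 1) / qn (qr K) (finrank K V - 2)
    with hB
  set 𝒪 := 𝒴.filter (fun X => ¬ R ≤ X) with h𝒪
  have hcard : (𝒴.card : ℝ) - z = 𝒪.card := by
    rw [← card_filter_add_card_filter_not (s := 𝒴) (R ≤ ·)]
    push_cast; ring
  rw [hcard]
  rcases lt_or_ge z g with hlt | hge
  · have h1 : 0 ≤ (qr K + 1) * (𝒪.card : ℝ) := by positivity
    have h2 : 0 ≤ qn (qr K) (m + 1) * B ^ 2 := mul_nonneg (qn_nonneg hq _) (sq_nonneg _)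
    nlinarith [mul_nonneg h1 (sub_nonneg.2 hlt.le)]
  set pts := (Gr K V 1).filter (· ≤ T) with hpts
  have hptsc : (pts.card : ℝ) = qn (qr K) (m + 1) := by rw [hpts, card_points_le, hT]
  -- A member meets T in at least a line, hence in at least q + 1 points.
  have h1 : (qr K + 1) * (𝒪.card : ℝ) ≤ ∑ S ∈ pts, ((𝒪.filter (fun X => S ≤ X)).card : ℝ) := by
    rw [sum_card_filter_comm pts 𝒪 (fun S X => S ≤ X), mul_comm, ← nsmul_eq_mul]
    refine card_nsmul_le_sum _ _ _ fun X hX => ?_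
    refine (card_points_of_two_le (hXT X (mem_filter.1 hX).1)).trans ?_
    norm_cast
    refine card_le_card fun S hS => ?_
    simp only [mem_filter, hpts, le_inf_iff] at hS ⊢
    exact ⟨⟨hS.1, hS.2.2⟩, hS.2.1⟩
  -- Members through S but not R cross-intersect those through R but not S, and `cross_families`
  -- applies to these two points. The members through both, at most g, account for the subtraction
  -- in z - g.
  have h2 : ∀ S ∈ pts, ((𝒪.filter (fun X => S ≤ X)).card : ℝ) * (z - g) ≤ B ^ 2 := by
    intro S hS
    rw [hpts, mem_filter, mem_Gr] at hS
    by_cases hSR : S = R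
    · have : 𝒪.filter (fun X => S ≤ X) = ∅ := by
        ext X
        simp only [h𝒪, mem_filter, notMem_empty, iff_false, hSR]
        tauto
      rw [this, card_empty, Nat.cast_zero, zero_mul]
      exact sq_nonneg _
    have hSnR : ¬ S ≤ R := fun h => hSR (Submodule.eq_of_le_of_finrank_eq h (by omega))
    have hRnS : ¬ R ≤ S := fun h => hSR (Submodule.eq_of_le_of_finrank_eq h (by omega)).symm
    have hdisj : S ⊓ R = ⊥ := inf_eq_bot_of_point hS.1 hSnR
    have hSR2 : finrank K (S ⊔ R : Submodule K V) = 2 := by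
      rw [finrank_sup_point hR hRnS, hS.1]
    have hmeet : ∀ {A B X : Submodule K V}, finrank K A = 1 → finrank K B = 1 →
        finrank K (A ⊔ B : Submodule K V) = 2 → A ≤ X → ¬ B ≤ X → X ⊓ (A ⊔ B) = A := by
      intro A B X hA hB hAB h3 h4
      have h5 : A ≤ X ⊓ (A ⊔ B) := le_inf h3 le_sup_left
      have h6 : X ⊓ (A ⊔ B) < A ⊔ B := lt_of_le_of_ne inf_le_right
        (fun h => h4 ((le_sup_right.trans h.ge).trans inf_le_left))
      have := Submodule.finrank_lt_finrank_of_lt h6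
      exact (Submodule.eq_of_le_of_finrank_le h5 (by omega)).symm
    have key := cross_families (p := 1) (by omega) hN hS.1 hR hdisj
      (𝒳 := 𝒪.filter (fun X => S ≤ X)) (𝒳' := 𝒴.filter (fun X => R ≤ X ∧ ¬ S ≤ X))
      (by
        intro X hX
        simp only [h𝒪, mem_filter] at hX
        exact ⟨h𝒴 X hX.1.1, hmeet hS.1 hR hSR2 hX.2 hX.1.2⟩)
      (by
        intro X hX
        simp only [mem_filter] at hX
        refine ⟨h𝒴 X hX.1, ?_⟩
        rw [sup_comm]
        exact hmeet hR hS.1 (by rwa [sup_comm]) hX.2.1 hX.2.2)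
      (by
        intro X hX X' hX'
        simp only [h𝒪, mem_filter] at hX hX'
        exact hint X hX.1.1 X' hX'.1)
    have h3 : z - g ≤ ((𝒴.filter (fun X => R ≤ X ∧ ¬ S ≤ X)).card : ℝ) := by
      have e : z = ((𝒴.filter (fun X => R ≤ X ∧ S ≤ X)).card : ℝ)
          + ((𝒴.filter (fun X => R ≤ X ∧ ¬ S ≤ X)).card : ℝ) := by
        rw [hz, ← card_filter_add_card_filter_not (s := 𝒴.filter (R ≤ ·)) (S ≤ ·), filter_filter,
          filter_filter]
        push_cast; rfl
      have h4 := card_filter_superspace_le h𝒴 (S := S ⊔ R) (by omega)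
      rw [hSR2] at h4
      have h5 : 𝒴.filter (fun X => R ≤ X ∧ S ≤ X) = 𝒴.filter (S ⊔ R ≤ ·) := by
        ext X; simp only [mem_filter, sup_le_iff]; tauto
      rw [h5] at e
      linarith
    calc _ ≤ ((𝒪.filter (fun X => S ≤ X)).card : ℝ)
          * ((𝒴.filter (fun X => R ≤ X ∧ ¬ S ≤ X)).card : ℝ) :=
          mul_le_mul_of_nonneg_left h3 (Nat.cast_nonneg _)
      _ ≤ _ := key
  calc (qr K + 1) * (𝒪.card : ℝ) * (z - g)
      ≤ (∑ S ∈ pts, ((𝒪.filter (fun X => S ≤ X)).card : ℝ)) * (z - g) :=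
        mul_le_mul_of_nonneg_right h1 (sub_nonneg.2 hge)
    _ = ∑ S ∈ pts, ((𝒪.filter (fun X => S ≤ X)).card : ℝ) * (z - g) := sum_mul _ _ _
    _ ≤ pts.card • B ^ 2 := sum_le_card_nsmul _ _ _ h2
    _ = _ := by rw [nsmul_eq_mul, hptsc]

/-- A quadratic bound on the size of the family in terms of its maximal degree on points of `T`. -/
lemma card_sq_le (hm : 3 ≤ m) (hN : 2 * m ≤ finrank K V)
    (h𝒴 : ∀ X ∈ 𝒴, finrank K X = m) (hint : ∀ X ∈ 𝒴, ∀ X' ∈ 𝒴, X ⊓ X' ≠ ⊥)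
    (hT : finrank K T = m + 1) (hXT : ∀ X ∈ 𝒴, 2 ≤ finrank K (X ⊓ T : Submodule K V))
    {z : ℝ} (hz : ∀ R : Submodule K V, finrank K R = 1 → R ≤ T →
      ((𝒴.filter (R ≤ ·)).card : ℝ) ≤ z) :
    (𝒴.card : ℝ) ^ 2 ≤ (gb (qr K) (m + 1) 2 *
      (gb (qr K) (finrank K V - 2) (m - 2) * qn (qr K) (m - 2) / qn (qr K) (finrank K V - 4))) ^ 2
      + 2 * (qr K + 1) * 𝒴.card * z := by
  have hq := qr_pos K
  set B := gb (qr K) (finrank K V - 2) (m - 2) * qn (qr K) (m - 2) / qn (qr K) (finrank K V - 4)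
    with hB
  -- Attach to each member X a line l X of X ⊓ T. Pairs (X, X') where one line meets the other space
  -- are few, because a line has q + 1 points, each of degree at most z. The other pairs are sorted
  -- by their two lines, and every cell is bounded by `cross_families` with p = 2.
  have hex : ∀ X : Submodule K V, ∃ l : Submodule K V, X ∈ 𝒴 → l ≤ X ∧ l ≤ T ∧ finrank K l = 2 := by
    intro X
    by_cases hX : X ∈ 𝒴
    · obtain ⟨U, -, h2, h3⟩ := exists_between (bot_le : ⊥ ≤ X ⊓ T) (d := 2) (by simp) (hXT X hX)
      exact ⟨U, fun _ => ⟨h2.trans inf_le_left, h2.trans inf_le_right, h3⟩⟩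
    · exact ⟨⊥, fun h => absurd h hX⟩
  choose l hl using hex
  set lines := (Gr K V 2).filter (· ≤ T) with hlines
  have hlc : (lines.card : ℝ) = gb (qr K) (m + 1) 2 := by
    rw [hlines, card_filter_le, card_Gr, hT]
  have bad : ∀ X ∈ 𝒴, ((𝒴.filter (fun X' => l X ⊓ X' ≠ ⊥)).card : ℝ) ≤ (qr K + 1) * z := by
    intro X hX
    obtain ⟨h1, h2, h3⟩ := hl X hX
    have hsub : 𝒴.filter (fun X' => l X ⊓ X' ≠ ⊥) ⊆
        ((Gr K V 1).filter (· ≤ l X)).biUnion (fun R => 𝒴.filter (R ≤ ·)) := by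
      intro X' hX'
      rw [mem_filter] at hX'
      obtain ⟨R, hR1, hR2⟩ := exists_point hX'.2
      simp only [mem_biUnion, mem_filter, mem_Gr]
      exact ⟨R, ⟨hR1, hR2.trans inf_le_left⟩, hX'.1, hR2.trans inf_le_right⟩
    have hc : (((Gr K V 1).filter (· ≤ l X)).card : ℝ) = qr K + 1 := by
      rw [card_points_le, h3, qn_succ, qn_one, pow_one, add_comm]
    calc ((𝒴.filter (fun X' => l X ⊓ X' ≠ ⊥)).card : ℝ)
        ≤ ∑ R ∈ (Gr K V 1).filter (· ≤ l X), ((𝒴.filter (R ≤ ·)).card : ℝ) := by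
          exact_mod_cast (card_le_card hsub).trans card_biUnion_le
      _ ≤ ((Gr K V 1).filter (· ≤ l X)).card • z := by
          refine sum_le_card_nsmul _ _ _ fun R hR => ?_
          rw [mem_filter, mem_Gr] at hR
          exact hz R hR.1 (hR.2.trans h2)
      _ = _ := by rw [nsmul_eq_mul, hc]
  have cell : ∀ a ∈ lines ×ˢ lines,
      ((𝒴.filter (fun X => l X = a.1 ∧ X ⊓ a.2 = ⊥)).card : ℝ)
        * ((𝒴.filter (fun X => l X = a.2 ∧ X ⊓ a.1 = ⊥)).card : ℝ) ≤ B ^ 2 := by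
    rintro ⟨a, b⟩ hab
    simp only [mem_product, hlines, mem_filter, mem_Gr] at hab
    obtain ⟨⟨ha, haT⟩, hb, hbT⟩ := hab
    dsimp only
    by_cases hdisj : a ⊓ b = ⊥
    · have hmeet : ∀ {a b X : Submodule K V}, finrank K a = 2 → finrank K b = 2 →
          a ⊓ b = ⊥ → a ≤ X → X ⊓ b = ⊥ → X ⊓ (a ⊔ b) = a := by
        intro a b X ha hb hab h1 h2
        have e := sup_inf_assoc_of_le b h1
        rwa [inf_comm, inf_comm b X, h2, sup_bot_eq] at e
      refine cross_families (p := 2) (by omega) hN ha hb hdisj ?_ ?_ ?_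
      · intro X hX
        simp only [mem_filter] at hX
        exact ⟨h𝒴 X hX.1, hmeet ha hb hdisj (hX.2.1 ▸ (hl X hX.1).1) hX.2.2⟩
      · intro X hX
        simp only [mem_filter] at hX
        refine ⟨h𝒴 X hX.1, ?_⟩
        rw [sup_comm]
        exact hmeet hb ha (by rwa [inf_comm]) (hX.2.1 ▸ (hl X hX.1).1) hX.2.2
      · intro X hX X' hX'
        simp only [mem_filter] at hX hX'
        exact hint X hX.1 X' hX'.1
    · have : 𝒴.filter (fun X => l X = a ∧ X ⊓ b = ⊥) = ∅ := by
        ext X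
        simp only [mem_filter, notMem_empty, iff_false]
        rintro ⟨h1, h2, h3⟩
        apply hdisj
        rw [eq_bot_iff, ← h3]
        exact inf_le_inf_right b (h2 ▸ (hl X h1).1)
      rw [this, card_empty, Nat.cast_zero, zero_mul]
      exact sq_nonneg _
  set good := (𝒴 ×ˢ 𝒴).filter (fun p => l p.1 ⊓ p.2 = ⊥ ∧ l p.2 ⊓ p.1 = ⊥) with hgood
  have hcover : 𝒴 ×ˢ 𝒴 ⊆ good ∪ ((𝒴 ×ˢ 𝒴).filter (fun p => l p.1 ⊓ p.2 ≠ ⊥)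
      ∪ (𝒴 ×ˢ 𝒴).filter (fun p => l p.2 ⊓ p.1 ≠ ⊥)) := by
    intro p hp
    simp only [hgood, mem_union, mem_filter, hp, true_and]
    tauto
  have b1 : (((𝒴 ×ˢ 𝒴).filter (fun p => l p.1 ⊓ p.2 ≠ ⊥)).card : ℝ) ≤ 𝒴.card * ((qr K + 1) * z) := by
    have : ((𝒴 ×ˢ 𝒴).filter (fun p => l p.1 ⊓ p.2 ≠ ⊥)).card
        = ∑ X ∈ 𝒴, (𝒴.filter (fun X' => l X ⊓ X' ≠ ⊥)).card := by
      simp only [card_filter, sum_product]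
    rw [this, ← nsmul_eq_mul]
    push_cast
    exact sum_le_card_nsmul _ _ _ bad
  have b2 : (((𝒴 ×ˢ 𝒴).filter (fun p => l p.2 ⊓ p.1 ≠ ⊥)).card : ℝ) ≤ 𝒴.card * ((qr K + 1) * z) := by
    have : ((𝒴 ×ˢ 𝒴).filter (fun p => l p.2 ⊓ p.1 ≠ ⊥)).card
        = ∑ X ∈ 𝒴, (𝒴.filter (fun X' => l X ⊓ X' ≠ ⊥)).card := by
      simp only [card_filter, sum_product_right]
    rw [this, ← nsmul_eq_mul]
    push_cast
    exact sum_le_card_nsmul _ _ _ bad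
  have b3 : (good.card : ℝ) ≤ gb (qr K) (m + 1) 2 ^ 2 * B ^ 2 := by
    have hsub : good ⊆ (lines ×ˢ lines).biUnion (fun a =>
        (𝒴.filter (fun X => l X = a.1 ∧ X ⊓ a.2 = ⊥)) ×ˢ
          (𝒴.filter (fun X => l X = a.2 ∧ X ⊓ a.1 = ⊥))) := by
      rintro ⟨X, X'⟩ hp
      simp only [hgood, mem_filter, mem_product] at hp
      simp only [mem_biUnion, mem_product, mem_filter, hlines, mem_Gr]
      obtain ⟨⟨hX, hX'⟩, h1, h2⟩ := hp
      refine ⟨(l X, l X'), ⟨⟨(hl X hX).2.2, (hl X hX).2.1⟩, (hl X' hX').2.2, (hl X' hX').2.1⟩,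
        ⟨hX, rfl, by rwa [inf_comm]⟩, hX', rfl, by rwa [inf_comm]⟩
    calc (good.card : ℝ) ≤ ∑ a ∈ lines ×ˢ lines,
          (((𝒴.filter (fun X => l X = a.1 ∧ X ⊓ a.2 = ⊥)) ×ˢ
            (𝒴.filter (fun X => l X = a.2 ∧ X ⊓ a.1 = ⊥))).card : ℝ) := by
          exact_mod_cast (card_le_card hsub).trans card_biUnion_le
      _ ≤ (lines ×ˢ lines).card • B ^ 2 := by
          refine sum_le_card_nsmul _ _ _ fun a ha => ?_
          rw [card_product]
          push_cast
          exact cell a ha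
      _ = _ := by rw [nsmul_eq_mul, card_product, ← hlc]; push_cast; ring
  have b4 : (𝒴.card : ℝ) ^ 2 ≤ good.card + (((𝒴 ×ˢ 𝒴).filter (fun p => l p.1 ⊓ p.2 ≠ ⊥)).card
      + ((𝒴 ×ˢ 𝒴).filter (fun p => l p.2 ⊓ p.1 ≠ ⊥)).card) := by
    have h1 := (card_le_card hcover).trans ((card_union_le _ _).trans
      (Nat.add_le_add_left (card_union_le _ _) _))
    rw [card_product] at h1
    rw [sq]
    exact_mod_cast h1
  rw [mul_pow]
  linarith

end CrossFamilies


/-! ### Numerical estimates for the local inequality. -/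

section Estimates

variable {q : ℝ}

lemma gb_two {k : ℕ} (hk : 2 ≤ k) : gb q k 2 = qn q k * qn q (k - 1) / (q + 1) := by
  obtain ⟨k, rfl⟩ := Nat.exists_eq_add_of_le' hk
  have h2 : qn q (1 + 1) = q + 1 := by rw [qn_succ, qn_one, pow_one, add_comm]
  rw [gb_succ_succ, gb_one, h2, show k + 2 - 1 = k + 1 by omega]
  ring

lemma qn_div_le (hq : 0 < q) {a b : ℕ} {r P : ℝ} (hb : 0 < b) (hab : a ≤ b) (hP : 0 < P)
    (h : P ≤ r * q ^ (b - a)) : qn q a / qn q b ≤ r / P := by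
  rw [div_le_div_iff₀ (qn_pos hq hb) hP]
  have h1 : q ^ (b - a) * qn q a ≤ qn q b := by
    have := qn_add (q := q) (b - a) a
    rw [Nat.sub_add_cancel hab] at this
    have := qn_nonneg hq (b - a)
    linarith
  have hr : 0 < r := by
    have := pow_pos hq (b - a)
    by_contra hr
    nlinarith [not_lt.1 hr]
  nlinarith [mul_le_mul_of_nonneg_left h (qn_nonneg hq a), mul_le_mul_of_nonneg_left h1 hr.le]

lemma qn_le_div (hq : 1 < q) {a k : ℕ} {r : ℝ} (h : r * q ^ a = q ^ k) (hr : 0 < r) :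
    qn q a ≤ q ^ k / (r * (q - 1)) := by
  have h1 := qn_mul (q := q) a
  rw [le_div_iff₀ (mul_pos hr (by linarith))]
  nlinarith

/-- Improving an upper bound on `z`. -/
lemma bootstrap_step {α z s c a z₀ z₁ : ℝ} (ha : a ≤ α) (hz : z ≤ z₀)
    (h : (α - z) * (z - s) ≤ c) (hc : c ≤ (a - z₀) * (z₁ - s)) (hz₀ : z₀ < a) (hs : s ≤ z₁) :
    z ≤ z₁ := by
  by_contra hcon
  rw [not_le] at hcon
  nlinarith [mul_le_mul (show a - z₀ ≤ α - z by linarith) (show z₁ - s ≤ z - s by linarith)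
    (by linarith) (by linarith),
    mul_lt_mul_of_pos_left (show z₁ - s < z - s by linarith) (show 0 < a - z₀ by linarith)]

/-- The function α² - r α z₁ increases for α ≥ a once r z₁ ≤ a, so an inequality failing at a fails
for all larger α. -/
lemma quadratic_contradiction {α z κ a r z₁ : ℝ} (ha : a ≤ α) (ha0 : 0 < a) (hr : 0 ≤ r)
    (hz : z ≤ z₁) (h : α ^ 2 ≤ κ + r * α * z) (h1 : κ + r * a * z₁ < a ^ 2) (h2 : r * z₁ ≤ a) :
    False := by
  have h3 : r * α * z ≤ r * α * z₁ :=
    mul_le_mul_of_nonneg_left hz (mul_nonneg hr (by linarith))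
  nlinarith [mul_nonneg (sub_nonneg.2 ha) (show 0 ≤ α + a - r * z₁ by linarith)]

/-- The proportion of the spaces through a point which contain a second point. -/
def s₀ (q : ℝ) (n k : ℕ) : ℝ := qn q (k - 2) / qn q (n - 2)

/-- The constant in the comparison of spaces avoiding a point with spaces through it. -/
def c₀ (q : ℝ) (n k : ℕ) : ℝ := qn q k * (qn q (k - 2) / qn q (n - 3)) ^ 2 / (q + 1)

/-- The constant coming from pairs of spaces containing independent lines. -/
def κ₀ (q : ℝ) (n k : ℕ) : ℝ := gb q k 2 * (s₀ q n k * (qn q (k - 3) / qn q (n - 5)))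

lemma kappa_le {S R X Y : ℝ} {n k : ℕ} (hq : 0 < q) (hk : 2 ≤ k)
    (h1 : s₀ q n k ≤ S) (h2 : qn q (k - 3) / qn q (n - 5) ≤ R) (hX : qn q k ≤ X)
    (hY : qn q (k - 1) ≤ Y) : κ₀ q n k ≤ X * Y / (q + 1) * (S * R) := by
  have p1 := qn_nonneg hq k
  have p2 := qn_nonneg hq (k - 1)
  have p3 : 0 ≤ s₀ q n k := div_nonneg (qn_nonneg hq _) (qn_nonneg hq _)
  have p4 : 0 ≤ qn q (k - 3) / qn q (n - 5) := div_nonneg (qn_nonneg hq _) (qn_nonneg hq _)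
  rw [κ₀, gb_two hk]
  have := p1.trans hX
  have := p2.trans hY
  have := p3.trans h1
  gcongr

lemma kappa_nonneg (hq : 0 < q) (n k : ℕ) : 0 ≤ κ₀ q n k :=
  mul_nonneg (gb_nonneg hq _ _) (mul_nonneg (div_nonneg (qn_nonneg hq _) (qn_nonneg hq _))
    (div_nonneg (qn_nonneg hq _) (qn_nonneg hq _)))

lemma c_le {R X : ℝ} {n k : ℕ} (hq : 0 < q) (h2 : qn q (k - 2) / qn q (n - 3) ≤ R)
    (hX : qn q k ≤ X) : c₀ q n k ≤ X * R ^ 2 / (q + 1) := by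
  have p1 := qn_nonneg hq k
  have p4 : 0 ≤ qn q (k - 2) / qn q (n - 3) := div_nonneg (qn_nonneg hq _) (qn_nonneg hq _)
  have := p1.trans hX
  rw [c₀]
  gcongr

-- Here α is the size of the intersecting family and z its maximal degree on points of T, both
-- divided by the number of (k-1)-spaces through a point of V ⧸ L. If α ≥ 3/4, then z ≤ 1/4, and
-- since 3/4 - 1/4 = 1/2 the first inequality improves this to z ≤ s₀ + 2 c₀, which contradicts the
-- third. The threshold 3/4 complements the bound ν₁ ≤ 1/4.
set_option maxHeartbeats 400000 in
lemma local_numeric_of_three_le (hq : 3 ≤ q) {n k : ℕ} (hk : 4 ≤ k) (hn : 2 * k ≤ n) {α z : ℝ}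
    (h1 : (α - z) * (z - s₀ q n k) ≤ c₀ q n k) (h2 : z ≤ qn q (k - 1) * s₀ q n k)
    (h3 : α ^ 2 ≤ κ₀ q n k ^ 2 + 2 * (q + 1) * α * z) : α < 3 / 4 := by
  by_contra hα
  rw [not_lt] at hα
  have hq0 : 0 < q := by linarith
  have hq1 : 1 < q := by linarith
  have hP : 0 < q ^ k := pow_pos hq0 k
  have hmono : ∀ {a b : ℕ}, a ≤ b → q ^ a ≤ q ^ b := fun h => pow_le_pow_right₀ hq1.le h
  have hP4 : q ^ 4 ≤ q ^ k := hmono hk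
  have b1 : s₀ q n k ≤ 1 / q ^ k := qn_div_le hq0 (by omega) (by omega) hP (by
    rw [one_mul]; exact hmono (by omega))
  have b2 : qn q (k - 2) / qn q (n - 3) ≤ q / q ^ k := qn_div_le hq0 (by omega) (by omega) hP (by
    rw [← pow_succ']; exact hmono (by omega))
  have b3 : qn q (k - 3) / qn q (n - 5) ≤ q ^ 2 / q ^ k :=
    qn_div_le hq0 (by omega) (by omega) hP (by rw [← pow_add]; exact hmono (by omega))
  have e1 : qn q k ≤ q ^ k / (1 * (q - 1)) := qn_le_div hq1 (by ring) one_pos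
  have e2 : qn q (k - 1) ≤ q ^ k / (q * (q - 1)) :=
    qn_le_div hq1 (by rw [← pow_succ']; congr 1; omega) hq0
  have hκ := kappa_le hq0 (by omega) b1 b3 e1 e2
  have hc := c_le hq0 b2 e1
  set P := q ^ k with hPdef
  have hq' : 0 < q - 1 := by linarith
  have hκ' : κ₀ q n k ≤ 3 / 16 := by
    refine hκ.trans ?_
    have : P / (1 * (q - 1)) * (P / (q * (q - 1))) / (q + 1) * (1 / P * (q ^ 2 / P))
        = q / ((q - 1) ^ 2 * (q + 1)) := by field_simp
    rw [this, div_le_div_iff₀ (by positivity) (by norm_num)]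
    nlinarith [mul_nonneg (show 0 ≤ q - 3 by linarith) (show 0 ≤ q - 3 by linarith),
      mul_nonneg (mul_nonneg (show 0 ≤ q - 3 by linarith) (show 0 ≤ q - 3 by linarith)) hq0.le]
  have hq4 : 0 < q ^ 4 := pow_pos hq0 4
  have hc' : c₀ q n k ≤ 1 / (q ^ 2 * (q ^ 2 - 1)) := by
    refine hc.trans ?_
    have e : P / (1 * (q - 1)) * (q / P) ^ 2 / (q + 1) = q ^ 2 / (P * (q ^ 2 - 1)) := by
      have : q ^ 2 - 1 = (q - 1) * (q + 1) := by ring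
      rw [this]; field_simp
    have hq21 : 0 < q ^ 2 - 1 := by nlinarith
    rw [e, div_le_div_iff₀ (by positivity) (by positivity)]
    have := mul_le_mul_of_nonneg_right hP4 hq21.le
    nlinarith
  have hs' : s₀ q n k ≤ 1 / q ^ 4 := b1.trans (one_div_le_one_div_of_le hq4 hP4)
  have hz0 : z ≤ 1 / 4 := by
    refine h2.trans ?_
    have h4 : qn q (k - 1) * s₀ q n k ≤ P / (q * (q - 1)) * (1 / P) :=
      mul_le_mul e2 b1 (div_nonneg (qn_nonneg hq0 _) (qn_nonneg hq0 _))
        ((qn_nonneg hq0 _).trans e2)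
    have e : P / (q * (q - 1)) * (1 / P) = 1 / (q * (q - 1)) := by field_simp
    rw [e] at h4
    refine h4.trans ?_
    rw [div_le_div_iff₀ (by positivity) (by norm_num)]
    nlinarith
  have hs0 : 0 ≤ s₀ q n k := div_nonneg (qn_nonneg hq0 _) (qn_nonneg hq0 _)
  have hc0 : 0 ≤ c₀ q n k := by
    have := qn_nonneg hq0 k
    rw [c₀]; positivity
  have hz1 := bootstrap_step (z₁ := s₀ q n k + 2 * c₀ q n k) hα hz0 h1 (by linarith)
    (by norm_num) (by linarith)
  have hz2 : 2 * (q + 1) * z ≤ 2 * (q + 1) * (1 / q ^ 4) + 4 / (q ^ 2 * (q - 1)) := by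
    have : 2 * (q + 1) * z ≤ 2 * (q + 1) * (1 / q ^ 4 + 2 * (1 / (q ^ 2 * (q ^ 2 - 1)))) :=
      mul_le_mul_of_nonneg_left (by linarith) (by linarith)
    refine this.trans (le_of_eq ?_)
    have e : q ^ 2 - 1 = (q - 1) * (q + 1) := by ring
    rw [e]; field_simp; ring
  have hz3 : 2 * (q + 1) * (1 / q ^ 4) ≤ 1 / 10 := by
    rw [mul_one_div, div_le_div_iff₀ hq4 (by norm_num)]
    have h27 : 3 ^ 3 ≤ q ^ 3 := pow_le_pow_left₀ (by norm_num) hq 3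
    have h4 : 0 ≤ (q ^ 3 - 3 ^ 3) * q := mul_nonneg (by linarith) hq0.le
    have e : (q ^ 3 - 3 ^ 3) * q = q ^ 4 - 27 * q := by ring
    linarith
  have hz4 : 4 / (q ^ 2 * (q - 1)) ≤ 1 / 4 := by
    rw [div_le_div_iff₀ (by positivity) (by norm_num)]
    nlinarith [mul_nonneg (show 0 ≤ q - 3 by linarith) (show 0 ≤ q by linarith)]
  have hκ2 : κ₀ q n k ^ 2 ≤ (3 / 16) ^ 2 := pow_le_pow_left₀ (kappa_nonneg hq0 n k) hκ' 2
  -- The factor 2 (q + 1) is absorbed into z, and 7/20 = 1/10 + 1/4 adds up `hz3` and `hz4`.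
  refine quadratic_contradiction (α := α) (z := 2 * (q + 1) * z) (r := 1) (z₁ := 7 / 20) hα
    (by norm_num) (by norm_num) (by linarith) (κ := (3 / 16) ^ 2) (by linarith) (by norm_num)
    (by norm_num)

lemma local_numeric_of_two {n k : ℕ} (hk : 4 ≤ k) (hn : 2 * k + 1 ≤ n) {α z : ℝ}
    (h1 : (α - z) * (z - s₀ 2 n k) ≤ c₀ 2 n k) (h2 : z ≤ qn 2 (k - 1) * s₀ 2 n k)
    (h3 : α ^ 2 ≤ κ₀ 2 n k ^ 2 + 2 * (2 + 1) * α * z) : α < 3 / 4 := by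
  by_contra hα
  rw [not_lt] at hα
  have hq0 : (0 : ℝ) < 2 := by norm_num
  have hq1 : (1 : ℝ) < 2 := by norm_num
  have hP : (0 : ℝ) < 2 ^ k := pow_pos hq0 k
  have hmono : ∀ {a b : ℕ}, a ≤ b → (2 : ℝ) ^ a ≤ 2 ^ b := fun h => pow_le_pow_right₀ hq1.le h
  have hP4 : (2 : ℝ) ^ 4 ≤ 2 ^ k := hmono hk
  have b1 : s₀ 2 n k ≤ (1 / 2) / 2 ^ k := qn_div_le hq0 (by omega) (by omega) hP (by
    have := hmono (show k + 1 ≤ n - 2 - (k - 2) by omega)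
    rw [pow_succ] at this; linarith)
  have b2 : qn 2 (k - 2) / qn 2 (n - 3) ≤ 1 / (2 : ℝ) ^ k :=
    qn_div_le hq0 (by omega) (by omega) hP (by rw [one_mul]; exact hmono (by omega))
  have b3 : qn 2 (k - 3) / qn 2 (n - 5) ≤ 2 / (2 : ℝ) ^ k :=
    qn_div_le hq0 (by omega) (by omega) hP (by rw [← pow_succ']; exact hmono (by omega))
  have e1 : qn (2 : ℝ) k ≤ 2 ^ k / (1 * (2 - 1)) := qn_le_div hq1 (by ring) one_pos
  have e2 : qn (2 : ℝ) (k - 1) ≤ 2 ^ k / (2 * (2 - 1)) :=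
    qn_le_div hq1 (by rw [← pow_succ']; congr 1; omega) hq0
  have hκ := kappa_le hq0 (by omega) b1 b3 e1 e2
  have hc := c_le hq0 b2 e1
  set P := (2 : ℝ) ^ k with hPdef
  have hκ' : κ₀ 2 n k ≤ 1 / 6 := by
    refine hκ.trans (le_of_eq ?_)
    field_simp; norm_num
  have hP16 : 1 / P ≤ 1 / 16 := one_div_le_one_div_of_le (by norm_num) (by linarith)
  have hc' : c₀ 2 n k ≤ 1 / 48 := by
    refine hc.trans ?_
    have : P / (1 * (2 - 1)) * (1 / P) ^ 2 / (2 + 1) = 1 / P / 3 := by field_simp; norm_num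
    rw [this]; linarith
  have hs' : s₀ 2 n k ≤ 1 / 32 := by
    refine b1.trans ?_
    rw [div_le_div_iff₀ hP (by norm_num)]; linarith
  have hz0 : z ≤ 1 / 4 := by
    refine h2.trans ?_
    have h4 : qn 2 (k - 1) * s₀ 2 n k ≤ P / (2 * (2 - 1)) * (1 / 2 / P) :=
      mul_le_mul e2 b1 (div_nonneg (qn_nonneg hq0 _) (qn_nonneg hq0 _))
        ((qn_nonneg hq0 _).trans e2)
    refine h4.trans (le_of_eq ?_)
    field_simp; norm_num
  have hz1 := bootstrap_step (z₁ := s₀ 2 n k + 2 * (1 / 48)) hα hz0 h1 (by linarith)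
    (by norm_num) (by linarith)
  have hκ2 : κ₀ 2 n k ^ 2 ≤ (1 / 6) ^ 2 := pow_le_pow_left₀ (kappa_nonneg hq0 n k) hκ' 2
  -- The bound 7/96 is 1/32 + 2/48, from the estimates for s₀ and c₀.
  refine quadratic_contradiction (α := α) (z := z) (r := 2 * (2 + 1)) (z₁ := 7 / 96) hα
    (by norm_num) (by norm_num) (by linarith) (κ := (1 / 6) ^ 2) (by linarith) (by norm_num)
    (by norm_num)

/-- The proportion of spaces meeting two `k`-spaces whose intersection has `u` points. -/
def ν₂ (k : ℕ) (u : ℝ) : ℝ :=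
  u * (qn 2 (k - 2) / qn 2 (2 * k - 1)) +
    (qn 2 k - u) ^ 2 * (qn 2 (k - 2) / qn 2 (2 * k - 1) * (qn 2 (k - 3) / qn 2 (2 * k - 2)))

/-- Two rounds of `bootstrap_step`, from z₀ to z₁ to z₂. The threshold a is existential because it
has to serve both sides of the requirement ν₂ + α < 1. -/
lemma local_numeric_balanced_aux {k : ℕ} {a z₀ z₁ z₂ : ℝ} (ha : 0 < a)
    (hν : ∀ u, 0 ≤ u → u ≤ qn 2 (k - 1) → ν₂ k u ≤ 1 - a)
    (h0 : qn 2 (k - 1) * s₀ 2 (2 * k) k ≤ z₀) (hz0 : z₀ < a)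
    (hs1 : s₀ 2 (2 * k) k ≤ z₁) (h1 : c₀ 2 (2 * k) k ≤ (a - z₀) * (z₁ - s₀ 2 (2 * k) k)) (hz1 : z₁ < a)
    (hs2 : s₀ 2 (2 * k) k ≤ z₂) (h2 : c₀ 2 (2 * k) k ≤ (a - z₁) * (z₂ - s₀ 2 (2 * k) k))
    (h3 : κ₀ 2 (2 * k) k ^ 2 + 6 * a * z₂ < a ^ 2) (h4 : 6 * z₂ ≤ a) :
    ∃ a : ℝ, (∀ u, 0 ≤ u → u ≤ qn 2 (k - 1) → ν₂ k u ≤ 1 - a) ∧ ∀ α z : ℝ,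
      (α - z) * (z - s₀ 2 (2 * k) k) ≤ c₀ 2 (2 * k) k → z ≤ qn 2 (k - 1) * s₀ 2 (2 * k) k →
      α ^ 2 ≤ κ₀ 2 (2 * k) k ^ 2 + 2 * (2 + 1) * α * z → α < a := by
  refine ⟨a, hν, fun α z f1 f2 f3 => ?_⟩
  by_contra hα
  rw [not_lt] at hα
  have g1 := bootstrap_step hα (f2.trans h0) f1 h1 hz0 hs1
  have g2 := bootstrap_step hα g1 f1 h2 hz1 hs2
  exact quadratic_contradiction (r := 6) hα ha (by norm_num) g2 (by linarith) h3 h4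

lemma local_numeric_balanced_large {k : ℕ} (hk : 9 ≤ k) :
    ∃ a : ℝ, (∀ u, 0 ≤ u → u ≤ qn 2 (k - 1) → ν₂ k u ≤ 1 - a) ∧ ∀ α z : ℝ,
      (α - z) * (z - s₀ 2 (2 * k) k) ≤ c₀ 2 (2 * k) k → z ≤ qn 2 (k - 1) * s₀ 2 (2 * k) k →
      α ^ 2 ≤ κ₀ 2 (2 * k) k ^ 2 + 2 * (2 + 1) * α * z → α < a := by
  have hq0 : (0 : ℝ) < 2 := by norm_num
  have hq1 : (1 : ℝ) < 2 := by norm_num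
  have hP : (0 : ℝ) < 2 ^ k := pow_pos hq0 k
  have hmono : ∀ {a b : ℕ}, a ≤ b → (2 : ℝ) ^ a ≤ 2 ^ b := fun h => pow_le_pow_right₀ hq1.le h
  have hP9 : (2 : ℝ) ^ 9 ≤ 2 ^ k := hmono hk
  have hn : 2 * k ≤ 2 * k := le_rfl
  have b1 : s₀ 2 (2 * k) k ≤ 1 / 2 ^ k := qn_div_le hq0 (by omega) (by omega) hP (by
    rw [one_mul]; exact hmono (by omega))
  have b2 : qn 2 (k - 2) / qn 2 (2 * k - 3) ≤ 2 / (2 : ℝ) ^ k :=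
    qn_div_le hq0 (by omega) (by omega) hP (by rw [← pow_succ']; exact hmono (by omega))
  have b3 : qn 2 (k - 3) / qn 2 (2 * k - 5) ≤ 4 / (2 : ℝ) ^ k :=
    qn_div_le hq0 (by omega) (by omega) hP (by
      rw [show (4 : ℝ) = 2 ^ 2 by norm_num, ← pow_add]; exact hmono (by omega))
  have b4 : qn 2 (k - 2) / qn 2 (2 * k - 1) ≤ (1 / 2) / (2 : ℝ) ^ k :=
    qn_div_le hq0 (by omega) (by omega) hP (by
      have := hmono (show k + 1 ≤ 2 * k - 1 - (k - 2) by omega)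
      rw [pow_succ] at this; linarith)
  have b5 : qn 2 (k - 3) / qn 2 (2 * k - 2) ≤ (1 / 2) / (2 : ℝ) ^ k :=
    qn_div_le hq0 (by omega) (by omega) hP (by
      have := hmono (show k + 1 ≤ 2 * k - 2 - (k - 3) by omega)
      rw [pow_succ] at this; linarith)
  have e1 : qn (2 : ℝ) k ≤ 2 ^ k / (1 * (2 - 1)) := qn_le_div hq1 (by ring) one_pos
  have e2 : qn (2 : ℝ) (k - 1) ≤ 2 ^ k / (2 * (2 - 1)) :=
    qn_le_div hq1 (by rw [← pow_succ']; congr 1; omega) hq0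
  have hκ := kappa_le hq0 (by omega) b1 b3 e1 e2
  have hc := c_le hq0 b2 e1
  have e3 : qn (2 : ℝ) (k - 1) ≤ qn 2 k := qn_mono hq0 (by omega)
  have n4 : 0 ≤ qn (2 : ℝ) (k - 2) / qn 2 (2 * k - 1) :=
    div_nonneg (qn_nonneg hq0 _) (qn_nonneg hq0 _)
  have n5 : 0 ≤ qn (2 : ℝ) (k - 3) / qn 2 (2 * k - 2) :=
    div_nonneg (qn_nonneg hq0 _) (qn_nonneg hq0 _)
  have n1 : 0 ≤ s₀ 2 (2 * k) k := div_nonneg (qn_nonneg hq0 _) (qn_nonneg hq0 _)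
  have nκ := kappa_nonneg hq0 (2 * k) k
  have n2 := qn_nonneg hq0 (k - 1)
  set P := (2 : ℝ) ^ k with hPdef
  have hκ' : κ₀ 2 (2 * k) k ≤ 2 / 3 := by
    refine hκ.trans (le_of_eq ?_)
    field_simp; norm_num
  have hP512 : 1 / P ≤ 1 / 512 := one_div_le_one_div_of_le (by norm_num) (by linarith)
  have hPpos : 0 < 1 / P := by positivity
  have hc' : c₀ 2 (2 * k) k ≤ 4 / 3 * (1 / P) := by
    refine hc.trans (le_of_eq ?_)
    field_simp; norm_num
  -- With P = 2^k and u ≤ P/2, ν₂ ≤ (1 + (u/P)²)/4 ≤ 5/16, whence a = 11/16. As c₀ ≤ 4/(3P), the gap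
  -- a - z₀ = 3/16 yields the coefficient 64/9. The gap a - z₁ ≥ 2/3 yields the coefficient 2, and
  -- this is where P ≥ 512, that is k ≥ 9, enters.
  refine local_numeric_balanced_aux (a := 11 / 16) (z₀ := 1 / 2)
    (z₁ := s₀ 2 (2 * k) k + 64 / 9 * (1 / P)) (z₂ := s₀ 2 (2 * k) k + 2 * (1 / P))
    (by norm_num) ?_ ?_ (by norm_num) (by linarith) (by linarith) (by linarith) (by linarith)
    ?_ ?_ (by linarith)
  · intro u hu hu'
    have hu2 : u ≤ P / 2 := by
      refine hu'.trans (e2.trans (le_of_eq ?_)); norm_num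
    have hX : qn 2 k - u ≤ P - u := by
      have : P / (1 * (2 - 1)) = P := by norm_num
      linarith
    have hX0 : 0 ≤ qn 2 k - u := by linarith
    have t1 : u * (qn 2 (k - 2) / qn 2 (2 * k - 1)) ≤ u * (1 / 2 / P) :=
      mul_le_mul_of_nonneg_left b4 hu
    have t2 : (qn 2 k - u) ^ 2 *
        (qn 2 (k - 2) / qn 2 (2 * k - 1) * (qn 2 (k - 3) / qn 2 (2 * k - 2)))
        ≤ (P - u) ^ 2 * (1 / 2 / P * (1 / 2 / P)) := by
      gcongr
    have t3 : u * (1 / 2 / P) + (P - u) ^ 2 * (1 / 2 / P * (1 / 2 / P))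
        = (P ^ 2 + u ^ 2) / (4 * P ^ 2) := by field_simp; ring
    have t4 : (P ^ 2 + u ^ 2) / (4 * P ^ 2) ≤ 1 - 11 / 16 := by
      rw [div_le_iff₀ (by positivity)]
      nlinarith
    rw [ν₂]; linarith
  · have h4 : qn 2 (k - 1) * s₀ 2 (2 * k) k ≤ P / (2 * (2 - 1)) * (1 / P) :=
      mul_le_mul e2 b1 n1 (n2.trans e2)
    refine h4.trans (le_of_eq ?_)
    field_simp; norm_num
  · nlinarith
  · have hκ2 : κ₀ 2 (2 * k) k ^ 2 ≤ (2 / 3) ^ 2 := pow_le_pow_left₀ nκ hκ' 2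
    linarith

lemma local_numeric_balanced_small {k : ℕ} (hk : 4 ≤ k) (hk' : k < 9) :
    ∃ a : ℝ, (∀ u, 0 ≤ u → u ≤ qn 2 (k - 1) → ν₂ k u ≤ 1 - a) ∧ ∀ α z : ℝ,
      (α - z) * (z - s₀ 2 (2 * k) k) ≤ c₀ 2 (2 * k) k → z ≤ qn 2 (k - 1) * s₀ 2 (2 * k) k →
      α ^ 2 ≤ κ₀ 2 (2 * k) k ^ 2 + 2 * (2 + 1) * α * z → α < a := by
  have val : ∀ m : ℕ, qn (2 : ℝ) m = 2 ^ m - 1 := fun m => by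
    have := qn_mul (q := 2) m
    linarith
  have g2 : gb (2 : ℝ) k 2 = qn 2 k * qn 2 (k - 1) / (2 + 1) := gb_two (by omega)
  -- In each case a lies just below 1 minus the maximum of ν₂, and the zᵢ are rounded values of the
  -- successive bounds. Since ν₂ is a convex quadratic in u, the product u (u_max - u) ≥ 0 suffices
  -- to bound it.
  interval_cases k
  · refine local_numeric_balanced_aux (a := 81 / 100) (z₀ := 1 / 3) (z₁ := 147 / 1000)
      (z₂ := 119 / 1000) ?_ ?_ ?_ ?_ ?_ ?_ ?_ ?_ ?_ ?_ ?_ <;>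
    norm_num [s₀, c₀, κ₀, ν₂, val, g2]
    intro u hu hu'; nlinarith [mul_nonneg hu (sub_nonneg.2 hu')]
  · refine local_numeric_balanced_aux (a := 753 / 1000) (z₀ := 42 / 100) (z₁ := 125 / 1000)
      (z₂ := 78 / 1000) ?_ ?_ ?_ ?_ ?_ ?_ ?_ ?_ ?_ ?_ ?_ <;>
    norm_num [s₀, c₀, κ₀, ν₂, val, g2]
    intro u hu hu'; nlinarith [mul_nonneg hu (sub_nonneg.2 hu')]
  · refine local_numeric_balanced_aux (a := 721 / 1000) (z₀ := 46 / 100) (z₁ := 9 / 100)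
      (z₂ := 44 / 1000) ?_ ?_ ?_ ?_ ?_ ?_ ?_ ?_ ?_ ?_ ?_ <;>
    norm_num [s₀, c₀, κ₀, ν₂, val, g2]
    intro u hu hu'; nlinarith [mul_nonneg hu (sub_nonneg.2 hu')]
  · refine local_numeric_balanced_aux (a := 704 / 1000) (z₀ := 48 / 100) (z₁ := 6 / 100)
      (z₂ := 23 / 1000) ?_ ?_ ?_ ?_ ?_ ?_ ?_ ?_ ?_ ?_ ?_ <;>
    norm_num [s₀, c₀, κ₀, ν₂, val, g2]
    intro u hu hu'; nlinarith [mul_nonneg hu (sub_nonneg.2 hu')]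
  · refine local_numeric_balanced_aux (a := 696 / 1000) (z₀ := 49 / 100) (z₁ := 4 / 100)
      (z₂ := 12 / 1000) ?_ ?_ ?_ ?_ ?_ ?_ ?_ ?_ ?_ ?_ ?_ <;>
    norm_num [s₀, c₀, κ₀, ν₂, val, g2]
    intro u hu hu'; nlinarith [mul_nonneg hu (sub_nonneg.2 hu')]

lemma local_numeric_balanced {k : ℕ} (hk : 4 ≤ k) :
    ∃ a : ℝ, (∀ u, 0 ≤ u → u ≤ qn 2 (k - 1) → ν₂ k u ≤ 1 - a) ∧ ∀ α z : ℝ,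
      (α - z) * (z - s₀ 2 (2 * k) k) ≤ c₀ 2 (2 * k) k → z ≤ qn 2 (k - 1) * s₀ 2 (2 * k) k →
      α ^ 2 ≤ κ₀ 2 (2 * k) k ^ 2 + 2 * (2 + 1) * α * z → α < a := by
  rcases lt_or_ge k 9 with h | h
  · exact local_numeric_balanced_small hk h
  · exact local_numeric_balanced_large h

end Estimates


/-! ### Good and bad members, weights on hyperplanes, and averaging over points. -/

section Weights

set_option linter.unusedSectionVars false

variable {K V : Type*} [Field K] [Fintype K] [AddCommGroup V] [Module K V] [FiniteDimensional K V]

lemma inf_eq_of_hyperplane {k : ℕ} {A A' H : Submodule K V} (hA : finrank K A = k)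
    (hA' : finrank K A' = k) (hne : A ≠ A') (hH : finrank K H + 1 = k) (h : H ≤ A) (h' : H ≤ A') :
    A ⊓ A' = H := by
  have h1 : A ⊓ A' < A := lt_of_le_of_ne inf_le_left fun e =>
    hne (Submodule.eq_of_le_of_finrank_eq (inf_eq_left.1 e) (by omega))
  have := Submodule.finrank_lt_finrank_of_lt h1
  exact (Submodule.eq_of_le_of_finrank_le (le_inf h h') (by omega)).symm

lemma finrank_inf_lt {k : ℕ} {A A' : Submodule K V} (hA : finrank K A = k)
    (hA' : finrank K A' = k) (hne : A ≠ A') : finrank K (A ⊓ A' : Submodule K V) < k := by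
  have h1 : A ⊓ A' < A := lt_of_le_of_ne inf_le_left fun e =>
    hne (Submodule.eq_of_le_of_finrank_eq (inf_eq_left.1 e) (by omega))
  have := Submodule.finrank_lt_finrank_of_lt h1
  omega

lemma card_hyperplanes {k : ℕ} (hk : 1 ≤ k) {A : Submodule K V} (hA : finrank K A = k) :
    (((Gr K V (k - 1)).filter (· ≤ A)).card : ℝ) = qn (qr K) k := by
  obtain ⟨j, rfl⟩ := Nat.exists_eq_add_of_le' hk
  rw [card_filter_le, card_Gr, hA, Nat.add_sub_cancel, gb_succ_self (qr_pos K)]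

lemma card_hyperplanes_ge {k : ℕ} {S A : Submodule K V} (hA : finrank K A = k) (hSA : S ≤ A)
    (hS : finrank K S < k) :
    (((Gr K V (k - 1)).filter (fun H => S ≤ H ∧ H ≤ A)).card : ℝ)
      = qn (qr K) (k - finrank K S) := by
  have c := card_between hSA (k - 1 - finrank K S)
  rw [show finrank K S + (k - 1 - finrank K S) = k - 1 by omega, hA] at c
  rw [c]
  obtain ⟨j, hj⟩ := Nat.exists_eq_add_of_lt hS
  rw [show k - finrank K S = j + 1 by omega, show k - 1 - finrank K S = j by omega,
    gb_succ_self (qr_pos K)]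

variable (k : ℕ) (F : Finset (Submodule K V))

/-- A family of `k`-spaces without covering triples, in the range `2 ≤ k ≤ n / 2`. -/
structure CTF : Prop where
  two_le : 2 ≤ k
  le : 2 * k ≤ finrank K V
  dim : ∀ A ∈ F, finrank K A = k
  free : CoveringTripleFree k (F : Set (Submodule K V))

/-- `c` is a point of `A` contained in all members of `F` adjacent to `A`. -/
def IsCentre (A c : Submodule K V) : Prop :=
  finrank K c = 1 ∧ c ≤ A ∧
    ∀ A' ∈ F, A' ≠ A → finrank K (A ⊓ A' : Submodule K V) + 1 = k → c ≤ A'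

/-- Members of `F` with a centre. -/
def good : Finset (Submodule K V) := F.filter (fun A => ∃ c, IsCentre k F A c)

/-- Members of `F` without a centre. -/
def bad : Finset (Submodule K V) := F.filter (fun A => ¬ ∃ c, IsCentre k F A c)

/-- A chosen centre. -/
def ctr (A : Submodule K V) : Submodule K V :=
  if h : ∃ c, IsCentre k F A c then h.choose else ⊥

/-- Number of good members above `H`. -/
def gdeg (H : Submodule K V) : ℝ := ((good k F).filter (H ≤ ·)).card

/-- Number of bad members above `H`. -/
def zdeg (H : Submodule K V) : ℕ := ((bad k F).filter (H ≤ ·)).card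

/-- The number of `k`-spaces above a `(k - 1)`-space. -/
def dg (K V : Type*) [Field K] [Fintype K] [AddCommGroup V] [Module K V] (k : ℕ) : ℝ :=
  qn (qr K) (finrank K V + 1 - k)

/-- The weight which a member `A` assigns to its hyperplane `H`. -/
def wt (A H : Submodule K V) : ℝ :=
  if A ∈ good k F then (if ctr k F A ≤ H then 1 / dg K V k else 1)
  else if zdeg k F H = 1 then 1 - gdeg k F H / dg K V k else 0

/-- The total weight received by `H`. -/
def om (H : Submodule K V) : ℝ := ∑ A ∈ F.filter (H ≤ ·), wt k F A H

/-- The bad members through `L` with an adjacent bad member avoiding `L`. -/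
def exch (L : Submodule K V) : Finset (Submodule K V) :=
  (bad k F).filter (fun B => L ≤ B ∧
    ∃ E ∈ bad k F, finrank K (B ⊓ E : Submodule K V) + 1 = k ∧ ¬ L ≤ E)

variable {k F}

lemma mem_bad {A : Submodule K V} : A ∈ bad k F ↔ A ∈ F ∧ ¬ ∃ c, IsCentre k F A c := by
  simp [bad]

lemma mem_good {A : Submodule K V} : A ∈ good k F ↔ A ∈ F ∧ ∃ c, IsCentre k F A c := by
  simp [good]

lemma mem_bad_iff {A : Submodule K V} (h : A ∈ F) : A ∈ bad k F ↔ A ∉ good k F := by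
  rw [mem_bad, mem_good]; tauto

lemma isCentre_ctr {A : Submodule K V} (h : A ∈ good k F) : IsCentre k F A (ctr k F A) := by
  have h' := (mem_good.1 h).2
  rw [ctr, dif_pos h']
  exact h'.choose_spec

namespace CTF

variable (h : CTF k F)
include h

lemma dg_pos : 0 < dg K V k := qn_pos (qr_pos K) (by have := h.le; have := h.two_le; omega)

lemma card_above {H : Submodule K V} (hH : finrank K H + 1 = k) :
    (((Gr K V k).filter (H ≤ ·)).card : ℝ) = dg K V k := by
  have c := card_superspaces H 1
  rw [gb_one, hH] at c
  rw [c, dg]; congr 1; omega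

lemma card_good_above_le {H : Submodule K V} (hH : finrank K H + 1 = k) :
    gdeg k F H ≤ dg K V k := by
  rw [← h.card_above hH, gdeg]
  norm_cast
  refine card_le_card fun A hA => ?_
  rw [mem_filter] at hA ⊢
  exact ⟨mem_Gr.2 (h.dim A (mem_good.1 hA.1).1), hA.2⟩

/-- A hyperplane of a good member which avoids the centre lies in no other member. -/
lemma eq_of_not_ctr_le {A A' H : Submodule K V} {c : Submodule K V} (hA : A ∈ F)
    (hc : IsCentre k F A c) (hA' : A' ∈ F)
    (hH : finrank K H + 1 = k) (h1 : H ≤ A) (h2 : H ≤ A') (h3 : ¬ c ≤ H) :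
    A' = A := by
  by_contra hne
  have e := inf_eq_of_hyperplane (h.dim A hA) (h.dim A' hA') (Ne.symm hne) hH h1 h2
  have := hc.2.2 A' hA' hne (by rw [e]; exact hH)
  exact h3 (e ▸ le_inf hc.2.1 this)

/-- Suppose B ⊓ A is a point. As it is not a centre of B, some adjacent C misses it, and then B is
the direct sum of the hyperplane B ⊓ C and this point. -/
lemma finrank_inf_bad_ne_one {A B : Submodule K V} (hB : B ∈ bad k F) (hA : A ∈ F) :
    finrank K (B ⊓ A : Submodule K V) ≠ 1 := by
  intro h1
  have hk := h.two_le
  have hBF := (mem_bad.1 hB).1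
  have hn := (mem_bad.1 hB).2
  rw [not_exists] at hn
  have hn := hn (B ⊓ A)
  simp only [IsCentre, not_and, not_forall, exists_prop] at hn
  obtain ⟨C, hC, hCB, hd, hP⟩ := hn h1 inf_le_left
  refine h.free B hBF C hC A hA ⟨h.dim B hBF, h.dim C hC, h.dim A hA, hCB.symm, ?_, ?_, ?_, ?_⟩
  · rintro rfl
    rw [inf_idem, h.dim B hBF] at h1; omega
  · rintro rfl; exact hP inf_le_right
  · have hnle : ¬ B ⊓ A ≤ B ⊓ C := fun h' => hP (h'.trans inf_le_right)
    have hdim := finrank_sup_point h1 hnle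
    have := h.dim B hBF
    exact Submodule.eq_of_le_of_finrank_le (sup_le inf_le_left inf_le_left) (by omega)
  · rw [inf_comm]
    exact inf_eq_bot_of_point h1 (fun h' => hP (h'.trans inf_le_right))

lemma two_le_finrank_inf_bad {A B : Submodule K V} (hB : B ∈ bad k F) (hA : A ∈ F)
    (hne : B ⊓ A ≠ ⊥) : 2 ≤ finrank K (B ⊓ A : Submodule K V) := by
  have h1 := h.finrank_inf_bad_ne_one hB hA
  have h2 : finrank K (B ⊓ A : Submodule K V) ≠ 0 := fun h0 => hne (Submodule.finrank_eq_zero.1 h0)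
  omega

lemma bad_eq_empty_of_two (hk : k = 2) : bad k F = ∅ := by
  rw [eq_empty_iff_forall_notMem]
  intro B hB
  have hBF := (mem_bad.1 hB).1
  have hn := (mem_bad.1 hB).2
  obtain ⟨c, hc, hcB⟩ := exists_point (A := B) (fun h0 => by
    have := h.dim B hBF
    rw [h0, finrank_bot] at this; omega)
  rw [not_exists] at hn
  have hn := hn c
  simp only [IsCentre, not_and, not_forall, exists_prop] at hn
  obtain ⟨C, hC, -, hd, -⟩ := hn hc hcB
  exact h.finrank_inf_bad_ne_one hB hC (by omega)

/-- If `B` and `E` are adjacent bad members and the point `L` lies in `B` but not in `E`, every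
member through `L` meets `E` in dimension at least two. -/
lemma two_le_finrank_inf_exch {A B E L : Submodule K V} (hB : B ∈ bad k F) (hE : E ∈ bad k F)
    (hBE : finrank K (B ⊓ E : Submodule K V) + 1 = k) (hL : finrank K L = 1) (hLB : L ≤ B)
    (hA : A ∈ F) (hLA : L ≤ A) : 2 ≤ finrank K (A ⊓ E : Submodule K V) := by
  have hL0 : L ≠ ⊥ := by rintro rfl; simp at hL
  have h1 := h.two_le_finrank_inf_bad hB hA (fun h0 => hL0 (eq_bot_iff.2 (h0 ▸ le_inf hLB hLA)))
  rw [inf_comm]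
  refine h.two_le_finrank_inf_bad hE hA fun h0 => ?_
  -- Inside B, a space of dimension at least two meets the hyperplane B ⊓ E. Hence A ⊓ E is nonzero,
  -- and badness of E upgrades this to dimension two.
  have h2 := Submodule.finrank_sup_add_finrank_inf_eq (B ⊓ A) (B ⊓ E)
  have h3 : (B ⊓ A) ⊓ (B ⊓ E) = ⊥ := by
    rw [eq_bot_iff, ← h0]
    exact le_inf (inf_le_right.trans inf_le_right) (inf_le_left.trans inf_le_right)
  have h4 := Submodule.finrank_mono (sup_le (inf_le_left : B ⊓ A ≤ B) (inf_le_left : B ⊓ E ≤ B))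
  rw [h3, finrank_bot] at h2
  rw [h.dim B (mem_bad.1 hB).1] at h4
  omega

section Hyperplane

variable {H : Submodule K V}

lemma wt_nonneg (hH : finrank K H + 1 = k) (A : Submodule K V) : 0 ≤ wt k F A H := by
  have := h.dg_pos
  rw [wt]
  split_ifs
  · positivity
  · norm_num
  · rw [sub_nonneg, div_le_one this]; exact h.card_good_above_le hH
  · exact le_rfl

/-- If a good member above H has its centre off H, it is the only member above H. Otherwise the good
members contribute `gdeg` / D, and the bad ones contribute the remainder if there is exactly one of
them, and nothing if there are none or several. -/
lemma om_le_one (hH : finrank K H + 1 = k) : om k F H ≤ 1 := by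
  have hD := h.dg_pos
  by_cases hex : ∃ A ∈ good k F, H ≤ A ∧ ¬ ctr k F A ≤ H
  · obtain ⟨A, hA, hHA, hc⟩ := hex
    have hAF := (mem_good.1 hA).1
    have : F.filter (H ≤ ·) = {A} := by
      ext A'
      simp only [mem_filter, mem_singleton]
      constructor
      · rintro ⟨h1, h2⟩
        exact h.eq_of_not_ctr_le hAF (isCentre_ctr hA) h1 hH hHA h2 hc
      · rintro rfl; exact ⟨hAF, hHA⟩
    rw [om, this, sum_singleton, wt, if_pos hA, if_neg hc]
  · push Not at hex
    rw [om, ← sum_filter_add_sum_filter_not _ (fun A => A ∈ good k F)]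
    have e1 : ∑ A ∈ (F.filter (H ≤ ·)).filter (fun A => A ∈ good k F), wt k F A H
        = gdeg k F H / dg K V k := by
      rw [gdeg, show (good k F).filter (H ≤ ·)
        = (F.filter (H ≤ ·)).filter (fun A => A ∈ good k F) by
          ext A; simp only [mem_filter, mem_good]; tauto, div_eq_mul_one_div, ← nsmul_eq_mul,
        ← sum_const]
      refine sum_congr rfl fun A hA => ?_
      simp only [mem_filter] at hA
      rw [wt, if_pos hA.2, if_pos (hex A hA.2 hA.1.2)]
    have e2 : ∑ A ∈ (F.filter (H ≤ ·)).filter (fun A => A ∉ good k F), wt k F A H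
        = zdeg k F H * (if zdeg k F H = 1 then 1 - gdeg k F H / dg K V k else 0) := by
      rw [zdeg, show (bad k F).filter (H ≤ ·)
        = (F.filter (H ≤ ·)).filter (fun A => A ∉ good k F) by
          ext A; simp only [mem_filter, mem_bad, mem_good]; tauto, ← nsmul_eq_mul,
        ← sum_const]
      refine sum_congr rfl fun A hA => ?_
      simp only [mem_filter] at hA
      rw [wt, if_neg hA.2, zdeg, show (bad k F).filter (H ≤ ·)
        = (F.filter (H ≤ ·)).filter (fun A => A ∉ good k F) by
          ext A; simp only [mem_filter, mem_bad, mem_good]; tauto]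
    have h1 : gdeg k F H / dg K V k ≤ 1 := by
      rw [div_le_one hD]; exact h.card_good_above_le hH
    rw [e1, e2]
    split_ifs with hz
    · rw [hz]; simp
    · simpa using h1

lemma exists_of_om_ne_zero (hH : om k F H ≠ 0) : ∃ A ∈ F, H ≤ A := by
  by_contra hcon
  push Not at hcon
  apply hH
  rw [om, filter_false_of_mem hcon, sum_empty]

end Hyperplane

/-- The average total weight assigned by a member. -/
lemma cstar_eq : qn (qr K) (finrank K V) / dg K V k
    = qr K ^ (k - 1) + qn (qr K) (k - 1) / dg K V k := by
  have hD := h.dg_pos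
  have h1 := h.two_le
  have h2 := h.le
  have := qn_add (q := qr K) (k - 1) (finrank K V + 1 - k)
  rw [show k - 1 + (finrank K V + 1 - k) = finrank K V by omega] at this
  rw [this]
  unfold dg at hD ⊢
  field_simp
  ring

lemma sum_wt_good {A : Submodule K V} (hA : A ∈ good k F) :
    ∑ H ∈ (Gr K V (k - 1)).filter (· ≤ A), wt k F A H = qn (qr K) (finrank K V) / dg K V k := by
  have hk := h.two_le
  have hAd := h.dim A (mem_good.1 hA).1
  obtain ⟨hc1, hc2, -⟩ := isCentre_ctr hA
  rw [h.cstar_eq]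
  have c1 := card_hyperplanes (by omega) hAd
  have c2 := card_hyperplanes_ge hAd hc2 (by omega)
  rw [hc1] at c2
  have e : ∀ H, wt k F A H = if ctr k F A ≤ H then 1 / dg K V k else 1 := fun H => by
    rw [wt, if_pos hA]
  simp_rw [e]
  rw [sum_ite, sum_const, sum_const, nsmul_eq_mul, nsmul_eq_mul, mul_one]
  have e2 : ((Gr K V (k - 1)).filter (· ≤ A)).filter (fun H => ctr k F A ≤ H)
      = (Gr K V (k - 1)).filter (fun H => ctr k F A ≤ H ∧ H ≤ A) := by
    ext; simp only [mem_filter]; tauto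
  have e3 := card_filter_add_card_filter_not (s := (Gr K V (k - 1)).filter (· ≤ A))
    (fun H => ctr k F A ≤ H)
  have e4 : (((((Gr K V (k - 1)).filter (· ≤ A)).filter (fun H => ¬ ctr k F A ≤ H)).card : ℕ) : ℝ)
      = qn (qr K) k - qn (qr K) (k - 1) := by
    rw [← c1, ← c2, ← e2, ← e3]; push_cast; ring
  rw [e4, e2, c2, qn_sub (by omega), show k - (k - 1) = 1 by omega, qn_one]
  ring

/-- Inside a `(k + 1)`-space containing a bad member, the good members pass through a common
point of the bad member. -/
lemma good_inside {B U : Submodule K V} (hB : B ∈ bad k F) (hBU : B ≤ U)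
    (hU : finrank K U = k + 1) :
    (((good k F).filter (· ≤ U)).card : ℝ) ≤ qn (qr K) k - 1 ∧
    ((((good k F).filter (· ≤ U)).card : ℝ) = qn (qr K) k - 1 →
      ∃ c : Submodule K V, finrank K c = 1 ∧ c ≤ B ∧ (∀ A ∈ F, A ≤ U → c ≤ A) ∧
        ∀ A : Submodule K V, finrank K A = k → c ≤ A → A ≤ U → A ∈ F) := by
  have hk := h.two_le
  have hBF := (mem_bad.1 hB).1
  have hBd := h.dim B hBF
  have hq := qr_pos K
  have hpos : 0 < qn (qr K) k - 1 := by
    have := qn_lt hq (show 1 < k by omega)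
    rw [qn_one] at this; linarith
  rcases ((good k F).filter (· ≤ U)).eq_empty_or_nonempty with he | ⟨A, hA⟩
  · rw [he, card_empty, Nat.cast_zero]
    exact ⟨hpos.le, fun h0 => absurd h0 hpos.ne⟩
  rw [mem_filter] at hA
  obtain ⟨hA, hAU⟩ := hA
  have hAF := (mem_good.1 hA).1
  obtain ⟨hc1, hc2, hc3⟩ := isCentre_ctr hA
  set c := ctr k F A
  -- Distinct k-spaces inside a (k+1)-space are adjacent, so the centre of one good member lies in
  -- every member inside U. Of the [k] k-spaces of U through this centre, B itself is not good.
  have through : ∀ A' ∈ F, A' ≤ U → c ≤ A' := by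
    intro A' hA' hA'U
    by_cases hne : A' = A
    · rw [hne]; exact hc2
    · refine hc3 A' hA' hne ?_
      have h1 := Submodule.finrank_sup_add_finrank_inf_eq A A'
      have h2 := Submodule.finrank_mono (sup_le hAU hA'U)
      have h3 := finrank_inf_lt (h.dim A hAF) (h.dim A' hA') (Ne.symm hne)
      rw [h.dim A hAF, h.dim A' hA'] at h1
      omega
  have cU := card_hyperplanes_ge (k := k + 1) hU (hc2.trans hAU) (by omega)
  rw [hc1, Nat.add_sub_cancel] at cU
  have hBmem : B ∈ (Gr K V k).filter (fun H => c ≤ H ∧ H ≤ U) := by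
    rw [mem_filter, mem_Gr]; exact ⟨hBd, through B hBF hBU, hBU⟩
  have hsub : (good k F).filter (· ≤ U) ⊆
      ((Gr K V k).filter (fun H => c ≤ H ∧ H ≤ U)).erase B := by
    intro A' hA'
    rw [mem_filter] at hA'
    have hA'F := (mem_good.1 hA'.1).1
    rw [mem_erase, mem_filter, mem_Gr]
    refine ⟨?_, h.dim A' hA'F, through A' hA'F hA'.2, hA'.2⟩
    rintro rfl
    exact (mem_bad_iff hA'F).1 hB hA'.1
  have hcard : (((((Gr K V k).filter (fun H => c ≤ H ∧ H ≤ U)).erase B).card : ℕ) : ℝ)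
      = qn (qr K) k - 1 := by
    rw [card_erase_of_mem hBmem, Nat.cast_sub (card_pos.2 ⟨B, hBmem⟩), cU, Nat.cast_one]
  refine ⟨?_, fun heq => ⟨c, hc1, through B hBF hBU, through, ?_⟩⟩
  · rw [← hcard]; exact_mod_cast card_le_card hsub
  · intro A' hA' hcA' hA'U
    by_cases hne : A' = B
    · rw [hne]; exact hBF
    have heq' := eq_of_subset_of_card_le hsub (by
      rw [← hcard] at heq
      exact_mod_cast heq.ge)
    have : A' ∈ (good k F).filter (· ≤ U) := by
      rw [heq', mem_erase, mem_filter, mem_Gr]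
      exact ⟨hne, hA', hcA', hA'U⟩
    exact (mem_good.1 (mem_filter.1 this).1).1

/-- Send a pair (H, A) to (A ⊔ B, A). This is injective because H = A ⊓ B. -/
lemma sum_gdeg_le {B : Submodule K V} (hB : B ∈ bad k F) :
    ∑ H ∈ (Gr K V (k - 1)).filter (· ≤ B), gdeg k F H ≤
      ∑ U ∈ (Gr K V (k + 1)).filter (B ≤ ·), (((good k F).filter (· ≤ U)).card : ℝ) := by
  have hk := h.two_le
  have hBF := (mem_bad.1 hB).1
  have hBd := h.dim B hBF
  simp only [gdeg]
  norm_cast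
  rw [← card_sigma, ← card_sigma]
  refine card_le_card_of_injOn (fun p => ⟨p.2 ⊔ B, p.2⟩) ?_ ?_
  · rintro ⟨H, A⟩ hp
    simp only [mem_coe, mem_sigma, mem_filter, mem_Gr] at hp ⊢
    obtain ⟨⟨hH, hHB⟩, hA, hHA⟩ := hp
    have hAF := (mem_good.1 hA).1
    have hne : A ≠ B := by rintro rfl; exact (mem_bad_iff hAF).1 hB hA
    have e := inf_eq_of_hyperplane (h.dim A hAF) hBd hne (by omega) hHA hHB
    have h1 := Submodule.finrank_sup_add_finrank_inf_eq A B
    rw [e, h.dim A hAF, hBd] at h1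
    exact ⟨⟨by omega, le_sup_right⟩, hA, le_sup_left⟩
  · rintro ⟨H, A⟩ hp ⟨H', A'⟩ hp' he
    simp only [mem_coe, mem_sigma, mem_filter, mem_Gr] at hp hp'
    simp only [Sigma.mk.injEq, heq_eq_eq] at he
    obtain ⟨-, rfl⟩ := he
    obtain ⟨⟨hH, hHB⟩, hA, hHA⟩ := hp
    obtain ⟨⟨hH', hHB'⟩, -, hHA'⟩ := hp'
    have hAF := (mem_good.1 hA).1
    have hne : A ≠ B := by rintro rfl; exact (mem_bad_iff hAF).1 hB hA
    have e := inf_eq_of_hyperplane (h.dim A hAF) hBd hne (by omega) hHA hHB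
    have e' := inf_eq_of_hyperplane (h.dim A hAF) hBd hne (by omega) hHA' hHB'
    rw [← e, ← e']

lemma card_above_succ {B : Submodule K V} (hB : B ∈ bad k F) :
    (((Gr K V (k + 1)).filter (B ≤ ·)).card : ℝ) = qn (qr K) (finrank K V - k) := by
  have c := card_superspaces B 1
  rwa [gb_one, h.dim B (mem_bad.1 hB).1] at c

lemma sum_gdeg_le' {B : Submodule K V} (hB : B ∈ bad k F) :
    ∑ H ∈ (Gr K V (k - 1)).filter (· ≤ B), gdeg k F H ≤
      qn (qr K) (finrank K V - k) * (qn (qr K) k - 1) := by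
  refine (h.sum_gdeg_le hB).trans ?_
  rw [← h.card_above_succ hB, ← nsmul_eq_mul]
  refine sum_le_card_nsmul _ _ _ fun U hU => ?_
  rw [mem_filter, mem_Gr] at hU
  exact (h.good_inside hB hU.2 hU.1).1

/-- This balances the scheme: a bad member without shared hyperplanes and with the maximal number
[k] - 1 of good members in each (k+1)-space above it gives away exactly as much as a good member. -/
lemma dg_mul_cstar_identity :
    qn (qr K) k - qn (qr K) (finrank K V - k) * (qn (qr K) k - 1) / dg K V k
      = qn (qr K) (finrank K V) / dg K V k := by
  have hD := h.dg_pos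
  have h1 := h.two_le
  have h2 := h.le
  have e1 := qn_succ' (q := qr K) (k - 1)
  rw [show k - 1 + 1 = k by omega] at e1
  have e2 := qn_succ' (q := qr K) (finrank K V - k)
  rw [show finrank K V - k + 1 = finrank K V + 1 - k by omega] at e2
  have e3 := qn_sub (q := qr K) (show k - 1 ≤ k by omega)
  rw [show k - (k - 1) = 1 by omega, qn_one] at e3
  rw [h.cstar_eq]
  unfold dg at hD ⊢
  field_simp
  rw [e1] at e3 ⊢
  linear_combination (qn (qr K) (k - 1)) * e2 + qn (qr K) (finrank K V + 1 - k) * e3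

end CTF

variable (k F) in
/-- Hyperplanes of `B` lying in several bad members. -/
def shared (B : Submodule K V) : Finset (Submodule K V) :=
  (Gr K V (k - 1)).filter (fun H => H ≤ B ∧ zdeg k F H ≠ 1)

namespace CTF

variable (h : CTF k F)
include h

lemma exists_of_mem_shared {B H : Submodule K V} (hB : B ∈ bad k F) (hH : H ∈ shared k F B) :
    ∃ E ∈ bad k F, E ≠ B ∧ H ≤ E := by
  rw [shared, mem_filter] at hH
  obtain ⟨-, hHB, hz⟩ := hH
  by_contra hcon
  push Not at hcon
  apply hz
  rw [zdeg, card_eq_one]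
  refine ⟨B, ?_⟩
  ext E
  rw [mem_filter, mem_singleton]
  constructor
  · rintro ⟨h1, h2⟩
    by_contra hne
    exact hcon E h1 hne h2
  · rintro rfl; exact ⟨hB, hHB⟩

lemma mem_exch_of_shared {B H L : Submodule K V} (hB : B ∈ bad k F) (hH : H ∈ shared k F B)
    (hLB : L ≤ B) (hLH : ¬ L ≤ H) : B ∈ exch k F L := by
  obtain ⟨E, hE, hne, hHE⟩ := h.exists_of_mem_shared hB hH
  rw [shared, mem_filter, mem_Gr] at hH
  have hk := h.two_le
  have e := inf_eq_of_hyperplane (h.dim B (mem_bad.1 hB).1) (h.dim E (mem_bad.1 hE).1) hne.symm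
    (by omega) hH.2.1 hHE
  rw [exch, mem_filter]
  refine ⟨hB, hLB, E, hE, by rw [e]; omega, fun hLE => hLH ?_⟩
  rw [← e]; exact le_inf hLB hLE

lemma sum_wt_bad {B : Submodule K V} (hB : B ∈ bad k F) :
    qn (qr K) k - (∑ H ∈ (Gr K V (k - 1)).filter (· ≤ B), gdeg k F H) / dg K V k
      - (shared k F B).card ≤ ∑ H ∈ (Gr K V (k - 1)).filter (· ≤ B), wt k F B H := by
  have hk := h.two_le
  have hD := h.dg_pos
  have hBF := (mem_bad.1 hB).1
  have hBg := (mem_bad_iff hBF).1 hB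
  have c1 := card_hyperplanes (by omega) (h.dim B hBF)
  rw [← c1, sum_div]
  have e : ((shared k F B).card : ℝ) = ∑ H ∈ (Gr K V (k - 1)).filter (· ≤ B),
      if zdeg k F H = 1 then 0 else 1 := by
    rw [shared, ← filter_filter, card_filter]
    push_cast
    exact sum_congr rfl fun H _ => by split_ifs <;> tauto
  have e2 : (((Gr K V (k - 1)).filter (· ≤ B)).card : ℝ)
      = ∑ H ∈ (Gr K V (k - 1)).filter (· ≤ B), (1 : ℝ) := by simp
  rw [e, e2, ← sum_sub_distrib, ← sum_sub_distrib]
  refine sum_le_sum fun H _ => ?_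
  rw [wt, if_neg hBg]
  split_ifs
  · linarith
  · have : 0 ≤ gdeg k F H / dg K V k := div_nonneg (Nat.cast_nonneg _) hD.le
    linarith

/-- Multiply by q - 1, and the left side once more by q - 1 ≥ 1. The comparison is then between
(q^(n+1-k) - 1)(q^(k-1) - 1) and q^n - q. -/
lemma qn_mul_le (hk : 3 ≤ k) :
    dg K V k * qn (qr K) (k - 1) ≤ qr K * qn (qr K) (finrank K V - 1) := by
  have h1 := h.two_le
  have h2 := h.le
  have hq := two_le_qr K
  set q := qr K
  unfold dg
  have e1 := qn_mul (q := q) (finrank K V + 1 - k)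
  have e2 := qn_mul (q := q) (k - 1)
  have e3 := qn_mul (q := q) (finrank K V - 1)
  have e4 : q * q ^ (finrank K V - 1) = q ^ (finrank K V + 1 - k) * q ^ (k - 1) := by
    rw [← pow_succ', ← pow_add]; congr 1; omega
  have p1 : q ≤ q ^ (finrank K V + 1 - k) := by
    simpa using pow_le_pow_right₀ (show 1 ≤ q by linarith) (show 1 ≤ finrank K V + 1 - k by omega)
  have p2 : 1 ≤ q ^ (k - 1) := one_le_pow₀ (by linarith)
  have n1 := qn_nonneg (q := q) (by linarith) (finrank K V + 1 - k)
  have n2 := qn_nonneg (q := q) (by linarith) (k - 1)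
  set x := qn q (finrank K V + 1 - k)
  set y := qn q (k - 1)
  set z := qn q (finrank K V - 1)
  have hq1 : 0 < q - 1 := by linarith
  have key : x * y * (q - 1) ≤ q * z * (q - 1) := by
    have h5 : x * y * (q - 1) ≤ x * y * (q - 1) * (q - 1) :=
      le_mul_of_one_le_right (mul_nonneg (mul_nonneg n1 n2) hq1.le) (by linarith)
    have h6 : x * y * (q - 1) * (q - 1)
        = (q ^ (finrank K V + 1 - k) - 1) * (q ^ (k - 1) - 1) := by
      rw [← e1, ← e2]; ring
    have h7 : q * z * (q - 1) = q ^ (finrank K V + 1 - k) * q ^ (k - 1) - q := by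
      rw [← e4, mul_assoc, e3]; ring
    rw [h6] at h5
    rw [h7]
    linarith
  exact le_of_mul_le_mul_right key hq1

/-- The loss of a bad member is controlled by the number of points at which it is exchanged. -/
lemma loss_le (hk : 3 ≤ k) {B : Submodule K V} (hB : B ∈ bad k F) :
    min ((shared k F B).card : ℝ) (qn (qr K) (finrank K V) / dg K V k) ≤
      qn (qr K) (finrank K V - 1) / (dg K V k * qn (qr K) (k - 1)) *
        ((Gr K V 1).filter (fun L => B ∈ exch k F L)).card := by
  have hD := h.dg_pos
  have hq := qr_pos K
  have hle := h.le
  have hBd := h.dim B (mem_bad.1 hB).1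
  have hk1 : 0 < qn (qr K) (k - 1) := qn_pos hq (by omega)
  have hn1 : 0 < qn (qr K) (finrank K V - 1) := qn_pos hq (by omega)
  rcases (shared k F B).eq_empty_or_nonempty with he | hne
  · rw [he, card_empty, Nat.cast_zero]
    refine (min_le_left _ _).trans ?_
    positivity
  -- A point of B outside I misses some shared hyperplane, so B is exchanged there. If I = 0, all
  -- [k] points of B are charged. If I has dimension d > 0, there are at most [k-d] shared
  -- hyperplanes, against at least q^d [k-d] charged points.
  set I := (shared k F B).inf id with hI
  have hIH : ∀ H ∈ shared k F B, I ≤ H := fun H hH => Finset.inf_le (f := id) hH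
  obtain ⟨H₀, hH₀⟩ := hne
  have hH₀' := hH₀
  rw [shared, mem_filter, mem_Gr] at hH₀'
  have hIB : I ≤ B := (hIH H₀ hH₀).trans hH₀'.2.1
  have hId : finrank K I < k := by
    have := Submodule.finrank_mono (hIH H₀ hH₀)
    omega
  have hpts : qn (qr K) k - qn (qr K) (finrank K I) ≤
      ((Gr K V 1).filter (fun L => B ∈ exch k F L)).card := by
    have cB := card_points_le B
    rw [hBd] at cB
    rw [← cB, ← card_points_le I]
    have hsub : (Gr K V 1).filter (· ≤ B) ⊆
        (Gr K V 1).filter (fun L => B ∈ exch k F L) ∪ (Gr K V 1).filter (· ≤ I) := by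
      intro L hL
      rw [mem_filter] at hL
      rw [mem_union, mem_filter, mem_filter]
      by_cases hLI : L ≤ I
      · exact Or.inr ⟨hL.1, hLI⟩
      · left
        refine ⟨hL.1, ?_⟩
        rw [hI, Finset.le_inf_iff] at hLI
        push Not at hLI
        obtain ⟨H, hH, hLH⟩ := hLI
        exact h.mem_exch_of_shared hB hH hL.2 hLH
    have := (card_le_card hsub).trans (card_union_le _ _)
    rw [sub_le_iff_le_add]
    exact_mod_cast this
  set p : ℝ := (((Gr K V 1).filter (fun L => B ∈ exch k F L)).card : ℝ)
  rcases Nat.eq_zero_or_pos (finrank K I) with h0 | hpos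
  · refine (min_le_right _ _).trans ?_
    rw [h0, qn_zero, sub_zero] at hpts
    have key : qn (qr K) (finrank K V) * qn (qr K) (k - 1)
        ≤ qn (qr K) (finrank K V - 1) * qn (qr K) k := by
      have e1 := qn_succ' (q := qr K) (k - 1)
      have e2 := qn_succ' (q := qr K) (finrank K V - 1)
      rw [show k - 1 + 1 = k by omega] at e1
      rw [show finrank K V - 1 + 1 = finrank K V by omega] at e2
      have := qn_mono hq (show k - 1 ≤ finrank K V - 1 by omega)
      rw [e1, e2]; linarith
    have h3 : qn (qr K) (finrank K V - 1) * qn (qr K) k ≤ qn (qr K) (finrank K V - 1) * p :=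
      mul_le_mul_of_nonneg_left hpts hn1.le
    rw [div_mul_eq_mul_div, div_le_div_iff₀ hD (mul_pos hD hk1)]
    have := mul_le_mul_of_nonneg_left (key.trans h3) hD.le
    linarith
  · refine (min_le_left _ _).trans ?_
    have ht : ((shared k F B).card : ℝ) ≤ qn (qr K) (k - finrank K I) := by
      rw [← card_hyperplanes_ge hBd hIB hId]
      norm_cast
      refine card_le_card fun H hH => ?_
      have h1 := hIH H hH
      rw [shared, mem_filter] at hH
      rw [mem_filter]
      exact ⟨hH.1, h1, hH.2.1⟩
    rw [qn_sub hId.le] at hpts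
    have hqI : qr K ≤ qr K ^ finrank K I := by
      have := two_le_qr K
      simpa using pow_le_pow_right₀ (show 1 ≤ qr K by linarith) hpos
    have h4 : qr K * ((shared k F B).card : ℝ) ≤ p :=
      le_trans (mul_le_mul hqI ht (Nat.cast_nonneg _) (by positivity)) hpts
    have h5 := h.qn_mul_le hk
    rw [div_mul_eq_mul_div, le_div_iff₀ (mul_pos hD hk1)]
    calc ((shared k F B).card : ℝ) * (dg K V k * qn (qr K) (k - 1))
        ≤ (shared k F B).card * (qr K * qn (qr K) (finrank K V - 1)) :=
          mul_le_mul_of_nonneg_left h5 (Nat.cast_nonneg _)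
      _ = qn (qr K) (finrank K V - 1) * (qr K * (shared k F B).card) := by ring
      _ ≤ _ := mul_le_mul_of_nonneg_left h4 hn1.le

lemma cstar_le_sum_wt {A : Submodule K V} (hA : A ∈ F) :
    qn (qr K) (finrank K V) / dg K V k ≤
      ∑ H ∈ (Gr K V (k - 1)).filter (· ≤ A), wt k F A H +
      qn (qr K) (finrank K V - 1) / (dg K V k * qn (qr K) (k - 1)) *
        ((Gr K V 1).filter (fun L => A ∈ exch k F L)).card := by
  have hD := h.dg_pos
  have hq := qr_pos K
  have hk2 := h.two_le
  by_cases hg : A ∈ good k F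
  · rw [h.sum_wt_good hg]
    have := qn_nonneg hq (k - 1)
    have := qn_nonneg hq (finrank K V - 1)
    have : 0 ≤ qn (qr K) (finrank K V - 1) / (dg K V k * qn (qr K) (k - 1)) *
        (((Gr K V 1).filter (fun L => A ∈ exch k F L)).card : ℝ) := by positivity
    linarith
  · have hB := (mem_bad_iff hA).2 hg
    have hk3 : 3 ≤ k := by
      by_contra hcon
      have := h.bad_eq_empty_of_two (by omega)
      rw [this] at hB
      exact absurd hB (notMem_empty A)
    have h1 := h.loss_le hk3 hB
    have h2 := h.sum_wt_bad hB
    have h3 := div_le_div_of_nonneg_right (h.sum_gdeg_le' hB) hD.le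
    have h4 := h.dg_mul_cstar_identity
    have h5 : 0 ≤ ∑ H ∈ (Gr K V (k - 1)).filter (· ≤ A), wt k F A H :=
      sum_nonneg fun H hH => h.wt_nonneg (by
        rw [mem_filter, mem_Gr] at hH; omega) A
    -- Weights are nonnegative, so the deficit of a member never exceeds [n]/D. This is why bounding
    -- the minimum is enough.
    rcases min_cases ((shared k F A).card : ℝ) (qn (qr K) (finrank K V) / dg K V k) with hm | hm
    · rw [hm.1] at h1; linarith
    · rw [hm.1] at h1; linarith

lemma sum_om_eq : ∑ H ∈ Gr K V (k - 1), om k F H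
    = ∑ A ∈ F, ∑ H ∈ (Gr K V (k - 1)).filter (· ≤ A), wt k F A H := by
  simp only [om, sum_filter]
  rw [sum_comm]

lemma sum_om_through : ∑ L ∈ Gr K V 1, ∑ H ∈ (Gr K V (k - 1)).filter (L ≤ ·), om k F H
    = qn (qr K) (k - 1) * ∑ H ∈ Gr K V (k - 1), om k F H := by
  simp_rw [sum_filter]
  rw [sum_comm, mul_sum]
  refine sum_congr rfl fun H hH => ?_
  rw [mem_Gr] at hH
  rw [← sum_filter, sum_const, nsmul_eq_mul, card_points_le, hH]

/-- The main inequality: the size of `F` is an average of local quantities over the points. -/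
theorem cstar_mul_card_le :
    qn (qr K) (k - 1) * (qn (qr K) (finrank K V) / dg K V k * F.card) ≤
      ∑ L ∈ Gr K V 1, (∑ H ∈ (Gr K V (k - 1)).filter (L ≤ ·), om k F H +
        qn (qr K) (finrank K V - 1) / dg K V k * (exch k F L).card) := by
  have hD := h.dg_pos
  have hq := qr_pos K
  have hk2 := h.two_le
  have hk1 : 0 < qn (qr K) (k - 1) := qn_pos hq (by omega)
  rw [sum_add_distrib, h.sum_om_through, h.sum_om_eq, ← mul_sum]
  have h1 := sum_le_sum fun A hA => h.cstar_le_sum_wt (A := A) hA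
  rw [sum_const, nsmul_eq_mul, sum_add_distrib, ← mul_sum] at h1
  have h2 : ∑ A ∈ F, (((Gr K V 1).filter (fun L => A ∈ exch k F L)).card : ℝ)
      = ∑ L ∈ Gr K V 1, ((exch k F L).card : ℝ) := by
    have e := sum_card_bipartiteAbove_eq_sum_card_bipartiteBelow (s := F) (t := Gr K V 1)
      (fun A L => A ∈ exch k F L)
    simp only [bipartiteAbove, bipartiteBelow] at e
    norm_cast
    rw [e]
    refine sum_congr rfl fun L _ => ?_
    congr 1
    ext A
    rw [mem_filter]
    refine ⟨fun h => h.2, fun h => ⟨?_, h⟩⟩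
    rw [exch, mem_filter] at h
    exact (mem_bad.1 h.1).1
  rw [h2] at h1
  have h3 := mul_le_mul_of_nonneg_left h1 hk1.le
  have e : qn (qr K) (k - 1) * (qn (qr K) (finrank K V - 1) / (dg K V k * qn (qr K) (k - 1)) *
      ∑ L ∈ Gr K V 1, ((exch k F L).card : ℝ))
      = qn (qr K) (finrank K V - 1) / dg K V k * ∑ L ∈ Gr K V 1, ((exch k F L).card : ℝ) := by
    field_simp
  rw [mul_add, e] at h3
  linarith

end CTF

end Weights


/-! ### Ratios of Gaussian binomials and proportions of meeting spaces. -/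

section MoreNumbers

variable {q : ℝ}

lemma gb_mul_right (hq : 0 < q) {n k : ℕ} (hk : k ≤ n) :
    gb q (n + 1) k * qn q (n + 1 - k) = qn q (n + 1) * gb q n k := by
  have h1 := gb_absorb hq (n + 1) k
  have h2 := gb_mul hq n k
  rw [qn_sub (by omega)] at h1
  have : q ^ k ≠ 0 := (pow_pos hq k).ne'
  apply mul_left_cancel₀ this
  linear_combination q ^ k * h2 - h1

lemma gb_ratio (hq : 0 < q) {n k : ℕ} (hk : 1 ≤ k) (hn : 1 ≤ n) :
    gb q (n - 1) (k - 1) = qn q k / qn q n * gb q n k := by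
  obtain ⟨k, rfl⟩ := Nat.exists_eq_add_of_le' hk
  obtain ⟨n, rfl⟩ := Nat.exists_eq_add_of_le' hn
  have h := gb_mul hq n k
  have := (qn_pos hq (Nat.succ_pos n)).ne'
  simp only [Nat.add_sub_cancel]
  rw [div_mul_eq_mul_div, h]
  field_simp

/-- The proportion of `(k - 1)`-spaces through a point meeting a given `k`-space. -/
def ν₁ (q : ℝ) (n k : ℕ) : ℝ := qn q k * (qn q (k - 2) / qn q (n - 1))

lemma nu_one_le {n k : ℕ} (hq : 1 < q) (hk : 3 ≤ k) {r : ℝ} (hr : 0 < r) (hn : k ≤ n)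
    (h : q ^ k ≤ r * q ^ (n - 1 - (k - 2))) : ν₁ q n k ≤ r / (q - 1) := by
  have hq0 : 0 < q := by linarith
  have hP := pow_pos hq0 k
  have b1 := qn_div_le hq0 (a := k - 2) (b := n - 1) (by omega) (by omega) hP h
  have b2 : qn q k ≤ q ^ k / (1 * (q - 1)) := qn_le_div hq (by ring) one_pos
  have hq1 : 0 < q - 1 := by linarith
  calc ν₁ q n k ≤ q ^ k / (1 * (q - 1)) * (r / q ^ k) :=
        mul_le_mul b2 b1 (div_nonneg (qn_nonneg hq0 _) (qn_nonneg hq0 _)) (by positivity)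
    _ = _ := by field_simp

lemma nu_one_le_quarter {n k : ℕ} (hk : 3 ≤ k) (h : 3 ≤ q ∧ 2 * k ≤ n ∨ q = 2 ∧ 2 * k + 1 ≤ n) :
    ν₁ q n k ≤ 1 / 4 := by
  rcases h with ⟨hq, hn⟩ | ⟨rfl, hn⟩
  · have hq0 : 0 < q := by linarith
    refine (nu_one_le (r := 1 / q) (by linarith) hk (by positivity) (by omega) ?_).trans ?_
    · have : q ^ (k + 1) ≤ q ^ (n - 1 - (k - 2)) :=
        pow_le_pow_right₀ (by linarith) (by omega)
      rw [one_div, ← div_eq_inv_mul, le_div_iff₀ hq0]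
      rwa [pow_succ] at this
    · rw [div_div, div_le_div_iff₀ (by nlinarith) (by norm_num)]
      nlinarith
  · refine (nu_one_le (r := 1 / 4) (by norm_num) hk (by norm_num) (by omega) ?_).trans
      (by norm_num)
    have : (2 : ℝ) ^ (k + 2) ≤ 2 ^ (n - 1 - (k - 2)) :=
      pow_le_pow_right₀ (by norm_num) (by omega)
    rw [pow_add] at this
    linarith

lemma nu_one_le_half {n k : ℕ} (hk : 3 ≤ k) (hn : 2 * k ≤ n) : ν₁ 2 n k ≤ 1 / 2 := by
  refine (nu_one_le (r := 1 / 2) (by norm_num) hk (by norm_num) (by omega) ?_).trans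
    (by norm_num)
  have : (2 : ℝ) ^ (k + 1) ≤ 2 ^ (n - 1 - (k - 2)) :=
    pow_le_pow_right₀ (by norm_num) (by omega)
  rw [pow_add] at this
  linarith

end MoreNumbers

/-! ### The local inequality at a point, in the quotient by this point. -/

section Local

set_option linter.unusedSectionVars false

variable {K V : Type*} [Field K] [Fintype K] [AddCommGroup V] [Module K V] [FiniteDimensional K V]

/-- The scaled form of the inequalities for an intersecting family all of whose members meet a
fixed space in dimension at least two. -/
lemma exists_scaled {k n : ℕ} (hk : 4 ≤ k) (hn : 2 * k ≤ n) (hV : finrank K V = n - 1)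
    {𝒴 : Finset (Submodule K V)} {T : Submodule K V}
    (h𝒴 : ∀ X ∈ 𝒴, finrank K X = k - 1) (hint : ∀ X ∈ 𝒴, ∀ X' ∈ 𝒴, X ⊓ X' ≠ ⊥)
    (hT : finrank K T = k) (hXT : ∀ X ∈ 𝒴, 2 ≤ finrank K (X ⊓ T : Submodule K V)) :
    ∃ z : ℝ, (𝒴.card / gb (qr K) (n - 2) (k - 2) - z) * (z - s₀ (qr K) n k) ≤ c₀ (qr K) n k ∧
      z ≤ qn (qr K) (k - 1) * s₀ (qr K) n k ∧
      (𝒴.card / gb (qr K) (n - 2) (k - 2)) ^ 2 ≤ κ₀ (qr K) n k ^ 2 +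
        2 * (qr K + 1) * (𝒴.card / gb (qr K) (n - 2) (k - 2)) * z := by
  have hq := qr_pos K
  have hT' : finrank K T = k - 1 + 1 := by omega
  set M := gb (qr K) (n - 2) (k - 2) with hM
  have hMpos : 0 < M := gb_pos hq (by omega)
  have hg : gb (qr K) (n - 1 - 2) (k - 1 - 2) = s₀ (qr K) n k * M := by
    have := gb_ratio hq (n := n - 2) (k := k - 2) (by omega) (by omega)
    rw [show n - 1 - 2 = n - 2 - 1 by omega, show k - 1 - 2 = k - 2 - 1 by omega, this, s₀]
  have hne : ((Gr K V 1).filter (· ≤ T)).Nonempty := by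
    rw [← card_pos]
    have := card_points_le T
    have h2 := qn_pos hq (show 0 < finrank K T by omega)
    rw [← this] at h2
    exact_mod_cast h2
  -- R is a point of T of maximal degree, so that the same z serves in all three inequalities.
  obtain ⟨R, hR, hmax⟩ := exists_max_image _ (fun R => (𝒴.filter (R ≤ ·)).card) hne
  rw [mem_filter, mem_Gr] at hR
  have f1 := card_off_point_mul_le (by omega) (by omega) h𝒴 hint hT' hXT hR.1
  have f2 := card_through_point_le (by omega) h𝒴 hT' hXT hR.1 hR.2
  have f3 := card_sq_le (by omega) (by omega) h𝒴 hint hT' hXT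
    (z := ((𝒴.filter (R ≤ ·)).card : ℝ)) (fun S hS hST => by
      exact_mod_cast hmax S (by rw [mem_filter, mem_Gr]; exact ⟨hS, hST⟩))
  rw [hV, hg] at f1 f2 f3
  rw [show n - 1 - 1 = n - 2 by omega, show k - 1 - 1 = k - 2 by omega,
    show n - 1 - 2 = n - 3 by omega, show k - 1 + 1 = k by omega, ← hM] at f1
  rw [show k - 1 + 1 = k by omega, show k - 1 - 2 = k - 3 by omega,
    show n - 1 - 4 = n - 5 by omega] at f3
  set z : ℝ := ((𝒴.filter (R ≤ ·)).card : ℝ)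
  set y : ℝ := (𝒴.card : ℝ)
  refine ⟨z / M, ?_, ?_, ?_⟩
  · rw [c₀, le_div_iff₀ (by linarith)]
    have e : (y / M - z / M) * (z / M - s₀ (qr K) n k) * (qr K + 1)
        = (qr K + 1) * (y - z) * (z - s₀ (qr K) n k * M) / M ^ 2 := by field_simp
    rw [e, div_le_iff₀ (by positivity)]
    refine f1.trans (le_of_eq ?_)
    ring
  · rw [div_le_iff₀ hMpos]; linarith
  · have e : (y / M) ^ 2 = y ^ 2 / M ^ 2 := by ring
    rw [e, div_le_iff₀ (by positivity)]
    refine f3.trans (le_of_eq ?_)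
    rw [κ₀]; field_simp

/-- Counting the spaces which meet a given space. -/
lemma card_meeting_le {d : ℕ} (hd : 1 ≤ d) (T : Submodule K V) :
    (((Gr K V d).filter (fun H => H ⊓ T ≠ ⊥)).card : ℝ) ≤
      qn (qr K) (finrank K T) * gb (qr K) (finrank K V - 1) (d - 1) := by
  have hsub : (Gr K V d).filter (fun H => H ⊓ T ≠ ⊥) ⊆
      ((Gr K V 1).filter (· ≤ T)).biUnion (fun R => (Gr K V d).filter (R ≤ ·)) := by
    intro H hH
    rw [mem_filter] at hH
    obtain ⟨R, hR, hRH⟩ := exists_point hH.2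
    simp only [mem_biUnion, mem_filter, mem_Gr]
    exact ⟨R, ⟨hR, hRH.trans inf_le_right⟩, mem_Gr.1 hH.1, hRH.trans inf_le_left⟩
  rw [← card_points_le, ← nsmul_eq_mul]
  refine le_trans ?_ (sum_le_card_nsmul _ (fun R => (((Gr K V d).filter (R ≤ ·)).card : ℝ)) _ ?_)
  · exact_mod_cast (card_le_card hsub).trans card_biUnion_le
  · intro R hR
    rw [mem_filter, mem_Gr] at hR
    have := card_filter_superspace_le (𝒴 := Gr K V d) (fun X hX => mem_Gr.1 hX) (S := R) (by omega)
    rwa [hR.1] at this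

/-- Counting the spaces which meet two given spaces. -/
lemma card_meeting_two_le {d : ℕ} (hd : 2 ≤ d) {T T' : Submodule K V}
    (hTT : finrank K T' = finrank K T) :
    (((Gr K V d).filter (fun H => H ⊓ T ≠ ⊥ ∧ H ⊓ T' ≠ ⊥)).card : ℝ) ≤
      qn (qr K) (finrank K (T ⊓ T' : Submodule K V)) * gb (qr K) (finrank K V - 1) (d - 1) +
      (qn (qr K) (finrank K T) - qn (qr K) (finrank K (T ⊓ T' : Submodule K V))) ^ 2 *
        gb (qr K) (finrank K V - 2) (d - 2) := by
  set P := (Gr K V 1).filter (fun R => R ≤ T ∧ ¬ R ≤ T')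
  set P' := (Gr K V 1).filter (fun R => R ≤ T' ∧ ¬ R ≤ T)
  have cP : ∀ A B : Submodule K V, (((Gr K V 1).filter (fun R => R ≤ A ∧ ¬ R ≤ B)).card : ℝ)
      = qn (qr K) (finrank K A) - qn (qr K) (finrank K (A ⊓ B : Submodule K V)) := by
    intro A B
    rw [← card_points_le, ← card_points_le,
      ← card_filter_add_card_filter_not (s := (Gr K V 1).filter (· ≤ A)) (· ≤ B), filter_filter,
      filter_filter]
    have : (Gr K V 1).filter (fun R => R ≤ A ∧ R ≤ B) = (Gr K V 1).filter (· ≤ A ⊓ B) := by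
      ext; simp only [mem_filter, le_inf_iff]
    rw [this]; push_cast; ring
  -- A space meeting both T and T' contains a point of T ⊓ T', or else one point of T off T' and one
  -- point of T' off T.
  have hcov : (Gr K V d).filter (fun H => H ⊓ T ≠ ⊥ ∧ H ⊓ T' ≠ ⊥) ⊆
      (Gr K V d).filter (fun H => H ⊓ (T ⊓ T') ≠ ⊥) ∪
      (P ×ˢ P').biUnion (fun a => (Gr K V d).filter (a.1 ⊔ a.2 ≤ ·)) := by
    intro H hH
    rw [mem_filter] at hH
    rw [mem_union, mem_filter]
    by_cases h0 : H ⊓ (T ⊓ T') ≠ ⊥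
    · exact Or.inl ⟨hH.1, h0⟩
    · right
      rw [not_not] at h0
      obtain ⟨R, hR, hRH⟩ := exists_point hH.2.1
      obtain ⟨R', hR', hRH'⟩ := exists_point hH.2.2
      have hbot : ∀ {S : Submodule K V}, finrank K S = 1 → S ≤ H → S ≤ T → ¬ S ≤ T' := by
        intro S hS h1 h2 h3
        have : S ≤ ⊥ := h0 ▸ le_inf h1 (le_inf h2 h3)
        rw [le_bot_iff] at this
        rw [this, finrank_bot] at hS; omega
      simp only [mem_biUnion, mem_product, mem_filter, mem_Gr, P, P']
      refine ⟨(R, R'), ⟨⟨hR, hRH.trans inf_le_right, ?_⟩, hR', hRH'.trans inf_le_right, ?_⟩,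
        mem_Gr.1 hH.1, sup_le (hRH.trans inf_le_left) (hRH'.trans inf_le_left)⟩
      · exact hbot hR (hRH.trans inf_le_left) (hRH.trans inf_le_right)
      · exact fun h' => hbot hR' (hRH'.trans inf_le_left) h' (hRH'.trans inf_le_right)
  have b1 := card_meeting_le (d := d) (by omega) (T ⊓ T')
  have b2 : (((P ×ˢ P').biUnion (fun a => (Gr K V d).filter (a.1 ⊔ a.2 ≤ ·))).card : ℝ) ≤
      (P ×ˢ P').card • gb (qr K) (finrank K V - 2) (d - 2) := by
    refine le_trans ?_ (sum_le_card_nsmul _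
      (fun a => (((Gr K V d).filter (a.1 ⊔ a.2 ≤ ·)).card : ℝ)) _ ?_)
    · exact_mod_cast card_biUnion_le
    · rintro ⟨R, R'⟩ ha
      simp only [mem_product, mem_filter, mem_Gr, P, P'] at ha
      obtain ⟨⟨hR, hRT, hRT'⟩, hR', hR'T', -⟩ := ha
      have hnle : ¬ R' ≤ R := by
        intro hle
        have := Submodule.eq_of_le_of_finrank_eq hle (by omega)
        subst this
        exact hRT' hR'T'
      have hd2 : finrank K (R ⊔ R' : Submodule K V) = 2 := by
        rw [finrank_sup_point hR' hnle, hR]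
      have := card_filter_superspace_le (𝒴 := Gr K V d) (fun X hX => mem_Gr.1 hX)
        (S := R ⊔ R') (by omega)
      rwa [hd2] at this
  rw [nsmul_eq_mul, card_product, Nat.cast_mul, cP, cP, hTT, inf_comm T' T, ← sq] at b2
  have b3 := (card_le_card hcov).trans (card_union_le _ _)
  have b4 : (((Gr K V d).filter (fun H => H ⊓ T ≠ ⊥ ∧ H ⊓ T' ≠ ⊥)).card : ℝ) ≤
    ((Gr K V d).filter (fun H => H ⊓ (T ⊓ T') ≠ ⊥)).card +
      ((P ×ˢ P').biUnion (fun a => (Gr K V d).filter (a.1 ⊔ a.2 ≤ ·))).card := by exact_mod_cast b3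
  linarith

lemma map_mkQ_injOn {L A B : Submodule K V} (hA : L ≤ A) (hB : L ≤ B)
    (h : A.map L.mkQ = B.map L.mkQ) : A = B := by
  have := congrArg (Submodule.comap L.mkQ) h
  rwa [Submodule.comap_map_eq, Submodule.comap_map_eq, Submodule.ker_mkQ, sup_eq_left.2 hA,
    sup_eq_left.2 hB] at this

lemma two_le_map_mkQ {L A E : Submodule K V} (hL : finrank K L = 1) (hLE : ¬ L ≤ E)
    (h : 2 ≤ finrank K (A ⊓ E : Submodule K V)) :
    2 ≤ finrank K (A.map L.mkQ ⊓ (E ⊔ L).map L.mkQ : Submodule K (V ⧸ L)) := by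
  have h1 := finrank_map_mkQ_add L (A ⊓ E)
  have h2 : (A ⊓ E) ⊓ L = ⊥ := by
    rw [inf_comm]
    exact inf_eq_bot_of_point hL fun h' => hLE (h'.trans inf_le_right)
  rw [h2, finrank_bot] at h1
  have h3 : (A ⊓ E).map L.mkQ ≤ A.map L.mkQ ⊓ (E ⊔ L).map L.mkQ :=
    le_inf (Submodule.map_mono inf_le_left) (Submodule.map_mono (inf_le_right.trans le_sup_left))
  have := Submodule.finrank_mono h3
  omega

lemma meets_of_hyperplane {H A E : Submodule K V}
    (hHA : H ≤ A) (hd : finrank K A ≤ finrank K H + 1)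
    (h2 : 2 ≤ finrank K (A ⊓ E : Submodule K V)) : H ⊓ E ≠ ⊥ := by
  intro h0
  have h1 := Submodule.finrank_sup_add_finrank_inf_eq H (A ⊓ E)
  have h3 : H ⊓ (A ⊓ E) = ⊥ := by
    rw [eq_bot_iff, ← h0]; exact le_inf inf_le_left (inf_le_right.trans inf_le_right)
  have h4 := Submodule.finrank_mono (sup_le hHA (inf_le_left : A ⊓ E ≤ A))
  rw [h3, finrank_bot] at h1
  omega

variable {k : ℕ} {F : Finset (Submodule K V)}

namespace CTF

variable (h : CTF k F)
include h

/-- The weight through a point `L` is bounded by the number of images in `V ⧸ L` of spaces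
contained in a member of `F`. -/
lemma sum_om_le_card {L : Submodule K V} (hL : finrank K L = 1)
    (p : Submodule K (V ⧸ L) → Prop) [DecidablePred p]
    (hp : ∀ H : Submodule K V, finrank K H + 1 = k → L ≤ H → (∃ A ∈ F, H ≤ A) →
      p (H.map L.mkQ)) :
    ∑ H ∈ (Gr K V (k - 1)).filter (L ≤ ·), om k F H ≤
      (((Gr K (V ⧸ L) (k - 2)).filter p).card : ℝ) := by
  have hk := h.two_le
  set S := ((Gr K V (k - 1)).filter (L ≤ ·)).filter (fun H => ∃ A ∈ F, H ≤ A)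
  have h1 : ∑ H ∈ (Gr K V (k - 1)).filter (L ≤ ·), om k F H ≤ (S.card : ℝ) := by
    rw [card_eq_sum_ones, sum_filter (s := (Gr K V (k - 1)).filter (L ≤ ·))]
    push_cast
    refine sum_le_sum fun H hH => ?_
    rw [mem_filter, mem_Gr] at hH
    split_ifs with hex
    · simpa using h.om_le_one (H := H) (by omega)
    · have : om k F H = 0 := by
        by_contra hne
        exact hex (h.exists_of_om_ne_zero hne)
      rw [this]
  refine h1.trans ?_
  norm_cast
  refine card_le_card_of_injOn (fun H => H.map L.mkQ) ?_ ?_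
  · intro H hH
    simp only [S, coe_filter, mem_filter, mem_Gr, Set.mem_ofPred_eq] at hH ⊢
    obtain ⟨⟨hHd, hLH⟩, hex⟩ := hH
    have := finrank_map_mkQ hLH
    exact ⟨by omega, hp H (by omega) hLH hex⟩
  · intro H hH H' hH' he
    simp only [S, coe_filter, mem_filter, mem_Gr, Set.mem_ofPred_eq] at hH hH'
    exact map_mkQ_injOn hH.1.2 hH'.1.2 he

/-- A space `E` that all members through `L` meet in dimension at least two. -/
lemma meets_map {L E : Submodule K V} (hL : finrank K L = 1) (hLE : ¬ L ≤ E)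
    (hE : ∀ A ∈ F, L ≤ A → 2 ≤ finrank K (A ⊓ E : Submodule K V))
    {H : Submodule K V} (hH : finrank K H + 1 = k) (hLH : L ≤ H) (hex : ∃ A ∈ F, H ≤ A) :
    H.map L.mkQ ⊓ (E ⊔ L).map L.mkQ ≠ ⊥ := by
  obtain ⟨A, hA, hHA⟩ := hex
  have h1 := two_le_map_mkQ hL hLE (hE A hA (hLH.trans hHA))
  refine meets_of_hyperplane (Submodule.map_mono hHA) ?_ h1
  have := finrank_map_mkQ hLH
  have := finrank_map_mkQ (hLH.trans hHA)
  have := h.dim A hA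
  omega

end CTF

lemma finrank_map_sup_mkQ {L E : Submodule K V} (hL : finrank K L = 1) (hLE : ¬ L ≤ E) :
    finrank K ((E ⊔ L).map L.mkQ) = finrank K E := by
  have := finrank_map_mkQ (le_sup_right : L ≤ E ⊔ L)
  have := finrank_sup_point hL hLE
  omega

lemma le_of_adjacent {B E L : Submodule K V} (hB : finrank K B = k)
    (hBE : finrank K (B ⊓ E : Submodule K V) + 1 = k) (hL : finrank K L = 1) (hLB : L ≤ B)
    (hLE : ¬ L ≤ E) : B ≤ E ⊔ L := by
  have h1 : ¬ L ≤ B ⊓ E := fun h' => hLE (h'.trans inf_le_right)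
  have h2 := finrank_sup_point hL h1
  have h3 : B ⊓ E ⊔ L = B :=
    Submodule.eq_of_le_of_finrank_eq (sup_le inf_le_left hLB) (by omega)
  rw [← h3]
  exact sup_le_sup_right inf_le_right L

namespace CTF

variable (h : CTF k F)
include h

/-- At a point where a bad member is exchanged, the local contribution is strictly below
average. -/
theorem local_lt {L : Submodule K V} (hL : finrank K L = 1) (hne : (exch k F L).Nonempty) :
    ∑ H ∈ (Gr K V (k - 1)).filter (L ≤ ·), om k F H +
      qn (qr K) (finrank K V - 1) / dg K V k * (exch k F L).card <
      gb (qr K) (finrank K V - 1) (k - 2) := by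
  have hq := qr_pos K
  have hD := h.dg_pos
  have hk2 := h.two_le
  have hle := h.le
  obtain ⟨B, hBx⟩ := hne
  have hBx' := hBx
  rw [exch, mem_filter] at hBx'
  obtain ⟨hB, hLB, E, hE, hBE, hLE⟩ := hBx'
  have hk : 3 ≤ k := by
    by_contra hcon
    have := h.bad_eq_empty_of_two (by omega)
    rw [this] at hB
    exact absurd hB (notMem_empty B)
  set n := finrank K V with hn
  have hEd := h.dim E (mem_bad.1 hE).1
  have hE2 : ∀ A ∈ F, L ≤ A → 2 ≤ finrank K (A ⊓ E : Submodule K V) :=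
    fun A hA hLA => h.two_le_finrank_inf_exch hB hE hBE hL hLB hA hLA
  have hW : finrank K (V ⧸ L) = n - 1 := by
    have := Submodule.finrank_quotient_add_finrank L
    omega
  set T := (E ⊔ L).map L.mkQ with hT
  have hTd : finrank K T = k := by rw [hT, finrank_map_sup_mkQ hL hLE, hEd]
  set M := gb (qr K) (n - 2) (k - 2) with hM
  set C := gb (qr K) (n - 1) (k - 2) with hC
  have hMpos : 0 < M := gb_pos hq (by omega)
  have hCpos : 0 < C := gb_pos hq (by omega)
  -- The charge per exchanged member is C / M. After division by C the claim becomes w + |𝒴| / M <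
  -- 1, where w bounds the proportion of (k-1)-spaces through L that carry weight.
  have hCM : qn (qr K) (n - 1) / dg K V k = C / M := by
    have := gb_mul_right hq (n := n - 2) (k := k - 2) (by omega)
    rw [show n - 2 + 1 = n - 1 by omega, show n - 1 - (k - 2) = n + 1 - k by omega] at this
    rw [div_eq_div_iff hD.ne' hMpos.ne', dg, ← hn, ← this]
  -- the images in the quotient
  set 𝒴 := (exch k F L).image (fun A => A.map L.mkQ) with h𝒴
  have hexF : ∀ A ∈ exch k F L, A ∈ bad k F ∧ A ∈ F ∧ L ≤ A := by
    intro A hA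
    rw [exch, mem_filter] at hA
    exact ⟨hA.1, (mem_bad.1 hA.1).1, hA.2.1⟩
  have hcard : 𝒴.card = (exch k F L).card := by
    refine card_image_of_injOn fun A hA A' hA' he => ?_
    exact map_mkQ_injOn (hexF A hA).2.2 (hexF A' hA').2.2 he
  have h𝒴d : ∀ X ∈ 𝒴, finrank K X = k - 1 := by
    intro X hX
    obtain ⟨A, hA, rfl⟩ := mem_image.1 hX
    have := finrank_map_mkQ (hexF A hA).2.2
    have := h.dim A (hexF A hA).2.1
    omega
  have hint : ∀ X ∈ 𝒴, ∀ X' ∈ 𝒴, X ⊓ X' ≠ ⊥ := by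
    intro X hX X' hX' h0
    obtain ⟨A, hA, rfl⟩ := mem_image.1 hX
    obtain ⟨A', hA', rfl⟩ := mem_image.1 hX'
    obtain ⟨a1, a2, a3⟩ := hexF A hA
    obtain ⟨b1, b2, b3⟩ := hexF A' hA'
    have h1 := h.two_le_finrank_inf_bad a1 b2 (fun h0 => by
      have : L ≤ ⊥ := h0 ▸ le_inf a3 b3
      rw [le_bot_iff] at this
      rw [this, finrank_bot] at hL; omega)
    have h2 := finrank_map_mkQ (le_inf a3 b3)
    have h3 : (A ⊓ A').map L.mkQ ≤ ⊥ := by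
      rw [← h0]
      exact le_inf (Submodule.map_mono inf_le_left) (Submodule.map_mono inf_le_right)
    rw [le_bot_iff] at h3
    rw [h3, finrank_bot] at h2
    omega
  have hXT : ∀ X ∈ 𝒴, 2 ≤ finrank K (X ⊓ T : Submodule K (V ⧸ L)) := by
    intro X hX
    obtain ⟨A, hA, rfl⟩ := mem_image.1 hX
    exact two_le_map_mkQ hL hLE (hE2 A (hexF A hA).2.1 (hexF A hA).2.2)
  -- the weight through `L`
  set W := ∑ H ∈ (Gr K V (k - 1)).filter (L ≤ ·), om k F H with hWdef
  have r1 : gb (qr K) (n - 1 - 1) (k - 2 - 1) = qn (qr K) (k - 2) / qn (qr K) (n - 1) * C :=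
    gb_ratio hq (by omega) (by omega)
  have hW1 : W ≤ ν₁ (qr K) n k * C := by
    have b1 := h.sum_om_le_card hL (fun X => X ⊓ T ≠ ⊥)
      (fun H hH hLH hex => h.meets_map hL hLE hE2 hH hLH hex)
    have b2 := card_meeting_le (d := k - 2) (by omega) T
    rw [hTd, hW, r1] at b2
    refine b1.trans (b2.trans (le_of_eq ?_))
    rw [ν₁]; ring
  have finish : ∀ {w : ℝ}, W ≤ w * C → w + (𝒴.card : ℝ) / M < 1 →
      W + qn (qr K) (n - 1) / dg K V k * (exch k F L).card < C := by
    intro w hw hlt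
    rw [hCM, ← hcard]
    have : C / M * (𝒴.card : ℝ) = (𝒴.card : ℝ) / M * C := by ring
    rw [this]
    nlinarith
  rcases hk.eq_or_lt with hk3 | hk4
  · -- all members lie in a common space
    have hsub : 𝒴 ⊆ (Gr K (V ⧸ L) (k - 1)).filter (· ≤ T) := by
      intro X hX
      have h1 := h𝒴d X hX
      have h2 := hXT X hX
      rw [mem_filter, mem_Gr]
      refine ⟨h1, ?_⟩
      rw [← inf_eq_left]
      exact Submodule.eq_of_le_of_finrank_le inf_le_left (by omega)
    have h1 : (𝒴.card : ℝ) ≤ qn (qr K) k := by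
      rw [← card_hyperplanes (by omega) hTd]
      exact_mod_cast card_le_card hsub
    refine finish hW1 ?_
    have hM1 : M = qn (qr K) (n - 2) := by
      rw [hM, show k - 2 = 1 by omega, gb_one]
    have hν : ν₁ (qr K) n k = qn (qr K) 3 / qn (qr K) (n - 1) := by
      rw [ν₁, show k - 2 = 1 by omega, ← hk3, qn_one]; ring
    have hq2 := two_le_qr K
    have c1 := qn_mono hq (show 4 ≤ n - 2 by omega)
    have c2 := qn_mono hq (show 5 ≤ n - 1 by omega)
    have c3 := qn_succ' (q := qr K) 3
    have c4 := qn_succ' (q := qr K) 4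
    have c5 := qn_pos hq (show 0 < 3 by omega)
    have c6 : 2 * qn (qr K) 3 ≤ qr K * qn (qr K) 3 := mul_le_mul_of_nonneg_right hq2 c5.le
    have c7 : 2 * qn (qr K) 4 ≤ qr K * qn (qr K) 4 :=
      mul_le_mul_of_nonneg_right hq2 (qn_nonneg hq 4)
    rw [hν, hM1]
    have d1 : (𝒴.card : ℝ) / qn (qr K) (n - 2) ≤ 1 / 2 := by
      rw [div_le_div_iff₀ (qn_pos hq (by omega)) (by norm_num)]
      rw [← hk3] at h1
      linarith
    have d2 : qn (qr K) 3 / qn (qr K) (n - 1) < 1 / 2 := by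
      rw [div_lt_div_iff₀ (qn_pos hq (by omega)) (by norm_num)]
      linarith
    linarith
  obtain ⟨z, g1, g2, g3⟩ := exists_scaled (by omega) hle hW h𝒴d hint hTd hXT
  rw [← hM] at g1 g3
  have hqcases : 3 ≤ qr K ∨ qr K = 2 := by
    have h1 : 2 ≤ Fintype.card K := Fintype.one_lt_card
    rcases h1.eq_or_lt with h2 | h2
    · right; rw [qr, ← h2]; norm_num
    · left; rw [qr]; exact_mod_cast h2
  rcases hqcases with hq3 | hq2
  · have a1 := local_numeric_of_three_le hq3 hk4 hle g1 g2 g3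
    have a2 := nu_one_le_quarter hk (Or.inl ⟨hq3, hle⟩)
    exact finish hW1 (by linarith)
  rcases hle.eq_or_lt with hn2 | hn2
  swap
  · rw [hq2] at g1 g2 g3
    have a1 := local_numeric_of_two hk4 hn2 g1 g2 g3
    have a2 := nu_one_le_quarter hk (Or.inr ⟨hq2, hn2⟩)
    exact finish hW1 (by linarith)
  -- For q = 2 and n = 2k the bound on ν₁ is only 1/2. If all exchanged members lie in E ⊔ L, then 𝒴
  -- consists of hyperplanes of T and is tiny. Otherwise a second exchange gives T' ≠ T, and the
  -- weighted spaces must meet both.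
  by_cases hall : ∀ A ∈ exch k F L, A ≤ E ⊔ L
  · have hsub : 𝒴 ⊆ (Gr K (V ⧸ L) (k - 1)).filter (· ≤ T) := by
      intro X hX
      rw [mem_filter, mem_Gr]
      refine ⟨h𝒴d X hX, ?_⟩
      obtain ⟨A, hA, rfl⟩ := mem_image.1 hX
      exact Submodule.map_mono (hall A hA)
    have h1 : (𝒴.card : ℝ) ≤ qn (qr K) k := by
      rw [← card_hyperplanes (by omega) hTd]
      exact_mod_cast card_le_card hsub
    have a2 : ν₁ (qr K) n k ≤ 1 / 2 := by rw [hq2]; exact nu_one_le_half hk hle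
    refine finish hW1 ?_
    have h3 : (𝒴.card : ℝ) / M < 1 / 2 := by
      rw [div_lt_div_iff₀ hMpos (by norm_num)]
      have b1 := gb_pow_le hq (k - 2) k (k - 2)
      rw [gb_self hq, mul_one, show k - 2 + k = n - 2 by omega, ← hM, hq2] at b1
      have b2 : (2 : ℝ) ^ (k + 1) ≤ 2 ^ (k * (k - 2)) := by
        refine pow_le_pow_right₀ (by norm_num) ?_
        have : k * 2 ≤ k * (k - 2) := Nat.mul_le_mul_left k (by omega)
        omega
      have b3 := qn_mul (q := 2) k
      rw [hq2] at h1
      rw [pow_succ] at b2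
      linarith
    linarith
  · push Not at hall
    obtain ⟨B', hB'x, hB'E⟩ := hall
    rw [exch, mem_filter] at hB'x
    obtain ⟨hB', hLB', E', hE', hBE', hLE'⟩ := hB'x
    have hE2' : ∀ A ∈ F, L ≤ A → 2 ≤ finrank K (A ⊓ E' : Submodule K V) :=
      fun A hA hLA => h.two_le_finrank_inf_exch hB' hE' hBE' hL hLB' hA hLA
    have hB'T := le_of_adjacent (h.dim B' (mem_bad.1 hB').1) hBE' hL hLB' hLE'
    set T' := (E' ⊔ L).map L.mkQ with hT'
    have hT'd : finrank K T' = k := by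
      rw [hT', finrank_map_sup_mkQ hL hLE', h.dim E' (mem_bad.1 hE').1]
    have hTT : T ≠ T' := by
      intro he
      have := map_mkQ_injOn le_sup_right le_sup_right he
      exact hB'E (this ▸ hB'T)
    have ht := finrank_inf_lt hTd hT'd hTT
    obtain ⟨a, ha1, ha2⟩ := local_numeric_balanced hk4
    have b1 := h.sum_om_le_card hL (fun X => X ⊓ T ≠ ⊥ ∧ X ⊓ T' ≠ ⊥)
      (fun H hH hLH hex => ⟨h.meets_map hL hLE hE2 hH hLH hex,
        h.meets_map hL hLE' hE2' hH hLH hex⟩)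
    have b2 := card_meeting_two_le (d := k - 2) (by omega) (T := T) (T' := T') (by rw [hTd, hT'd])
    have r2 : gb (qr K) (n - 1 - 2) (k - 2 - 2)
        = qn (qr K) (k - 3) / qn (qr K) (n - 2) * (qn (qr K) (k - 2) / qn (qr K) (n - 1) * C) := by
      rw [← r1]
      have := gb_ratio hq (n := n - 2) (k := k - 3) (by omega) (by omega)
      rw [show n - 1 - 2 = n - 2 - 1 by omega, show k - 2 - 2 = k - 3 - 1 by omega, this]
      rfl
    rw [hTd, hW, r1, r2, hq2, ← hn2] at b2
    have hu := qn_nonneg (q := 2) (by norm_num) (finrank K (T ⊓ T' : Submodule K (V ⧸ L)))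
    have hu' := qn_mono (q := 2) (by norm_num)
      (show finrank K (T ⊓ T' : Submodule K (V ⧸ L)) ≤ k - 1 by omega)
    have hν := ha1 _ hu hu'
    have hW2 : W ≤ ν₂ k (qn 2 (finrank K (T ⊓ T' : Submodule K (V ⧸ L)))) * C := by
      refine b1.trans (b2.trans (le_of_eq ?_))
      rw [ν₂]; ring
    rw [hq2, ← hn2] at g1 g2 g3
    have hα := ha2 _ z g1 g2 g3
    exact finish hW2 (by linarith)

end CTF

end Local


/-! ### The bound, and the structure of extremal families. -/

section Extremal

set_option linter.unusedSectionVars false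

variable {K V : Type*} [Field K] [Fintype K] [AddCommGroup V] [Module K V] [FiniteDimensional K V]

lemma exists_extension {S A U : Submodule K V} (hS : S ≤ U) (hA : A ≤ U) {d : ℕ}
    (hd : finrank K S ≤ d) (h : finrank K A - finrank K (S ⊓ A : Submodule K V) + (d - finrank K S)
      ≤ finrank K U - finrank K S) :
    ∃ D : Submodule K V, finrank K D = d ∧ S ≤ D ∧ D ≤ U ∧ D ⊓ A = S ⊓ A := by
  have c := card_extensions hA (d - finrank K S) hS
  have hpos := dc_pos (qr_pos K) h
  rw [← c, show finrank K S + (d - finrank K S) = d by omega] at hpos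
  obtain ⟨D, hD⟩ := card_pos.1 (by exact_mod_cast hpos)
  simp only [mem_filter, mem_Gr] at hD
  exact ⟨D, hD⟩

lemma exists_point_not_le {A B : Submodule K V} (h : ¬ A ≤ B) :
    ∃ p : Submodule K V, finrank K p = 1 ∧ p ≤ A ∧ ¬ p ≤ B := by
  obtain ⟨x, hx, hxB⟩ := SetLike.not_le_iff_exists.1 h
  refine ⟨K ∙ x, finrank_span_singleton ?_, by simpa using hx, by simpa using hxB⟩
  rintro rfl; exact hxB B.zero_mem

lemma finrank_eq_one_of_inf {l H A : Submodule K V} (hl : finrank K l = 2) (hlA : l ≤ A)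
    (hHA : H ≤ A) (hd : finrank K A = finrank K H + 1) (h : ¬ l ≤ H) :
    finrank K (l ⊓ H : Submodule K V) = 1 := by
  have h1 := Submodule.finrank_sup_add_finrank_inf_eq l H
  have h2 := Submodule.finrank_mono (sup_le hlA hHA)
  have h3 : l ⊓ H < l := lt_of_le_of_ne inf_le_left fun e => h (inf_eq_left.1 e)
  have := Submodule.finrank_lt_finrank_of_lt h3
  omega

variable {k : ℕ} {F : Finset (Submodule K V)}

namespace CTF

variable (h : CTF k F)
include h

lemma local_le {L : Submodule K V} (hL : finrank K L = 1) :
    ∑ H ∈ (Gr K V (k - 1)).filter (L ≤ ·), om k F H +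
      qn (qr K) (finrank K V - 1) / dg K V k * (exch k F L).card ≤
      gb (qr K) (finrank K V - 1) (k - 2) := by
  have hk := h.two_le
  rcases (exch k F L).eq_empty_or_nonempty with he | hne
  · have c := card_superspaces L (k - 2)
    rw [hL, show 1 + (k - 2) = k - 1 by omega] at c
    rw [he, card_empty, Nat.cast_zero, mul_zero, add_zero, ← c]
    have : ∑ H ∈ (Gr K V (k - 1)).filter (L ≤ ·), om k F H ≤
        ((Gr K V (k - 1)).filter (L ≤ ·)).card • (1 : ℝ) :=
      sum_le_card_nsmul _ _ _ fun H hH => by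
        rw [mem_filter, mem_Gr] at hH
        exact h.om_le_one (by omega)
    simpa using this
  · exact (h.local_lt hL hne).le

/-- The right side is the sum of the local bounds over all points of V; the left side is the main
inequality evaluated at the target size. -/
lemma average_eq : qn (qr K) (k - 1) * (qn (qr K) (finrank K V) / dg K V k *
      gb (qr K) (finrank K V - 1) (k - 1)) =
    qn (qr K) (finrank K V) * gb (qr K) (finrank K V - 1) (k - 2) := by
  have hk := h.two_le
  have hle := h.le
  have hq := qr_pos K
  have hD := h.dg_pos
  have e := gb_absorb hq (finrank K V - 1) (k - 2)
  rw [show k - 2 + 1 = k - 1 by omega, qn_sub (by omega),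
    show finrank K V - 1 - (k - 2) = finrank K V + 1 - k by omega] at e
  have e2 : qn (qr K) (k - 1) * gb (qr K) (finrank K V - 1) (k - 1)
      = dg K V k * gb (qr K) (finrank K V - 1) (k - 2) := by
    apply mul_left_cancel₀ (pow_pos hq (k - 2)).ne'
    rw [dg]; linarith
  calc _ = qn (qr K) (finrank K V) / dg K V k *
        (qn (qr K) (k - 1) * gb (qr K) (finrank K V - 1) (k - 1)) := by ring
    _ = _ := by rw [e2]; field_simp

/-- The upper bound on the size of a family without covering triples. -/
theorem card_le : (F.card : ℝ) ≤ gb (qr K) (finrank K V - 1) (k - 1) := by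
  have hk := h.two_le
  have hle := h.le
  have hq := qr_pos K
  have hD := h.dg_pos
  have h1 := h.cstar_mul_card_le
  have h2 : ∑ L ∈ Gr K V 1, (∑ H ∈ (Gr K V (k - 1)).filter (L ≤ ·), om k F H +
        qn (qr K) (finrank K V - 1) / dg K V k * (exch k F L).card) ≤
      (Gr K V 1).card • gb (qr K) (finrank K V - 1) (k - 2) :=
    sum_le_card_nsmul _ _ _ fun L hL => h.local_le (mem_Gr.1 hL)
  rw [nsmul_eq_mul, card_Gr_one, ← h.average_eq] at h2
  have h3 := h1.trans h2
  have p1 := qn_pos hq (show 0 < k - 1 by omega)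
  have p2 := qn_pos hq (show 0 < finrank K V by omega)
  exact le_of_mul_le_mul_left (le_of_mul_le_mul_left h3 p1) (div_pos p2 hD)

section Equality

variable (heq : (F.card : ℝ) = gb (qr K) (finrank K V - 1) (k - 1))
include heq

lemma local_eq {L : Submodule K V} (hL : finrank K L = 1) :
    ∑ H ∈ (Gr K V (k - 1)).filter (L ≤ ·), om k F H +
      qn (qr K) (finrank K V - 1) / dg K V k * (exch k F L).card =
      gb (qr K) (finrank K V - 1) (k - 2) := by
  have h1 := h.cstar_mul_card_le
  rw [heq, h.average_eq, ← card_Gr_one, ← nsmul_eq_mul, ← sum_const] at h1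
  have h2 := (sum_eq_sum_iff_of_le fun L hL => h.local_le (mem_Gr.1 hL)).1
    (le_antisymm (sum_le_sum fun L hL => h.local_le (mem_Gr.1 hL)) h1)
  exact h2 L (mem_Gr.2 hL)

lemma exch_eq_empty {L : Submodule K V} (hL : finrank K L = 1) : exch k F L = ∅ := by
  by_contra hne
  exact (h.local_lt hL (nonempty_iff_ne_empty.2 hne)).ne (h.local_eq heq hL)

lemma om_eq_one {H : Submodule K V} (hH : finrank K H + 1 = k) : om k F H = 1 := by
  have hk := h.two_le
  obtain ⟨L, hL, hLH⟩ := exists_point (A := H) (by rintro rfl; rw [finrank_bot] at hH; omega)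
  have h1 := h.local_eq heq hL
  have c := card_superspaces L (k - 2)
  rw [hL, show 1 + (k - 2) = k - 1 by omega] at c
  rw [h.exch_eq_empty heq hL, card_empty, Nat.cast_zero, mul_zero, add_zero, ← c,
    card_eq_sum_ones, Nat.cast_sum] at h1
  have h2 := (sum_eq_sum_iff_of_le (f := fun H => om k F H) (g := fun _ => ((1 : ℕ) : ℝ))
    (s := (Gr K V (k - 1)).filter (L ≤ ·)) fun H hH => by
      rw [mem_filter, mem_Gr] at hH
      simpa using h.om_le_one (by omega)).1 h1
  simpa using h2 H (by rw [mem_filter, mem_Gr]; exact ⟨by omega, hLH⟩)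

lemma exists_member {H : Submodule K V} (hH : finrank K H + 1 = k) : ∃ A ∈ F, H ≤ A :=
  h.exists_of_om_ne_zero (by rw [h.om_eq_one heq hH]; exact one_ne_zero)

lemma shared_eq_empty {B : Submodule K V} (hB : B ∈ bad k F) : shared k F B = ∅ := by
  have hk := h.two_le
  rw [eq_empty_iff_forall_notMem]
  intro H hH
  have hH' := hH
  rw [shared, mem_filter, mem_Gr] at hH'
  obtain ⟨L, hL, hLB, hLH⟩ := exists_point_not_le (A := B) (B := H) (fun hle => by
    have := Submodule.finrank_mono hle
    have := h.dim B (mem_bad.1 hB).1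
    omega)
  have := h.mem_exch_of_shared hB hH hLB hLH
  rw [h.exch_eq_empty heq hL] at this
  exact notMem_empty _ this

/-- Without exchanges every member gives away at least [n]/D, while the total weight equals the
number of (k-1)-spaces, which is |F|·[n]/D. So there is no slack. -/
lemma sum_wt_eq {A : Submodule K V} (hA : A ∈ F) :
    qn (qr K) (finrank K V) / dg K V k =
      ∑ H ∈ (Gr K V (k - 1)).filter (· ≤ A), wt k F A H := by
  have hk := h.two_le
  have hle := h.le
  have hq := qr_pos K
  have hD := h.dg_pos
  have h1 : ∀ A ∈ F, qn (qr K) (finrank K V) / dg K V k ≤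
      ∑ H ∈ (Gr K V (k - 1)).filter (· ≤ A), wt k F A H := by
    intro A hA
    have h2 := h.cstar_le_sum_wt hA
    have : (Gr K V 1).filter (fun L => A ∈ exch k F L) = ∅ := by
      rw [filter_eq_empty_iff]
      intro L hL
      rw [h.exch_eq_empty heq (mem_Gr.1 hL)]
      exact notMem_empty A
    rwa [this, card_empty, Nat.cast_zero, mul_zero, add_zero] at h2
  have h2 : ∑ H ∈ Gr K V (k - 1), om k F H = gb (qr K) (finrank K V) (k - 1) := by
    rw [← card_Gr, card_eq_sum_ones, Nat.cast_sum]
    refine sum_congr rfl fun H hH => ?_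
    rw [mem_Gr] at hH
    rw [h.om_eq_one heq (by omega), Nat.cast_one]
  rw [h.sum_om_eq] at h2
  have h3 : ∑ _A ∈ F, qn (qr K) (finrank K V) / dg K V k
      = gb (qr K) (finrank K V) (k - 1) := by
    rw [sum_const, nsmul_eq_mul, heq]
    have e := gb_mul_right hq (n := finrank K V - 1) (k := k - 1) (by omega)
    rw [show finrank K V - 1 + 1 = finrank K V by omega,
      show finrank K V - (k - 1) = finrank K V + 1 - k by omega] at e
    rw [← mul_div_assoc, div_eq_iff hD.ne', dg, e]; ring
  exact (sum_eq_sum_iff_of_le h1).1 (h3.trans h2.symm) A hA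

/-- In the extremal case all spaces through some point of a bad member, inside a given
`(k + 1)`-space, are members. -/
lemma exists_local_star {B U : Submodule K V} (hB : B ∈ bad k F) (hBU : B ≤ U)
    (hU : finrank K U = k + 1) :
    ∃ c : Submodule K V, finrank K c = 1 ∧ c ≤ B ∧ (∀ A ∈ F, A ≤ U → c ≤ A) ∧
      ∀ A : Submodule K V, finrank K A = k → c ≤ A → A ≤ U → A ∈ F := by
  have hD := h.dg_pos
  refine (h.good_inside hB hBU hU).2 ?_
  have h1 := h.sum_wt_bad hB
  rw [h.shared_eq_empty heq hB, ← h.sum_wt_eq heq (mem_bad.1 hB).1, ← h.dg_mul_cstar_identity,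
    card_empty, Nat.cast_zero, sub_zero, sub_le_sub_iff_left, div_le_div_iff_of_pos_right hD,
    ← h.card_above_succ hB, ← nsmul_eq_mul, ← sum_const] at h1
  have h2 : ∀ U ∈ (Gr K V (k + 1)).filter (B ≤ ·),
      (((good k F).filter (· ≤ U)).card : ℝ) ≤ qn (qr K) k - 1 := by
    intro U hU
    rw [mem_filter, mem_Gr] at hU
    exact (h.good_inside hB hU.2 hU.1).1
  exact (sum_eq_sum_iff_of_le h2).1 (le_antisymm (sum_le_sum h2) (h1.trans (h.sum_gdeg_le hB))) U
    (by rw [mem_filter, mem_Gr]; exact ⟨hU, hBU⟩)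

/-- Around a bad B every (k+1)-space U carries a full local star with centre in B. As B is bad, some
adjacent A₀ misses the centre c of one such star, so the star in B ⊔ A₀ has another centre c'. Two
local stars through B, together with a member above every (k-1)-space, are rich enough to contain a
covering triple. -/
lemma bad_eq_empty : bad k F = ∅ := by
  have hk2 := h.two_le
  have hle := h.le
  rw [eq_empty_iff_forall_notMem]
  intro B hB
  have hk : 3 ≤ k := by
    by_contra hcon
    have := h.bad_eq_empty_of_two (by omega)
    rw [this] at hB
    exact absurd hB (notMem_empty B)
  have hBF := (mem_bad.1 hB).1
  have hBd := h.dim B hBF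
  -- two local stars with different centres
  obtain ⟨U, hBU, -, hU⟩ := exists_between (le_top : B ≤ ⊤) (d := k + 1) (by omega)
    (by rw [finrank_top]; omega)
  obtain ⟨c, hc, hcB, hcU, hcF⟩ := h.exists_local_star heq hB hBU hU
  have hn := (mem_bad.1 hB).2
  rw [not_exists] at hn
  have hn := hn c
  simp only [IsCentre, not_and, not_forall, exists_prop] at hn
  obtain ⟨A₀, hA₀, hA₀B, hd, hcA₀⟩ := hn hc hcB
  have hU' : finrank K (B ⊔ A₀ : Submodule K V) = k + 1 := by
    have := Submodule.finrank_sup_add_finrank_inf_eq B A₀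
    have := h.dim A₀ hA₀
    omega
  set U' := B ⊔ A₀ with hU'def
  have hBU' : B ≤ U' := le_sup_left
  obtain ⟨c', hc', hc'B, hc'U, hc'F⟩ := h.exists_local_star heq hB hBU' hU'
  have hc'A₀ := hc'U A₀ hA₀ le_sup_right
  have hUU' : U ≠ U' := by
    intro e
    exact hcA₀ (hcU A₀ hA₀ (e ▸ le_sup_right))
  have hUU : U ⊓ U' = B := inf_eq_of_hyperplane hU hU' hUU' (by omega) hBU hBU'
  have hc'c : ¬ c' ≤ c := by
    intro hle'
    have := Submodule.eq_of_le_of_finrank_eq hle' (by omega)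
    exact hcA₀ (this ▸ hc'A₀)
  have hcc : c ⊓ c' = ⊥ := by rw [inf_comm]; exact inf_eq_bot_of_point hc' hc'c
  -- a member `A` of the first star
  obtain ⟨H, hHd, hcH, hHB, hHc'⟩ := exists_extension hcB hc'B (d := k - 1) (by omega) (by
    rw [hcc, finrank_bot]; omega)
  rw [hcc] at hHc'
  obtain ⟨A, hAd, hHA, hAU, hAB⟩ := exists_extension (hHB.trans hBU) hBU (d := k) (by omega) (by
    rw [inf_eq_left.2 hHB]; omega)
  rw [inf_eq_left.2 hHB] at hAB
  have hAF := hcF A hAd (hcH.trans hHA) hAU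
  have hABne : A ≠ B := by
    rintro rfl
    rw [inf_idem] at hAB
    rw [hAB] at hAd; omega
  obtain ⟨p, hp, hpA, hpB⟩ := exists_point_not_le (A := A) (B := B) (fun hle' =>
    hABne (Submodule.eq_of_le_of_finrank_eq hle' (by omega)))
  have hpH : ¬ p ≤ H := fun h' => hpB (h'.trans hHB)
  -- J meets A only in p, and a member C above J exceeds J by one dimension. Hence A ⊓ C is either p
  -- or a line through p.
  obtain ⟨J, hJd, hpJ, -, hJA⟩ := exists_extension (le_top : p ≤ ⊤) (le_top : A ≤ ⊤) (d := k - 1)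
    (by omega) (by rw [inf_eq_left.2 hpA, finrank_top]; omega)
  rw [inf_eq_left.2 hpA] at hJA
  obtain ⟨C, hC, hJC⟩ := h.exists_member heq (H := J) (by omega)
  have hCd := h.dim C hC
  have hpC := hpJ.trans hJC
  have hBC : B ≠ C := by rintro rfl; exact hpB hpC
  have hCA2 : finrank K (A ⊓ C : Submodule K V) ≤ 2 := by
    have h1 := Submodule.finrank_sup_add_finrank_inf_eq (A ⊓ C) J
    have h2 : (A ⊓ C) ⊓ J = p := by
      apply le_antisymm
      · rw [← hJA]; exact le_inf inf_le_right (inf_le_left.trans inf_le_left)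
      · exact le_inf (le_inf hpA hpC) hpJ
    have h3 := Submodule.finrank_mono (sup_le (inf_le_right : A ⊓ C ≤ C) hJC)
    rw [h2] at h1
    omega
  have hpAC : p ≤ A ⊓ C := le_inf hpA hpC
  have hCA1 := Submodule.finrank_mono hpAC
  have hACne : A ≠ C := by
    rintro rfl
    rw [inf_idem] at hCA2; omega
  -- If A ⊓ C = p, then A = H ⊕ p with H = A ⊓ B. If it is a line l, then B is replaced by a member
  -- A' of the second star that meets A in a complement S of l.
  rcases (show finrank K (A ⊓ C : Submodule K V) = 1 ∨ finrank K (A ⊓ C : Submodule K V) = 2 by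
    omega) with h1 | h1
  · have hAC : A ⊓ C = p := (Submodule.eq_of_le_of_finrank_eq hpAC (by omega)).symm
    refine h.free A hAF B hBF C hC ⟨hAd, hBd, hCd, hABne, hACne, hBC, ?_, ?_⟩
    · rw [hAB, hAC]
      exact Submodule.eq_of_le_of_finrank_eq (sup_le hHA hpA) (by
        rw [finrank_sup_point hp hpH]; omega)
    · rw [hAB, hAC, inf_comm]
      exact inf_eq_bot_of_point hp hpH
  · set l := A ⊓ C with hl
    have hlH : ¬ l ≤ H := fun h' => hpH (hpAC.trans h')
    have hr := finrank_eq_one_of_inf h1 inf_le_left hHA (by omega) hlH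
    set r := l ⊓ H
    -- S is a complement in H of the point r where l meets H, hence a complement of l in A.
    obtain ⟨S, hSd, -, hSH, hSr⟩ := exists_extension (A := r) (bot_le : ⊥ ≤ H) inf_le_right
      (d := k - 2) (by rw [finrank_bot]; omega) (by rw [bot_inf_eq, finrank_bot]; omega)
    rw [bot_inf_eq] at hSr
    have hc'S : ¬ c' ≤ S := by
      intro h'
      have : c' ≤ H ⊓ c' := le_inf (h'.trans hSH) le_rfl
      rw [hHc', le_bot_iff] at this
      rw [this, finrank_bot] at hc'; omega
    have hSc' := finrank_sup_point hc' hc'S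
    have hSc'B : S ⊔ c' ≤ B := sup_le (hSH.trans hHB) hc'B
    obtain ⟨A', hA'd, hSA', hA'U, hA'B⟩ := exists_extension (hSc'B.trans hBU') hBU' (d := k)
      (by omega) (by rw [inf_eq_left.2 hSc'B]; omega)
    rw [inf_eq_left.2 hSc'B] at hA'B
    have hA'F := hc'F A' hA'd (le_sup_right.trans hSA') hA'U
    -- Since U ⊓ U' = B, the intersection A ⊓ A' lies in H ⊓ (S ⊔ c'), which is S because H was
    -- chosen to avoid c'.
    have hAA' : A ⊓ A' = S := by
      have e1 : A ⊓ A' ≤ B := by rw [← hUU]; exact inf_le_inf hAU hA'U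
      have e2 : A ⊓ A' ≤ H ⊓ (S ⊔ c') := by
        rw [← hAB, ← hA'B]
        exact le_inf (le_inf inf_le_left e1) (le_inf inf_le_right e1)
      have e3 : H ⊓ (S ⊔ c') = S := by
        have := sup_inf_assoc_of_le c' hSH
        rw [inf_comm c' H, hHc', sup_bot_eq, inf_comm] at this
        exact this
      rw [e3] at e2
      exact le_antisymm e2 (le_inf (hSH.trans hHA) (le_sup_left.trans hSA'))
    have hSl : S ⊓ l = ⊥ := by
      rw [eq_bot_iff, ← hSr]
      exact le_inf inf_le_left (le_inf inf_le_right (inf_le_left.trans hSH))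
    refine h.free A hAF A' hA'F C hC ⟨hAd, hA'd, hCd, ?_, hACne, ?_, ?_, ?_⟩
    · rintro rfl
      rw [inf_idem] at hAA'
      rw [hAA'] at hAd; omega
    · rintro rfl
      rw [← hl.trans hAA', inf_idem] at hSl
      rw [hSl, finrank_bot] at h1; omega
    · rw [hAA', ← hl]
      refine Submodule.eq_of_le_of_finrank_eq (sup_le (hSH.trans hHA) inf_le_left) ?_
      have := Submodule.finrank_sup_add_finrank_inf_eq S l
      rw [hSl, finrank_bot] at this
      omega
    · rw [hAA', ← hl]; exact hSl

lemma mem_good_of_mem {A : Submodule K V} (hA : A ∈ F) : A ∈ good k F := by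
  by_contra hg
  have := (mem_bad_iff hA).2 hg
  rw [h.bad_eq_empty heq] at this
  exact notMem_empty _ this

/-- In the extremal case, all spaces above a hyperplane of `X` through the centre of `X` are
members, with centres in this hyperplane. -/
lemma full_above {X H : Submodule K V} (hX : X ∈ F) (hHX : H ≤ X) (hH : finrank K H + 1 = k)
    (hc : ctr k F X ≤ H) {Y : Submodule K V} (hY : finrank K Y = k) (hHY : H ≤ Y) :
    Y ∈ F ∧ ctr k F Y ≤ H := by
  have hD := h.dg_pos
  have hctr : ∀ A ∈ F, H ≤ A → ctr k F A ≤ H := by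
    intro A hA hHA
    by_contra hcon
    have := h.eq_of_not_ctr_le hA (isCentre_ctr (h.mem_good_of_mem heq hA)) hX hH hHA hHX hcon
    exact hcon (this ▸ hc)
  have h1 := h.om_eq_one heq hH
  have h2 : om k F H = (F.filter (H ≤ ·)).card * (1 / dg K V k) := by
    rw [om, ← nsmul_eq_mul, ← sum_const]
    refine sum_congr rfl fun A hA => ?_
    rw [mem_filter] at hA
    rw [wt, if_pos (h.mem_good_of_mem heq hA.1), if_pos (hctr A hA.1 hA.2)]
  rw [h2, mul_one_div, div_eq_one_iff_eq hD.ne', ← h.card_above hH] at h1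
  have h3 : F.filter (H ≤ ·) = (Gr K V k).filter (H ≤ ·) := by
    refine eq_of_subset_of_card_le (fun A hA => ?_) (by exact_mod_cast h1.ge)
    rw [mem_filter] at hA ⊢
    exact ⟨mem_Gr.2 (h.dim A hA.1), hA.2⟩
  have h4 : Y ∈ F.filter (H ≤ ·) := by rw [h3, mem_filter, mem_Gr]; exact ⟨hY, hHY⟩
  rw [mem_filter] at h4
  exact ⟨h4.1, hctr Y h4.1 h4.2⟩

/-- Suppose the centres of X and Y differ. Take S of codimension one in H through the centre of X
but not that of Y, and hyperplanes P of X and Q of Y with P ⊓ H = Q ⊓ H = S. Then P ⊔ Q is a member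
by `full_above`. It contains Q, which misses the centre of Y, so it equals Y. This forces P ≤ X ⊓ Y
= H, which is impossible. -/
lemma ctr_eq {X H : Submodule K V} (hX : X ∈ F) (hHX : H ≤ X) (hH : finrank K H + 1 = k)
    (hc : ctr k F X ≤ H) {Y : Submodule K V} (hY : finrank K Y = k) (hHY : H ≤ Y) :
    ctr k F Y = ctr k F X := by
  by_contra hne
  have hXd := h.dim X hX
  obtain ⟨hYF, hcY⟩ := h.full_above heq hX hHX hH hc hY hHY
  have cX := isCentre_ctr (h.mem_good_of_mem heq hX)
  have cY := isCentre_ctr (h.mem_good_of_mem heq hYF)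
  have hXY : X ≠ Y := by rintro rfl; exact hne rfl
  have hXYH := inf_eq_of_hyperplane hXd hY hXY hH hHX hHY
  have hnle : ¬ ctr k F Y ≤ ctr k F X := fun hle =>
    hne (Submodule.eq_of_le_of_finrank_eq hle (by rw [cX.1, cY.1]))
  have hbot : ctr k F X ⊓ ctr k F Y = ⊥ := by
    rw [inf_comm]; exact inf_eq_bot_of_point cY.1 hnle
  have hH2 : 2 ≤ finrank K H := by
    have h1 := finrank_sup_point cY.1 hnle
    have h2 := Submodule.finrank_mono (sup_le hc hcY)
    have := cX.1
    omega
  have c1 := cX.1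
  have c2 := cY.1
  obtain ⟨S, hSd, hcS, hSH, hSY⟩ := exists_extension hc hcY (d := k - 2) (by omega) (by
    rw [hbot, finrank_bot]; omega)
  rw [hbot] at hSY
  have hcYS : ¬ ctr k F Y ≤ S := by
    intro h'
    have : ctr k F Y ≤ S ⊓ ctr k F Y := le_inf h' le_rfl
    rw [hSY, le_bot_iff] at this
    rw [this, finrank_bot] at c2; omega
  obtain ⟨P, hPd, hSP, hPX, hPH⟩ := exists_extension (hSH.trans hHX) hHX (d := k - 1) (by omega)
    (by rw [inf_eq_left.2 hSH]; omega)
  obtain ⟨Q, hQd, hSQ, hQY, hQH⟩ := exists_extension (hSH.trans hHY) hHY (d := k - 1) (by omega)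
    (by rw [inf_eq_left.2 hSH]; omega)
  rw [inf_eq_left.2 hSH] at hPH hQH
  have hPQ : P ⊓ Q = S := by
    apply le_antisymm
    · have : P ⊓ Q ≤ H := by rw [← hXYH]; exact inf_le_inf hPX hQY
      rw [← hPH]; exact le_inf inf_le_left this
    · exact le_inf hSP hSQ
  have hsup : finrank K (P ⊔ Q : Submodule K V) = k := by
    have := Submodule.finrank_sup_add_finrank_inf_eq P Q
    rw [hPQ] at this; omega
  obtain ⟨hPQF, -⟩ := h.full_above heq hX hPX (by omega) (hcS.trans hSP) hsup le_sup_left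
  have hcYQ : ¬ ctr k F Y ≤ Q := by
    intro h'
    exact hcYS (hQH ▸ le_inf h' hcY)
  have e := h.eq_of_not_ctr_le hYF cY hPQF (by omega) hQY le_sup_right hcYQ
  have hPle : P ≤ H := by
    rw [← hXYH]; exact le_inf hPX (e ▸ le_sup_left)
  rw [inf_eq_left.2 hPle] at hPH
  rw [hPH] at hPd; omega

/-- Walk from X to W one exchange at a time. Keep a hyperplane H of X containing X ⊓ W, hence the
centre, and add a point of W. The new space is a member with the same centre and meets W in one more
dimension. -/
lemma mem_of_ctr_le (j : ℕ) {X W : Submodule K V} (hX : X ∈ F) (hW : finrank K W = k)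
    (hcW : ctr k F X ≤ W) (hj : finrank K (X ⊓ W : Submodule K V) + j = k) : W ∈ F := by
  induction j generalizing X with
  | zero =>
    have hXd := h.dim X hX
    have h1 : X ⊓ W = X := Submodule.eq_of_le_of_finrank_eq inf_le_left (by omega)
    have h2 : X = W := Submodule.eq_of_le_of_finrank_eq (inf_eq_left.1 h1) (by omega)
    exact h2 ▸ hX
  | succ j ih =>
    have hXd := h.dim X hX
    have cX := isCentre_ctr (h.mem_good_of_mem heq hX)
    obtain ⟨H, hH1, hHX, hHd⟩ := exists_between (inf_le_left : X ⊓ W ≤ X) (d := k - 1) (by omega)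
      (by omega)
    have hcH : ctr k F X ≤ H := (le_inf cX.2.1 hcW).trans hH1
    obtain ⟨p, hp, hpW, hpX⟩ := exists_point_not_le (A := W) (B := X) (fun hle => by
      rw [inf_eq_right.2 hle] at hj; omega)
    have hpH : ¬ p ≤ H := fun h' => hpX (h'.trans hHX)
    have hYd : finrank K (H ⊔ p : Submodule K V) = k := by
      have := h.two_le
      rw [finrank_sup_point hp hpH]; omega
    have hk := h.two_le
    obtain ⟨hYF, -⟩ := h.full_above heq hX hHX (by omega) hcH hYd le_sup_left
    have hYc := h.ctr_eq heq hX hHX (by omega) hcH hYd le_sup_left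
    have hlt : X ⊓ W ⊔ p ≤ (H ⊔ p) ⊓ W :=
      sup_le (le_inf (hH1.trans le_sup_left) inf_le_right) (le_inf le_sup_right hpW)
    have h1 := Submodule.finrank_mono hlt
    rw [finrank_sup_point hp (fun h' => hpX (h'.trans inf_le_left))] at h1
    -- strengthen to an exact drop by one
    have h2 : finrank K ((H ⊔ p) ⊓ W : Submodule K V) ≤ finrank K (X ⊓ W : Submodule K V) + 1 := by
      have h3 := Submodule.finrank_sup_add_finrank_inf_eq ((H ⊔ p) ⊓ W) H
      have h4 := Submodule.finrank_mono
        (sup_le (inf_le_left : (H ⊔ p) ⊓ W ≤ H ⊔ p) (le_sup_left : H ≤ H ⊔ p))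
      have h5 : (H ⊔ p) ⊓ W ⊓ H ≤ X ⊓ W :=
        le_inf (inf_le_right.trans hHX) (inf_le_left.trans inf_le_right)
      have h6 := Submodule.finrank_mono h5
      omega
    exact ih hYF (hYc ▸ hcW) (by omega)

/-- A family attaining the bound is a full star. -/
theorem eq_fullStar : ∃ L : Submodule K V, finrank K L = 1 ∧
    (F : Set (Submodule K V)) = fullStar k L := by
  have hk := h.two_le
  have hle := h.le
  have hq := qr_pos K
  have hne : F.Nonempty := by
    rw [← card_pos]
    have := gb_pos hq (show k - 1 ≤ finrank K V - 1 by omega)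
    rw [← heq] at this
    exact_mod_cast this
  obtain ⟨X, hX⟩ := hne
  have cX := isCentre_ctr (h.mem_good_of_mem heq hX)
  refine ⟨ctr k F X, cX.1, ?_⟩
  have hsub : (Gr K V k).filter (ctr k F X ≤ ·) ⊆ F := by
    intro W hW
    rw [mem_filter, mem_Gr] at hW
    have hXd := h.dim X hX
    have := Submodule.finrank_mono (inf_le_left : X ⊓ W ≤ X)
    exact h.mem_of_ctr_le heq (k - finrank K (X ⊓ W : Submodule K V)) hX hW.1 hW.2 (by omega)
  have hcard := card_superspaces (ctr k F X) (k - 1)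
  rw [cX.1, show 1 + (k - 1) = k by omega, ← heq] at hcard
  have he := eq_of_subset_of_card_le hsub (by exact_mod_cast hcard.ge)
  ext W
  rw [mem_coe, ← Finset.ext_iff.1 he W, mem_filter, mem_Gr]
  rfl

end Equality

end CTF

end Extremal

/-! ### Agreement of the two forms of the Gaussian binomial. -/

section GaussianBinomial

lemma cast_qInt (q m : ℕ) : ((qInt q m : ℚ) : ℝ) = qn q m := by
  simp [qInt, qn]

lemma qFactorial_succ (q m : ℕ) : qFactorial q (m + 1) = qFactorial q m * qInt q (m + 1) := by
  simp [qFactorial, prod_range_succ]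

lemma cast_qFactorial_pos {q : ℕ} (hq : 0 < q) (m : ℕ) : 0 < ((qFactorial q m : ℚ) : ℝ) := by
  have hq' : (0 : ℝ) < q := by exact_mod_cast hq
  induction m with
  | zero => simp [qFactorial]
  | succ m ih =>
    rw [qFactorial_succ, Rat.cast_mul, cast_qInt]
    exact mul_pos ih (qn_pos hq' (Nat.succ_pos m))

lemma cast_gaussBinom {q : ℕ} (hq : 0 < q) {n j : ℕ} (h : j ≤ n) :
    ((gaussBinom q n j : ℚ) : ℝ) = gb q n j := by
  have hq' : (0 : ℝ) < q := by exact_mod_cast hq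
  induction n generalizing j with
  | zero =>
    obtain rfl : j = 0 := by omega
    simp [gaussBinom, qFactorial]
  | succ n ih =>
    cases j with
    | zero =>
      have := (cast_qFactorial_pos hq (n + 1)).ne'
      rw [gb_zero_right, gaussBinom, Rat.cast_div, Rat.cast_mul, Nat.sub_zero]
      simp [show qFactorial q 0 = 1 from rfl, this]
    | succ j =>
      have h1 := ih (j := j) (by omega)
      have p1 := (cast_qFactorial_pos hq j).ne'
      have p2 := (cast_qFactorial_pos hq (n - j)).ne'
      have p3 := (qn_pos hq' (Nat.succ_pos j)).ne'
      rw [gb_succ_succ, ← h1, gaussBinom, gaussBinom, qFactorial_succ, qFactorial_succ,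
        show n + 1 - (j + 1) = n - j by omega]
      push_cast
      rw [cast_qInt, cast_qInt]
      field_simp

end GaussianBinomial

/-! ### Covering triples, 3-clusters and stars. -/

section Configurations

variable {K V : Type*} [Field K] [AddCommGroup V] [Module K V] [FiniteDimensional K V]

/-- Every covering triple is a 3-cluster. -/
lemma IsCoveringTriple.isThreeCluster {k : ℕ} {A B C : Submodule K V}
    (h : IsCoveringTriple k A B C) : IsThreeCluster k A B C := by
  refine ⟨h.finrank_left, h.finrank_mid, h.finrank_right, h.ne_left_mid, h.ne_left_right,
    h.ne_mid_right, ?_, ?_⟩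
  · rw [eq_bot_iff, ← h.disjoint]
    exact le_inf inf_le_left (le_inf (inf_le_left.trans inf_le_left) inf_le_right)
  · have h1 : A ⊔ B ⊔ C ≤ B ⊔ C := by
      refine sup_le (sup_le ?_ le_sup_left) le_sup_right
      rw [← h.sum_eq]
      exact sup_le_sup inf_le_right inf_le_right
    have h2 := Submodule.finrank_mono h1
    have h3 := Submodule.finrank_sup_add_finrank_inf_eq B C
    have := h.finrank_mid
    have := h.finrank_right
    omega

omit [FiniteDimensional K V] in
lemma IsStar.threeClusterFree {k : ℕ} {F : Set (Submodule K V)} (h : IsStar F) :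
    ThreeClusterFree k F := by
  obtain ⟨L, hL, hF⟩ := h
  intro A hA B hB C hC hcl
  have : L ≤ ⊥ := hcl.inf_eq ▸ le_inf (le_inf (hF A hA) (hF B hB)) (hF C hC)
  rw [le_bot_iff] at this
  rw [this, finrank_bot] at hL
  omega

lemma ThreeClusterFree.coveringTripleFree {k : ℕ} {F : Set (Submodule K V)}
    (h : ThreeClusterFree k F) : CoveringTripleFree k F :=
  fun A hA B hB C hC ht => h A hA B hB C hC ht.isThreeCluster

lemma coveringTripleFree_bound [Fintype K] {n k : ℕ} (hn : finrank K V = n) (hk : 2 ≤ k)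
    (hkn : 2 * k ≤ n) {F : Set (Submodule K V)} (hF : IsFamily k F) (hfree : CoveringTripleFree k F) :
    (F.ncard : ℚ) ≤ gaussBinom (Fintype.card K) (n - 1) (k - 1) ∧
      ((F.ncard : ℚ) = gaussBinom (Fintype.card K) (n - 1) (k - 1) →
        ∃ L : Submodule K V, finrank K L = 1 ∧ F = fullStar k L) := by
  obtain ⟨G, rfl⟩ : ∃ G : Finset (Submodule K V), (G : Set (Submodule K V)) = F :=
    ⟨F.toFinite.toFinset, by simp⟩
  have h : CTF k G := ⟨hk, by omega, fun A hA => hF A hA, hfree⟩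
  have e := cast_gaussBinom (q := Fintype.card K) Fintype.card_pos (show k - 1 ≤ n - 1 by omega)
  have h1 := h.card_le
  rw [hn, qr, ← e] at h1
  rw [Set.ncard_coe_finset]
  refine ⟨by exact_mod_cast h1, fun heq => h.eq_fullStar ?_⟩
  rw [hn, qr, ← e, ← heq]
  norm_cast

lemma ncard_fullStar [Fintype K] {n k : ℕ} (hn : finrank K V = n) (hk : 1 ≤ k) (hkn : k ≤ n)
    {L : Submodule K V} (hL : finrank K L = 1) :
    ((fullStar k L).ncard : ℚ) = gaussBinom (Fintype.card K) (n - 1) (k - 1) := by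
  have e := cast_gaussBinom (q := Fintype.card K) Fintype.card_pos (show k - 1 ≤ n - 1 by omega)
  have c := card_superspaces L (k - 1)
  rw [hL, hn, qr, ← e, show 1 + (k - 1) = k by omega] at c
  have : fullStar k L = (((Gr K V k).filter (L ≤ ·) : Finset (Submodule K V)) : Set _) := by
    ext A
    rw [mem_coe, mem_filter, mem_Gr]
    rfl
  rw [this, Set.ncard_coe_finset]
  exact_mod_cast c

end Configurations

end

end SubspaceCluster

theorem theorem4p9 {K V : Type*} [Field K] [Fintype K] [AddCommGroup V] [Module K V]
    [FiniteDimensional K V] (n k : ℕ) (hn : Module.finrank K V = n) (hk : 2 ≤ k)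
    (hkn : 2 * k ≤ n) :
    -- the bound, and uniqueness, for covering-triple-free families
    (∀ F : Set (Submodule K V), IsFamily k F → CoveringTripleFree k F →
      (F.ncard : ℚ) ≤ gaussBinom (Fintype.card K) (n - 1) (k - 1) ∧
      (2 * k < n → (F.ncard : ℚ) = gaussBinom (Fintype.card K) (n - 1) (k - 1) →
        ∃ L : Submodule K V, Module.finrank K L = 1 ∧ F = fullStar k L)) ∧
    -- every covering triple is a 3-cluster
    (∀ A B C : Submodule K V, IsCoveringTriple k A B C → IsThreeCluster k A B C) ∧
    -- the bound, and uniqueness, for 3-cluster-free families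
    (∀ F : Set (Submodule K V), IsFamily k F → ThreeClusterFree k F →
      (F.ncard : ℚ) ≤ gaussBinom (Fintype.card K) (n - 1) (k - 1) ∧
      (2 * k < n → (F.ncard : ℚ) = gaussBinom (Fintype.card K) (n - 1) (k - 1) →
        ∃ L : Submodule K V, Module.finrank K L = 1 ∧ F = fullStar k L)) ∧
    -- stars are free of both configurations, and full stars attain the bound
    (∀ F : Set (Submodule K V), IsFamily k F → IsStar F →
      CoveringTripleFree k F ∧ ThreeClusterFree k F) ∧
    (∀ L : Submodule K V, Module.finrank K L = 1 →
      ((fullStar k L).ncard : ℚ) = gaussBinom (Fintype.card K) (n - 1) (k - 1)) := by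
  refine ⟨fun F hF hfree => ?_, fun A B C ht => ht.isThreeCluster, fun F hF hfree => ?_,
    fun F _ hs => ⟨hs.threeClusterFree.coveringTripleFree, hs.threeClusterFree⟩,
    fun L hL => ncard_fullStar hn (by omega) (by omega) hL⟩
  · obtain ⟨h1, h2⟩ := coveringTripleFree_bound hn hk hkn hF hfree
    exact ⟨h1, fun _ => h2⟩
  · obtain ⟨h1, h2⟩ := coveringTripleFree_bound hn hk hkn hF hfree.coveringTripleFree
    exact ⟨h1, fun _ => h2⟩
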